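/- Let $N\ge 3$ be odd, $F=\mathbf Z/2\mathbf Z$, and $[i,j]=\{h\in\mathbf Z: i\le h\le j\}$. The subsets of $[1,N]$ form an $F$-vector space under symmetric difference (written $+$); let $E_N$ be the subspace of subsets of even cardinality. A two-element subset $\{i,j\}$ of $[1,N]$ is written $ij$ if either $i<j$ and $j-i$ is odd, or $i>j$ and $i-j$ is even; put $[[ij]]=[i,j]$ in the first case and $[[ij]]=[i,N]\cup[1,j]$ in the second. **The sets $\mathcal X^\pm_{N-2}$.** Let $\mathcal P_N$ be the set of all sets $B$ of pairwise disjoint two-element subsets of $[1,N]$. For $B\in\mathcal P_N$ let $\mathrm{supp}(B)$ be the union of the members of $B$, let $\langle B\rangle\subset E_N$ be the $F$-span of the members of $B$, and let $B^0$ (resp. $B^1$) be the set of $\{i,j\}\in B$ with $i-j$ even (resp. odd). A set is $0$-covered if it is a (possibly empty) disjoint union of intervals $[a,b]$ with $ab\in B^1$, and $1$-covered if it is the disjoint union of a $0$-covered set and a one-element set. Let ${}^*\mathcal P_N$ be the set of $B\in\mathcal P_N$ such that $[i+1,j-1]$ is $0$-covered for all $ij\in B^1$, and such that there are $i_1<i_2<\dots<i_{2s}$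 (necessarily unique, with $s=|B^0|$) with $B^0=\{i_{2s}i_1,i_{2s-1}i_2,\dots,i_{s+1}i_s\}$ and with $[i_k+1,i_{k+1}-1]$ $0$-covered for all $k\in[1,2s-1]$, $k\ne s$. Consider the conditions: * (I) $s=0$, or $[1,i_1-1]$ and $[i_{2s}+1,N]$ are $0$-covered. * (II) $N\notin\mathrm{supp}(B)$ and either $s=0$, or $s$ is odd and one of the following holds: (i) $[1,i_1-1]$ is $1$-covered and $[i_{2s}+1,N-1]$ is $0$-covered; (ii) $[1,i_1-1]$ is $0$-covered and $[i_{2s}+1,N-1]$ is $1$-covered. * (III) (I) holds and $\{i,N\}\in B$ for some $i\equiv s\pmod 2$. Let $\mathcal X^+_{N-2}$ (resp. $\mathcal X^-_{N-2}$) be the set of $B\in{}^*\mathcal P_N$ satisfying (II) (resp. (III)), and $\mathcal X_{N-2}=\mathcal X^+_{N-2}\sqcup\mathcal X^-_{N-2}$. For $B\in\mathcal X_{N-2}^+$ with $s>0$ let $u_B$ be the unique $u$ such that, in case (i), $u\in[1,i_1-1]$ and $[1,u-1],[u+1,i_1-1]$ are $0$-covered, and, in case (ii), $u\in[i_{2s}+1,N-1]$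 and $[i_{2s}+1,u-1],[u+1,N-1]$ are $0$-covered. **The map $'\epsilon$, the coefficients $'c$ and the order $\preceq$.** For $B\in\mathcal X_{N-2}$ set $'\epsilon(B)=\sum_{ij\in B}[[ij]]$, except that if $B\in\mathcal X^+_{N-2}$ and $|B^0|>0$ one adds $[u_B,N]$ when $u_B$ is even, and $\{N\}+[1,u_B]$ when $u_B$ is odd. The map $'\epsilon:\mathcal X_{N-2}\to E_N$ is a bijection. For $X,X'\in E_N$ put $'\langle X\rangle=\langle {}'\epsilon^{-1}(X)\rangle$, and let $'c_{X',X}\in\mathbf Z$ be $1$ if $X'\in{}'\langle X\rangle$ and $0$ otherwise. For $B',B\in\mathcal X_{N-2}$ write $B'\preceq B$ if there are $B'=B_0,B_1,\dots,B_h=B$ in $\mathcal X_{N-2}$ with $'\epsilon(B_k)\in\langle B_{k+1}\rangle$ for $0\le k<h$; for $X',X\in E_N$ write $X'\preceq X$ if $'\epsilon^{-1}(X')\preceq{}'\epsilon^{-1}(X)$. **Orbits.** Let $\gamma(X)$ be the number of even elements of $X$ minus the number of odd elements of $X$. Put $$E_N^+=\{X\in E_N: N\notin X\},\qquad E_N^-=\{X\in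 E_N:N\in X\},$$ $$'E_N^+=\{X\in E_N^+:\gamma(X)<0,\text{ or }\gamma(X)=0\text{ and }N-1\notin X\},\qquad {}'E_N^-=\{X\in E_N^-:\gamma(X)\ge 0\}.$$ For each sign $\pm$, let $\bar E_N^\pm$ be the set of orbits of the involution $X\mapsto X+[1,N-1]$ of $E_N^\pm$. Each orbit $Y\in\bar E_N^\pm$ contains exactly one element $\tilde Y$ of $'E_N^\pm$. Let $\mathbf Z[\bar E_N^\pm]$ be the group of functions $\bar E_N^\pm\to\mathbf Z$, let $\psi_Y$ be the characteristic function of $\{Y\}$, and set $$\tilde\psi_Y=\sum_{Y'\in\bar E_N^\pm}c^\pm_{Y',Y}\,\psi_{Y'},\qquad c^\pm_{Y',Y}=\sum_{X\in Y'}{}'c_{X,\tilde Y}.$$ For $Y',Y\in\bar E_N^\pm$ write $Y'\,\bar\preceq\,Y$ if there are $Y'=Y_0,Y_1,\dots,Y_k=Y$ in $\bar E_N^\pm$ such that for each $i\in[0,k-1]$ either $\tilde Y_i\preceq\tilde Y_{i+1}$, or $|\gamma(\tilde Y_i)|<|\gamma(\tilde Y_{i+1})|$ (sign $+$), resp. $|\gamma(\tilde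 Y_i)+1|<|\gamma(\tilde Y_{i+1})+1|$ (sign $-$). **Statement.** With the bijectivity of $'\epsilon$ and the existence and uniqueness of $\tilde Y$ (which make the definitions meaningful) included in the claim, for each of the two signs $\pm$: 1. $\bar\preceq$ is a partial order on $\bar E_N^\pm$. 2. The matrix $(c^\pm_{Y',Y})$ relating $\{\tilde\psi_Y\}$ to $\{\psi_Y\}$ is unitriangular for $\bar\preceq$ with entries in $\{0,1\}$: one has $c^\pm_{Y',Y}\in\{0,1\}$ for all $Y',Y$; $c^\pm_{Y',Y}\ne0$ implies $Y'\,\bar\preceq\,Y$; and $c^\pm_{Y,Y}=1$ for all $Y$. 3. $\{\tilde\psi_Y: Y\in\bar E_N^\pm\}$ is a $\mathbf Z$-basis of $\mathbf Z[\bar E_N^\pm]$. -/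

import Mathlib

open scoped symmDiff

namespace Lusztig

/-! ### Subsets of `[1,N]`

A subset of `S_N = [1,N]` is a `Finset ℕ`; the sum in the `F`-vector space of all subsets
(`F = ℤ/2ℤ`) is the symmetric difference `∆`. -/

/-- The sum `∑_{a ∈ s} f a` in the `F`-vector space of finite subsets of `ℕ`. -/
def fsum {α : Type*} (s : Finset α) (f : α → Finset ℕ) : Finset ℕ :=
  s.fold (· ∆ ·) ∅ f

/-- `E_N`: the subsets of `[1,N]` of even cardinality. -/
def E (N : ℕ) : Finset (Finset ℕ) :=
  (Finset.Icc 1 N).powerset.filter fun X => Even X.card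

/-- The two-element subsets of `[1,N]`. The subset `{i,j}` is recorded by its spelling `ij`, the
ordered pair `(i,j)` with `i < j`, `j - i` odd, or `i > j`, `i - j` even
(each two-element subset has exactly one such spelling, see `existsUnique_spelling`). -/
def pairs (N : ℕ) : Finset (ℕ × ℕ) :=
  (Finset.Icc 1 N ×ˢ Finset.Icc 1 N).filter fun p =>
    (p.1 < p.2 ∧ Odd (p.2 - p.1)) ∨ (p.2 < p.1 ∧ Even (p.1 - p.2))

/-- The two-element set spelled by `ij`. -/
def pairSet (p : ℕ × ℕ) : Finset ℕ := {p.1, p.2}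

theorem existsUnique_spelling (N : ℕ) (X : Finset ℕ) (hX : X ⊆ Finset.Icc 1 N)
    (h2 : X.card = 2) : ∃! p, p ∈ pairs N ∧ pairSet p = X := by
  obtain ⟨a, b, hab, rfl⟩ := Finset.card_eq_two.1 h2
  have ha := hX (Finset.mem_insert_self a {b})
  have hb := hX (Finset.mem_insert_of_mem (Finset.mem_singleton_self b))
  wlog hlt : a < b generalizing a b
  · have := this b a hab.symm (by rwa [Finset.pair_comm]) (by rwa [Finset.pair_comm]) hb ha
      (by omega)
    rwa [Finset.pair_comm] at this
  have key : ∀ p : ℕ × ℕ, pairSet p = {a, b} → p = (a, b) ∨ p = (b, a) := by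
    rintro ⟨c, d⟩ h
    have hc : c ∈ ({a, b} : Finset ℕ) := h ▸ by simp [pairSet]
    have hd : d ∈ ({a, b} : Finset ℕ) := h ▸ by simp [pairSet]
    have ha' : a ∈ pairSet (c, d) := h ▸ by simp
    have hb' : b ∈ pairSet (c, d) := h ▸ by simp
    simp only [pairSet, Finset.mem_insert, Finset.mem_singleton] at hc hd ha' hb'
    simp only [Prod.mk.injEq]
    omega
  rcases Nat.even_or_odd (b - a) with he | ho
  · refine ⟨(b, a), ⟨?_, by simp [pairSet, Finset.pair_comm]⟩, ?_⟩
    · simp [pairs, -Finset.mem_Icc, ha, hb, hlt, he]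
    · rintro p ⟨hp, hs⟩
      rcases key p hs with rfl | rfl
      · simp only [pairs, Finset.mem_filter] at hp
        rcases hp.2 with h | h
        · exact absurd he (Nat.not_even_iff_odd.2 h.2)
        · omega
      · rfl
  · refine ⟨(a, b), ⟨?_, by simp [pairSet]⟩, ?_⟩
    · simp [pairs, -Finset.mem_Icc, ha, hb, hlt, ho]
    · rintro p ⟨hp, hs⟩
      rcases key p hs with rfl | rfl
      · rfl
      · simp only [pairs, Finset.mem_filter] at hp
        rcases hp.2 with h | h
        · omega
        · exact absurd ho (Nat.not_odd_iff_even.2 h.2)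

/-- `P_N`: the sets of pairwise disjoint two-element subsets of `[1,N]`. -/
def P (N : ℕ) : Finset (Finset (ℕ × ℕ)) :=
  (pairs N).powerset.filter fun B =>
    ∀ p ∈ B, ∀ q ∈ B, p ≠ q → Disjoint (pairSet p) (pairSet q)

/-- `supp(B)`, the union of the members of `B`. -/
def supp (B : Finset (ℕ × ℕ)) : Finset ℕ := B.biUnion pairSet

/-- `B⁰`: the members `ij` of `B` with `i - j` even (so `i > j`). -/
def B0 (B : Finset (ℕ × ℕ)) : Finset (ℕ × ℕ) := B.filter fun p => p.2 < p.1

/-- `B¹`: the members `ij` of `B` with `i - j` odd (so `i < j`). -/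
def B1 (B : Finset (ℕ × ℕ)) : Finset (ℕ × ℕ) := B.filter fun p => p.1 < p.2

/-- `X` is `0`-covered by `C` (used for `C = B¹`): `X` is a disjoint union of intervals `[a,b]`
with `ab ∈ C`. -/
def ZeroCovered (C : Finset (ℕ × ℕ)) (X : Finset ℕ) : Prop :=
  ∃ D ∈ C.powerset,
    (∀ p ∈ D, ∀ q ∈ D, p ≠ q → Disjoint (Finset.Icc p.1 p.2) (Finset.Icc q.1 q.2)) ∧
    D.biUnion (fun p => Finset.Icc p.1 p.2) = X

instance (C : Finset (ℕ × ℕ)) (X : Finset ℕ) : Decidable (ZeroCovered C X) := by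
  unfold ZeroCovered; infer_instance

/-- `X` is `1`-covered by `C`: `X` is the disjoint union of a `0`-covered set and a singleton. -/
def OneCovered (C : Finset (ℕ × ℕ)) (X : Finset ℕ) : Prop :=
  ∃ u ∈ X, ZeroCovered C (X.erase u)

instance (C : Finset (ℕ × ℕ)) (X : Finset ℕ) : Decidable (OneCovered C X) := by
  unfold OneCovered; infer_instance

/-- The `k`-th term `i_k` (`1 ≤ k ≤ 2|B⁰|`) of the sequence `i_*(B)`. Since
`i_1 < i_2 < ⋯ < i_{2s}` and `B⁰ = {i_{2s} i_1, …, i_{s+1} i_s}`, the sequence is the increasing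
enumeration of `supp(B⁰)`. -/
def iStar (B : Finset (ℕ × ℕ)) (k : ℕ) : ℕ :=
  ((supp (B0 B)).sort (· ≤ ·)).getD (k - 1) 0

/-- The last term `i_{2s}` of `i_*(B)`, `s = |B⁰|`. -/
def iLast (B : Finset (ℕ × ℕ)) : ℕ := iStar B (2 * (B0 B).card)

/-- The conditions defining `*P_N`. -/
def IsStar (B : Finset (ℕ × ℕ)) : Prop :=
  (∀ p ∈ B1 B, ZeroCovered (B1 B) (Finset.Icc (p.1 + 1) (p.2 - 1))) ∧
  B0 B = (Finset.Icc 1 (B0 B).card).image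
    (fun k => (iStar B (2 * (B0 B).card + 1 - k), iStar B k)) ∧
  (∀ k ∈ Finset.Icc 1 ((B0 B).card - 1),
    ZeroCovered (B1 B) (Finset.Icc (iStar B k + 1) (iStar B (k + 1) - 1))) ∧
  (∀ k ∈ Finset.Icc ((B0 B).card + 1) (2 * (B0 B).card - 1),
    ZeroCovered (B1 B) (Finset.Icc (iStar B k + 1) (iStar B (k + 1) - 1)))

instance (B : Finset (ℕ × ℕ)) : Decidable (IsStar B) := by
  unfold IsStar; infer_instance

/-- `*P_N`. -/
def starP (N : ℕ) : Finset (Finset (ℕ × ℕ)) := (P N).filter IsStar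

/-- Condition (I). -/
def CondI (N : ℕ) (B : Finset (ℕ × ℕ)) : Prop :=
  (B0 B).card = 0 ∨
    (ZeroCovered (B1 B) (Finset.Icc 1 (iStar B 1 - 1)) ∧
      ZeroCovered (B1 B) (Finset.Icc (iLast B + 1) N))

instance (N : ℕ) (B : Finset (ℕ × ℕ)) : Decidable (CondI N B) := by
  unfold CondI; infer_instance

/-- Condition (i) inside (II). -/
def CondIIi (N : ℕ) (B : Finset (ℕ × ℕ)) : Prop :=
  OneCovered (B1 B) (Finset.Icc 1 (iStar B 1 - 1)) ∧
    ZeroCovered (B1 B) (Finset.Icc (iLast B + 1) (N - 1))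

instance (N : ℕ) (B : Finset (ℕ × ℕ)) : Decidable (CondIIi N B) := by
  unfold CondIIi; infer_instance

/-- Condition (ii) inside (II). -/
def CondIIii (N : ℕ) (B : Finset (ℕ × ℕ)) : Prop :=
  ZeroCovered (B1 B) (Finset.Icc 1 (iStar B 1 - 1)) ∧
    OneCovered (B1 B) (Finset.Icc (iLast B + 1) (N - 1))

instance (N : ℕ) (B : Finset (ℕ × ℕ)) : Decidable (CondIIii N B) := by
  unfold CondIIii; infer_instance

/-- Condition (II). -/
def CondII (N : ℕ) (B : Finset (ℕ × ℕ)) : Prop :=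
  N ∉ supp B ∧ ((B0 B).card = 0 ∨ (Odd (B0 B).card ∧ (CondIIi N B ∨ CondIIii N B)))

instance (N : ℕ) (B : Finset (ℕ × ℕ)) : Decidable (CondII N B) := by
  unfold CondII; infer_instance

/-- Condition (III): (I), and `{i,N} ∈ B` for some `i` with `i ≡ |B⁰| mod 2`. -/
def CondIII (N : ℕ) (B : Finset (ℕ × ℕ)) : Prop :=
  CondI N B ∧
    (Even (B0 B).card → ∃ p ∈ B, ∃ i ∈ Finset.Icc 1 N, Even i ∧ pairSet p = {i, N}) ∧
    (Odd (B0 B).card → ∃ p ∈ B, ∃ i ∈ Finset.Icc 1 N, Odd i ∧ pairSet p = {i, N})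

instance (N : ℕ) (B : Finset (ℕ × ℕ)) : Decidable (CondIII N B) := by
  unfold CondIII; infer_instance

/-- `X_{N-2}^+`. -/
def XPlus (N : ℕ) : Finset (Finset (ℕ × ℕ)) := (starP N).filter (CondII N)

/-- `X_{N-2}^-`. -/
def XMinus (N : ℕ) : Finset (Finset (ℕ × ℕ)) := (starP N).filter (CondIII N)

/-- `X_{N-2} = X_{N-2}^+ ⊔ X_{N-2}^-`. -/
def X (N : ℕ) : Finset (Finset (ℕ × ℕ)) := XPlus N ∪ XMinus N

/-- The property that characterizes `u_B`, for `B ∈ X_{N-2}^+` with `|B⁰| > 0`. -/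
def IsU (N : ℕ) (B : Finset (ℕ × ℕ)) (u : ℕ) : Prop :=
  (CondIIi N B ∧ u ∈ Finset.Icc 1 (iStar B 1 - 1) ∧
    ZeroCovered (B1 B) (Finset.Icc 1 (u - 1)) ∧
    ZeroCovered (B1 B) (Finset.Icc (u + 1) (iStar B 1 - 1))) ∨
  (CondIIii N B ∧ u ∈ Finset.Icc (iLast B + 1) (N - 1) ∧
    ZeroCovered (B1 B) (Finset.Icc (iLast B + 1) (u - 1)) ∧
    ZeroCovered (B1 B) (Finset.Icc (u + 1) (N - 1)))

instance (N : ℕ) (B : Finset (ℕ × ℕ)) (u : ℕ) : Decidable (IsU N B u) := by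
  unfold IsU; infer_instance

/-- `u_B`: the unique `u ∈ [1,N]` with `IsU N B u` (written as the largest such `u`). -/
def uB (N : ℕ) (B : Finset (ℕ × ℕ)) : ℕ := ((Finset.Icc 1 N).filter (IsU N B)).sup id

/-- `[[ij]]`: the interval `[i,j]` if `i < j` (then `j - i` is odd), and `[i,N] ∪ [1,j]` if
`i > j` (then `i - j` is even). -/
def dbl (N : ℕ) (p : ℕ × ℕ) : Finset ℕ :=
  if p.1 < p.2 then Finset.Icc p.1 p.2 else Finset.Icc p.1 N ∪ Finset.Icc 1 p.2

/-- The map `′ε : X_{N-2} → E_N`. -/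
def eps (N : ℕ) (B : Finset (ℕ × ℕ)) : Finset ℕ :=
  if B ∈ XPlus N ∧ (B0 B).card ≠ 0 then
    if Even (uB N B) then fsum B (dbl N) ∆ Finset.Icc (uB N B) N
    else fsum B (dbl N) ∆ {N} ∆ Finset.Icc 1 (uB N B)
  else fsum B (dbl N)

/-- `<B>`: the `F`-span of the members of `B`, i.e. the set of all their `F`-linear
combinations. -/
def span (B : Finset (ℕ × ℕ)) : Finset (Finset ℕ) :=
  B.powerset.image fun D => fsum D pairSet

/-- The inverse of `′ε : X_{N-2} → E_N`. -/
noncomputable def epsInv (N : ℕ) (Z : Finset ℕ) : Finset (ℕ × ℕ) :=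
  Function.invFunOn (eps N) (X N : Set (Finset (ℕ × ℕ))) Z

/-- `B' ⪯ B` on `X_{N-2}`: there are `B' = B_0, B_1, …, B_h = B` in `X_{N-2}` with
`′ε(B_k) ∈ <B_{k+1}>` for all `k < h`. -/
def PrecB (N : ℕ) : Finset (ℕ × ℕ) → Finset (ℕ × ℕ) → Prop :=
  Relation.ReflTransGen fun B' B => B' ∈ X N ∧ B ∈ X N ∧ eps N B' ∈ span B

/-- `Z' ⪯ Z` on `E_N`. -/
def Prec (N : ℕ) (Z' Z : Finset ℕ) : Prop := PrecB N (epsInv N Z') (epsInv N Z)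

open Classical in
/-- The coefficient `′c_{Z',Z}` of `ψ_{Z'}` in `ψ_{′<Z>}`, where `′<Z> = <′ε⁻¹(Z)>`. -/
noncomputable def cPrime (N : ℕ) (Z' Z : Finset ℕ) : ℤ :=
  if Z' ∈ span (epsInv N Z) then 1 else 0

/-- `γ(Z) = |Z ∩ 2ℤ| - |Z ∩ (2ℤ + 1)|`. -/
def gam (Z : Finset ℕ) : ℤ :=
  ((Z.filter fun k => Even k).card : ℤ) - ((Z.filter fun k => Odd k).card : ℤ)

/-- The two values of the superscript `±`. -/
inductive Sgn : Type
  | plus : Sgn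
  | minus : Sgn

/-- `E_N^+ = {Z ∈ E_N ; N ∉ Z}` and `E_N^- = {Z ∈ E_N ; N ∈ Z}`. -/
def ES (N : ℕ) : Sgn → Finset (Finset ℕ)
  | Sgn.plus => (E N).filter fun Z => N ∉ Z
  | Sgn.minus => (E N).filter fun Z => N ∈ Z

/-- The subsets `′E_N^+` and `′E_N^-` of `E_N^+` and `E_N^-`. -/
def EPrime (N : ℕ) : Sgn → Finset (Finset ℕ)
  | Sgn.plus => (ES N Sgn.plus).filter fun Z => (gam Z = 0 ∧ N - 1 ∉ Z) ∨ gam Z < 0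
  | Sgn.minus => (ES N Sgn.minus).filter fun Z => 0 ≤ gam Z

/-- The set of orbits of the involution `Z ↦ Z + [1,N-1]` on `E_N^±`. An orbit is the finite set
`{Z, Z + [1,N-1]}` of its elements. -/
def EBar (N : ℕ) (σ : Sgn) : Finset (Finset (Finset ℕ)) :=
  (ES N σ).image fun Z => {Z, Z ∆ Finset.Icc 1 (N - 1)}

/-- `Ỹ`: the unique element of the orbit `Y` that lies in `′E_N^±`. -/
noncomputable def rep (N : ℕ) (σ : Sgn) (Y : EBar N σ) : Finset ℕ :=
  Classical.epsilon fun Z => Z ∈ Y.1 ∧ Z ∈ EPrime N σ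

/-- `|γ(Z)|` for the sign `+`, `|γ(Z) + 1|` for the sign `-`. -/
def height : Sgn → Finset ℕ → ℤ
  | Sgn.plus, Z => |gam Z|
  | Sgn.minus, Z => |gam Z + 1|

/-- `c^±_{Y',Y} = ∑_{Z ∈ Y'} ′c_{Z,Ỹ}`. -/
noncomputable def cBar (N : ℕ) (σ : Sgn) (Y' Y : EBar N σ) : ℤ :=
  ∑ Z ∈ Y'.1, cPrime N Z (rep N σ Y)

/-- The standard basis element `ψ_Y` of the group of functions on the set of orbits. -/
def psi (N : ℕ) (σ : Sgn) (Y : EBar N σ) : EBar N σ → ℤ := Pi.single Y 1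

/-- `ψ̃_Y = ∑_{Y'} c^±_{Y',Y} ψ_{Y'}`. -/
noncomputable def psiTilde (N : ℕ) (σ : Sgn) (Y : EBar N σ) : EBar N σ → ℤ :=
  ∑ Y' : EBar N σ, cBar N σ Y' Y • psi N σ Y'

/-- `Y' ⪯̄ Y`: there are orbits `Y' = Y_0, Y_1, …, Y_k = Y` such that for each `i < k` either
`Ỹ_i ⪯ Ỹ_{i+1}`, or `|γ(Ỹ_i)| < |γ(Ỹ_{i+1})|` (sign `+`),
`|γ(Ỹ_i) + 1| < |γ(Ỹ_{i+1}) + 1|` (sign `-`). -/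
def PrecBar (N : ℕ) (σ : Sgn) : EBar N σ → EBar N σ → Prop :=
  Relation.ReflTransGen fun Y' Y =>
    Prec N (rep N σ Y') (rep N σ Y) ∨ height σ (rep N σ Y') < height σ (rep N σ Y)

end Lusztig

/-! ### Matchings, rotated versions of γ, and depth. -/

namespace Lusztig

/-! Place `[1,N]` on a circle and read `[[ij]]` as an arc from `i` to `j`. Cutting the circle after
`h` gives a rotated version `gamAt h` of γ, always even on `E N`. Moving the cut past `h + 1` turns
a value `g` into `-g` or `-g - 2`, according to whether `h + 1` lies in the set (`gamAt_succ`). The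
map `fold` numbers the even integers 0, -2, 2, -4, 4, … by 0, 1, 2, 3, 4, …, and both moves pass to
a neighbouring number or fix 0. So each `Z` in `E N` gives a nonnegative periodic walk on the
circle, and the walk determines `Z` (`eq_of_fold_eq`).

Such walks are the depth functions of noncrossing arc systems. If `Z` is the sum of the arcs of a
system, its walk counts the arcs over each cut (`fold_fsum_dbl`); conversely the excursions of the
walk of `Z` form a system with sum `Z` (`exists_arcSystem`), and the system is unique
(`eq_of_fsum_dbl_eq`). The elements of `X N` encode arc systems: those of `XMinus` are the systems
whose sum contains `N`, those of `XPlus` the others with the arc at `N`, if any, deleted. The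
correction by `u_B` in ′ε restores that arc. Hence `bijOn_eps`.

For a cut `h`, the arcs over it carry signs whose total is 0 or 1, so a sum of pairs from the system
has a walk bounded by the depth (`fold_supp_le`). Thus `Z' ⪯ Z` implies that the walk of `Z'` lies
below that of `Z`, which gives antisymmetry.

The involution preserves |γ|, resp. |γ + 1|, here called `height`. In the span attached to a
representative, an element that is not itself a representative has strictly smaller height
(`height_lt`), and no orbit lies in the span entirely (`not_both_mem_span`). Ordering
lexicographically by height and walk gives the partial order and the unitriangularity; a
unitriangular integer matrix has determinant 1. -/

theorem mem_fsum {α : Type*} (s : Finset α) (f : α → Finset ℕ) (x : ℕ) :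
    x ∈ fsum s f ↔ Odd (s.filter fun a => x ∈ f a).card := by
  classical
  induction s using Finset.induction_on with
  | empty => simp [fsum]
  | insert a s ha ih =>
    have h : fsum (insert a s) f = f a ∆ fsum s f := by
      simp only [fsum]; rw [Finset.fold_insert ha]
    rw [h, Finset.mem_symmDiff, ih, Finset.filter_insert]
    by_cases hx : x ∈ f a
    · rw [if_pos hx, Finset.card_insert_of_notMem (by simp [ha]), Nat.odd_add_one]
      tauto
    · rw [if_neg hx]; tauto

theorem fsum_insert {α : Type*} [DecidableEq α] {s : Finset α} {a : α} (ha : a ∉ s)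
    (f : α → Finset ℕ) : fsum (insert a s) f = f a ∆ fsum s f := by
  simp only [fsum]; rw [Finset.fold_insert ha]

theorem mem_pairSet {p : ℕ × ℕ} {x : ℕ} : x ∈ pairSet p ↔ x = p.1 ∨ x = p.2 := by
  simp [pairSet]

theorem fst_mem_pairSet (p : ℕ × ℕ) : p.1 ∈ pairSet p := by simp [pairSet]

theorem snd_mem_pairSet (p : ℕ × ℕ) : p.2 ∈ pairSet p := by simp [pairSet]

theorem mem_supp {B : Finset (ℕ × ℕ)} {x : ℕ} : x ∈ supp B ↔ ∃ p ∈ B, x ∈ pairSet p := by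
  simp [supp]

theorem mem_pairs {N : ℕ} {p : ℕ × ℕ} : p ∈ pairs N ↔
    1 ≤ p.1 ∧ p.1 ≤ N ∧ 1 ≤ p.2 ∧ p.2 ≤ N ∧
      ((p.1 < p.2 ∧ (p.2 - p.1) % 2 = 1) ∨ (p.2 < p.1 ∧ (p.1 - p.2) % 2 = 0)) := by
  simp only [pairs, Finset.mem_filter, Finset.mem_product, Finset.mem_Icc, Nat.odd_iff,
    Nat.even_iff]
  tauto

theorem mem_dbl {N : ℕ} {p : ℕ × ℕ} (hp : p ∈ pairs N) {x : ℕ} : x ∈ dbl N p ↔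
    (p.1 < p.2 ∧ p.1 ≤ x ∧ x ≤ p.2) ∨
      (p.2 < p.1 ∧ ((p.1 ≤ x ∧ x ≤ N) ∨ (1 ≤ x ∧ x ≤ p.2))) := by
  rw [mem_pairs] at hp
  unfold dbl
  split_ifs with h
  · simp only [Finset.mem_Icc]; omega
  · simp only [Finset.mem_union, Finset.mem_Icc]; omega

/-- A set of pairwise disjoint two-element subsets of `[1,N]`. -/
structure IsMatching (N : ℕ) (C : Finset (ℕ × ℕ)) : Prop where
  sub : ∀ p ∈ C, p ∈ pairs N
  disj : ∀ p ∈ C, ∀ q ∈ C, ∀ x, x ∈ pairSet p → x ∈ pairSet q → p = q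

theorem mem_P {N : ℕ} {B : Finset (ℕ × ℕ)} : B ∈ P N ↔ IsMatching N B := by
  simp only [P, Finset.mem_filter, Finset.mem_powerset]
  constructor
  · rintro ⟨h1, h2⟩
    refine ⟨fun p hp => h1 hp, fun p hp q hq x hx hx' => ?_⟩
    by_contra hne
    exact Finset.disjoint_left.1 (h2 p hp q hq hne) hx hx'
  · rintro ⟨h1, h2⟩
    refine ⟨fun p hp => h1 p hp, fun p hp q hq hne => Finset.disjoint_left.2 fun x hx hx' => ?_⟩
    exact hne (h2 p hp q hq x hx hx')

/-- The sign of `x` in the rotation of `[1,N]` that starts after `h`. -/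
def sg (h x : ℕ) : ℤ := if h < x then (-1) ^ (x + h) else -(-1) ^ (x + h)

/-- The analogue of `γ` for the rotation of `[1,N]` that starts after `h`. -/
def gamAt (h : ℕ) (Z : Finset ℕ) : ℤ := ∑ x ∈ Z, sg h x

/-- The arc `p` passes from `h` to `h + 1` (from `N` to `1` if `h` is `0` or `N`). -/
def Crosses (h : ℕ) (p : ℕ × ℕ) : Prop :=
  (p.1 < p.2 ∧ p.1 ≤ h ∧ h < p.2) ∨ (p.2 < p.1 ∧ (p.1 ≤ h ∨ h < p.2))

instance (h : ℕ) (p : ℕ × ℕ) : Decidable (Crosses h p) := by unfold Crosses; infer_instance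

/-- Sign and parity in linear form, so that later sign identities reduce to `omega`. -/
theorem sg_cases (h x : ℕ) : (sg h x = 1 ∧ ((h < x ∧ (x + h) % 2 = 0) ∨ (x ≤ h ∧ (x + h) % 2 = 1))) ∨
    (sg h x = -1 ∧ ((h < x ∧ (x + h) % 2 = 1) ∨ (x ≤ h ∧ (x + h) % 2 = 0))) := by
  unfold sg
  rcases Nat.even_or_odd (x + h) with he | ho
  · rw [he.neg_one_pow]; rw [Nat.even_iff] at he; split_ifs <;> simp <;> omega
  · rw [ho.neg_one_pow]; rw [Nat.odd_iff] at ho; split_ifs <;> simp <;> omega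

/-- Moving the cut past `h + 1` reverses every sign except that of `h + 1`, which is `-1` before and
after. -/
theorem gamAt_succ (h : ℕ) (Z : Finset ℕ) :
    gamAt (h + 1) Z = -gamAt h Z - 2 * (if h + 1 ∈ Z then 1 else 0) := by
  have key : ∀ x, sg (h + 1) x = -sg h x - 2 * (if x = h + 1 then 1 else 0) := by
    intro x
    have h1 := sg_cases h x
    have h2 := sg_cases (h + 1) x
    split_ifs <;> omega
  unfold gamAt
  rw [Finset.sum_congr rfl fun x _ => key x, Finset.sum_sub_distrib, Finset.sum_neg_distrib,
    ← Finset.mul_sum, Finset.sum_ite_eq']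

/-- After a full turn each sign has been reversed `N - 1` times, an even number. -/
theorem gamAt_period {N : ℕ} (hodd : Odd N) {Z : Finset ℕ} (hZ : Z ⊆ Finset.Icc 1 N) :
    gamAt N Z = gamAt 0 Z := by
  refine Finset.sum_congr rfl fun x hx => ?_
  have := Finset.mem_Icc.1 (hZ hx)
  have h1 := sg_cases N x
  have h2 := sg_cases 0 x
  rw [Nat.odd_iff] at hodd
  omega

theorem gamAt_zero {N : ℕ} {Z : Finset ℕ} (hZ : Z ⊆ Finset.Icc 1 N) : gamAt 0 Z = gam Z := by
  unfold gamAt gam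
  rw [Finset.card_filter, Finset.card_filter]
  push_cast
  rw [← Finset.sum_sub_distrib]
  refine Finset.sum_congr rfl fun x hx => ?_
  have := Finset.mem_Icc.1 (hZ hx)
  have h1 := sg_cases 0 x
  simp only [Nat.odd_iff, Nat.even_iff]
  split_ifs <;> omega

theorem gamAt_even {Z : Finset ℕ} (hZ : Even Z.card) (h : ℕ) : Even (gamAt h Z) := by
  have : ∀ x, ∃ k : ℤ, sg h x = 1 + 2 * k := fun x => by
    rcases sg_cases h x with h | h
    · exact ⟨0, by omega⟩
    · exact ⟨-1, by omega⟩
  choose k hk using this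
  unfold gamAt
  rw [Finset.sum_congr rfl fun x _ => hk x, Finset.sum_add_distrib, ← Finset.mul_sum]
  simp only [Finset.sum_const, nsmul_eq_mul, mul_one]
  exact (by exact_mod_cast hZ : Even ((Z.card : ℕ) : ℤ)).add (even_two_mul _)

/-- The signed crossing indicator. -/
def crossSign (h : ℕ) (p : ℕ × ℕ) : ℤ := if Crosses h p then -sg h p.1 else 0

/-- The number of arcs of `C` that pass from `h` to `h + 1`. -/
def depth (C : Finset (ℕ × ℕ)) (h : ℕ) : ℤ := ∑ p ∈ C, if Crosses h p then 1 else 0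

/-- The parity in the spelling makes the two endpoints cancel when the cut is not under the arc, and
carry equal signs when it is. -/
theorem gamAt_pairSet {N : ℕ} {p : ℕ × ℕ} (hp : p ∈ pairs N) (h : ℕ) :
    gamAt h (pairSet p) = -2 * crossSign h p := by
  rw [mem_pairs] at hp
  have h1 := sg_cases h p.1
  have h2 := sg_cases h p.2
  have hne : p.1 ≠ p.2 := by omega
  unfold gamAt pairSet crossSign Crosses
  rw [Finset.sum_pair hne]
  split_ifs <;> omega

/-- An arc enters with sign `+1`, alternates from cut to cut, and by the parity of its spelling has
sign `+1` again at its last cut. -/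
theorem crossSign_succ {N : ℕ} {p : ℕ × ℕ} (hp : p ∈ pairs N) (h : ℕ) :
    crossSign (h + 1) p = -crossSign h p + if h + 1 ∈ pairSet p then 1 else 0 := by
  rw [mem_pairs] at hp
  have h1 := sg_cases h p.1
  have h2 := sg_cases (h + 1) p.1
  simp only [mem_pairSet]
  unfold crossSign Crosses
  split_ifs <;> omega

theorem crosses_period {N : ℕ} {p : ℕ × ℕ} (hp : p ∈ pairs N) : Crosses N p ↔ Crosses 0 p := by
  rw [mem_pairs] at hp
  unfold Crosses
  omega

namespace IsMatching

variable {N : ℕ} {C : Finset (ℕ × ℕ)}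

theorem mono (hC : IsMatching N C) {D : Finset (ℕ × ℕ)} (h : D ⊆ C) : IsMatching N D :=
  ⟨fun p hp => hC.sub p (h hp), fun p hp q hq => hC.disj p (h hp) q (h hq)⟩

theorem sum_mem_pairSet (hC : IsMatching N C) (x : ℕ) :
    ∑ p ∈ C, (if x ∈ pairSet p then (1 : ℤ) else 0) = if x ∈ supp C then 1 else 0 := by
  split_ifs with h
  · obtain ⟨p, hp, hx⟩ := mem_supp.1 h
    rw [Finset.sum_eq_single p, if_pos hx]
    · intro q hq hne
      rw [if_neg fun hx' => hne (hC.disj q hq p hp x hx' hx)]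
    · exact fun h => absurd hp h
  · refine Finset.sum_eq_zero fun p hp => if_neg fun hx => h (mem_supp.2 ⟨p, hp, hx⟩)

theorem card_supp (hC : IsMatching N C) : (supp C).card = 2 * C.card := by
  unfold supp
  rw [Finset.card_biUnion]
  · rw [Finset.sum_congr rfl (g := fun _ => 2), Finset.sum_const, smul_eq_mul, mul_comm]
    intro p hp
    have := mem_pairs.1 (hC.sub p hp)
    unfold pairSet
    rw [Finset.card_pair (by omega)]
  · intro p hp q hq hne
    exact Finset.disjoint_left.2 fun x hx hx' => hne (hC.disj p hp q hq x hx hx')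

theorem supp_subset (hC : IsMatching N C) : supp C ⊆ Finset.Icc 1 N := by
  intro x hx
  obtain ⟨p, hp, hx⟩ := mem_supp.1 hx
  have := mem_pairs.1 (hC.sub p hp)
  rw [mem_pairSet] at hx
  rw [Finset.mem_Icc]; omega

theorem mem_fsum_pairSet (hC : IsMatching N C) (x : ℕ) :
    x ∈ fsum C pairSet ↔ x ∈ supp C := by
  rw [mem_fsum, mem_supp]
  constructor
  · intro h
    obtain ⟨p, hp⟩ := Finset.card_pos.1 h.pos
    exact ⟨p, (Finset.mem_filter.1 hp).1, (Finset.mem_filter.1 hp).2⟩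
  · rintro ⟨p, hp, hx⟩
    have : C.filter (fun a => x ∈ pairSet a) = {p} := by
      ext q
      simp only [Finset.mem_filter, Finset.mem_singleton]
      constructor
      · rintro ⟨hq, hx'⟩; exact hC.disj q hq p hp x hx' hx
      · rintro rfl; exact ⟨hp, hx⟩
    rw [this]; simp

theorem fsum_pairSet (hC : IsMatching N C) : fsum C pairSet = supp C :=
  Finset.ext hC.mem_fsum_pairSet

theorem gamAt_supp (hC : IsMatching N C) (h : ℕ) :
    gamAt h (supp C) = ∑ p ∈ C, -2 * crossSign h p := by
  unfold gamAt supp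
  rw [Finset.sum_biUnion]
  · exact Finset.sum_congr rfl fun p hp => gamAt_pairSet (hC.sub p hp) h
  · intro p hp q hq hne
    exact Finset.disjoint_left.2 fun x hx hx' => hne (hC.disj p hp q hq x hx hx')

theorem sum_fst_eq (hC : IsMatching N C) (x : ℕ) :
    ∑ p ∈ C, (if p.1 = x then (1 : ℤ) else 0) = if ∃ p ∈ C, p.1 = x then 1 else 0 := by
  split_ifs with h
  · obtain ⟨p, hp, hx⟩ := h
    rw [Finset.sum_eq_single p, if_pos hx]
    · intro q hq hne
      exact if_neg fun hx' => hne (hC.disj q hq p hp x (mem_pairSet.2 (by simp [hx']))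
        (mem_pairSet.2 (by simp [hx])))
    · exact fun h => absurd hp h
  · exact Finset.sum_eq_zero fun p hp => if_neg fun hx => h ⟨p, hp, hx⟩

theorem sum_snd_eq (hC : IsMatching N C) (x : ℕ) :
    ∑ p ∈ C, (if p.2 = x then (1 : ℤ) else 0) = if ∃ p ∈ C, p.2 = x then 1 else 0 := by
  split_ifs with h
  · obtain ⟨p, hp, hx⟩ := h
    rw [Finset.sum_eq_single p, if_pos hx]
    · intro q hq hne
      exact if_neg fun hx' => hne (hC.disj q hq p hp x (mem_pairSet.2 (by simp [hx']))
        (mem_pairSet.2 (by simp [hx])))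
    · exact fun h => absurd hp h
  · exact Finset.sum_eq_zero fun p hp => if_neg fun hx => h ⟨p, hp, hx⟩

theorem depth_succ (hC : IsMatching N C) (h : ℕ) :
    depth C (h + 1) = depth C h + (if ∃ p ∈ C, p.1 = h + 1 then 1 else 0)
      - (if ∃ p ∈ C, p.2 = h + 1 then 1 else 0) := by
  rw [← hC.sum_fst_eq, ← hC.sum_snd_eq]
  unfold depth
  rw [← Finset.sum_add_distrib, ← Finset.sum_sub_distrib]
  refine Finset.sum_congr rfl fun p hp => ?_
  have := mem_pairs.1 (hC.sub p hp)
  unfold Crosses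
  split_ifs <;> omega

/-- The arcs containing `h + 1` are those over the cut before it and the one starting at it. -/
theorem card_dbl (hC : IsMatching N C) {h : ℕ} (hN : h < N) :
    ((C.filter fun p => h + 1 ∈ dbl N p).card : ℤ) =
      depth C h + if ∃ p ∈ C, p.1 = h + 1 then 1 else 0 := by
  rw [← hC.sum_fst_eq, Finset.card_filter]
  push_cast
  unfold depth
  rw [← Finset.sum_add_distrib]
  refine Finset.sum_congr rfl fun p hp => ?_
  simp only [mem_dbl (hC.sub p hp)]
  have := mem_pairs.1 (hC.sub p hp)
  unfold Crosses
  split_ifs <;> omega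

end IsMatching

end Lusztig

/-! ### Filled matchings: the folded γ is the depth, and it dominates the span. -/

namespace Lusztig

/-- A matching all of whose arcs `[[ij]]` cover only matched points. -/
def IsFilled (N : ℕ) (C : Finset (ℕ × ℕ)) : Prop :=
  IsMatching N C ∧ ∀ p ∈ C, ∀ x ∈ dbl N p, x ∈ supp C

/-- The folded value of `gamAt`. -/
def fold (h : ℕ) (Z : Finset ℕ) : ℤ := if 0 ≤ gamAt h Z then gamAt h Z else -gamAt h Z - 1

namespace IsMatching

variable {N : ℕ} {C : Finset (ℕ × ℕ)}

theorem depth_nonneg (C : Finset (ℕ × ℕ)) (h : ℕ) : 0 ≤ depth C h :=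
  Finset.sum_nonneg fun p _ => by split_ifs <;> simp

theorem depth_period (hC : IsMatching N C) : depth C N = depth C 0 :=
  Finset.sum_congr rfl fun p hp => by simp only [crosses_period (hC.sub p hp)]

/-- A matching has an even number of points and `N` is odd. The free point is the starting point for
the arguments around the circle. -/
theorem exists_notMem_supp (hodd : Odd N) (hC : IsMatching N C) : ∃ x, x < N ∧ x + 1 ∉ supp C := by
  by_contra! hcon
  have h1 : supp C = Finset.Icc 1 N := by
    refine Finset.Subset.antisymm hC.supp_subset fun x hx => ?_
    rw [Finset.mem_Icc] at hx
    have := hcon (x - 1) (by omega)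
    rwa [Nat.sub_add_cancel hx.1] at this
  have h2 := hC.card_supp
  rw [h1, Nat.card_Icc] at h2
  rw [Nat.odd_iff] at hodd
  omega

end IsMatching

/-- Induction around the circle `[1,N]`. -/
theorem cyclic_induction {N : ℕ} {P : ℕ → Prop} (x : ℕ) (hx : x ≤ N) (h0 : P x)
    (hstep : ∀ h < N, P h → P (h + 1)) (hper : P N → P 0) (h : ℕ) (hh : h ≤ N) : P h := by
  have up : ∀ a, P a → ∀ k, a + k ≤ N → P (a + k) := by
    intro a ha k
    induction k with
    | zero => exact fun _ => ha
    | succ k ih => exact fun hk => hstep (a + k) (by omega) (ih (by omega))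
  have hN : P N := by
    have := up x h0 (N - x) (by omega)
    rwa [show x + (N - x) = N by omega] at this
  have := up 0 (hper hN) h (by omega)
  rwa [zero_add] at this

namespace IsFilled

variable {N : ℕ} {C : Finset (ℕ × ℕ)}

/-- An arc over a cut next to `h + 1` contains `h + 1`, whereas filled arcs contain only matched
points. -/
theorem not_crosses (hC : IsFilled N C) {h : ℕ} (hN : h < N) (hx : h + 1 ∉ supp C)
    {p : ℕ × ℕ} (hp : p ∈ C) : ¬ Crosses h p ∧ ¬ Crosses (h + 1) p := by
  have h1 := mem_pairs.1 (hC.1.sub p hp)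
  have h2 := mt (hC.2 p hp (h + 1)) hx
  have h3 : h + 1 ∉ pairSet p := fun h' => hx (mem_supp.2 ⟨p, hp, h'⟩)
  rw [mem_dbl (hC.1.sub p hp)] at h2
  rw [mem_pairSet] at h3
  unfold Crosses
  omega

theorem depth_eq_zero (hC : IsFilled N C) {h : ℕ} (hN : h < N) (hx : h + 1 ∉ supp C) :
    depth C h = 0 ∧ depth C (h + 1) = 0 :=
  ⟨Finset.sum_eq_zero fun _ hp => if_neg (hC.not_crosses hN hx hp).1,
    Finset.sum_eq_zero fun _ hp => if_neg (hC.not_crosses hN hx hp).2⟩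

/-- The total `S` satisfies `S(h+1) = 1 - S(h)` at a matched point and vanishes on both sides of a
free point, so it never leaves `{0, 1}`. -/
theorem sum_crossSign (hodd : Odd N) (hC : IsFilled N C) (h : ℕ) (hh : h ≤ N) :
    ∑ p ∈ C, crossSign h p = 0 ∨ ∑ p ∈ C, crossSign h p = 1 := by
  obtain ⟨x, hxN, hx⟩ := hC.1.exists_notMem_supp hodd
  refine cyclic_induction (P := fun h => ∑ p ∈ C, crossSign h p = 0 ∨ ∑ p ∈ C, crossSign h p = 1)
    x hxN.le ?_ ?_ ?_ h hh
  · exact Or.inl (Finset.sum_eq_zero fun p hp => if_neg (hC.not_crosses hxN hx hp).1)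
  · intro h hh ih
    have h1 : ∑ p ∈ C, crossSign (h + 1) p =
        -∑ p ∈ C, crossSign h p + if h + 1 ∈ supp C then 1 else 0 := by
      rw [Finset.sum_congr rfl fun p hp => crossSign_succ (hC.1.sub p hp) h,
        Finset.sum_add_distrib, Finset.sum_neg_distrib, hC.1.sum_mem_pairSet]
    by_cases hs : h + 1 ∈ supp C
    · rw [if_pos hs] at h1
      omega
    · exact Or.inl (Finset.sum_eq_zero fun p hp => if_neg (hC.not_crosses hh hs hp).2)
  · intro ih
    have : ∑ p ∈ C, crossSign N p = ∑ p ∈ C, crossSign 0 p := by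
      refine Finset.sum_congr rfl fun p hp => ?_
      have h0 := mem_pairs.1 (hC.1.sub p hp)
      have h1 := sg_cases N p.1
      have h2 := sg_cases 0 p.1
      rw [Nat.odd_iff] at hodd
      unfold crossSign
      simp only [crosses_period (hC.1.sub p hp)]
      split_ifs <;> omega
    rwa [← this]

/-- Let δ, equal to 0 or 1, be the total sign of all arcs of `C` over the cut. At most `(depth -
δ)/2` of them have sign `-1` and `(depth + δ)/2` sign `+1`, so `gamAt` lies between `-(depth + δ)`
and `depth - δ`; the `-1` in `fold` absorbs δ. -/
theorem fold_supp_le (hodd : Odd N) (hC : IsFilled N C) {D : Finset (ℕ × ℕ)} (hD : D ⊆ C)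
    (h : ℕ) (hh : h ≤ N) : fold h (supp D) ≤ depth C h := by
  have hd := hC.sum_crossSign hodd h hh
  have h1 := (hC.1.mono hD).gamAt_supp h
  have hT : ∀ p, (crossSign h p = 1 ∨ crossSign h p = -1) ∧ Crosses h p ∨
      crossSign h p = 0 ∧ ¬ Crosses h p := by
    intro p
    have := sg_cases h p.1
    unfold crossSign
    split_ifs with hc
    · left; exact ⟨by omega, hc⟩
    · right; exact ⟨rfl, hc⟩
  -- The summands `|sign| - sign` are nonnegative, so the sum over `D` may be enlarged to one over
  -- `C`.
  have h2 : gamAt h (supp D) ≤ depth C h - ∑ p ∈ C, crossSign h p := by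
    rw [h1, depth, ← Finset.sum_sub_distrib]
    refine (Finset.sum_le_sum (g := fun p => (if Crosses h p then 1 else 0) - crossSign h p)
      fun p _ => ?_).trans (Finset.sum_le_sum_of_subset_of_nonneg hD fun p _ _ => ?_)
    · rcases hT p with ⟨h4, h5⟩ | ⟨h4, h5⟩ <;> simp only [h5, if_true, if_false] <;> omega
    · rcases hT p with ⟨h4, h5⟩ | ⟨h4, h5⟩ <;> simp only [h5, if_true, if_false] <;> omega
  have h3 : -gamAt h (supp D) ≤ depth C h + ∑ p ∈ C, crossSign h p := by
    rw [h1, depth, ← Finset.sum_add_distrib, ← Finset.sum_neg_distrib]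
    refine (Finset.sum_le_sum (g := fun p => (if Crosses h p then 1 else 0) + crossSign h p)
      fun p _ => ?_).trans (Finset.sum_le_sum_of_subset_of_nonneg hD fun p _ _ => ?_)
    · rcases hT p with ⟨h4, h5⟩ | ⟨h4, h5⟩ <;> simp only [h5, if_true, if_false] <;> omega
    · rcases hT p with ⟨h4, h5⟩ | ⟨h4, h5⟩ <;> simp only [h5, if_true, if_false] <;> omega
  unfold fold
  split_ifs <;> omega

theorem mem_fsum_dbl (hC : IsFilled N C) {h : ℕ} (hN : h < N) : h + 1 ∈ fsum C (dbl N) ↔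
    (depth C h + if ∃ p ∈ C, p.1 = h + 1 then 1 else 0) % 2 = 1 := by
  rw [mem_fsum, ← hC.1.card_dbl hN, Nat.odd_iff]
  omega

theorem fsum_dbl_subset (hC : IsMatching N C) : fsum C (dbl N) ⊆ Finset.Icc 1 N := by
  intro x hx
  obtain ⟨p, hp⟩ := Finset.card_pos.1 ((mem_fsum _ _ _).1 hx).pos
  rw [Finset.mem_filter] at hp
  have h1 := mem_pairs.1 (hC.sub p hp.1)
  have h2 := (mem_dbl (hC.sub p hp.1)).1 hp.2
  rw [Finset.mem_Icc]; omega

/-- Both sides obey the same recursion, so their difference changes sign at each cut. As `N` is odd,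
a full turn makes the difference equal to its own negative, hence zero. -/
theorem gamAt_fsum_dbl (hodd : Odd N) (hC : IsFilled N C) (h : ℕ) (hh : h ≤ N) :
    gamAt h (fsum C (dbl N)) = if depth C h % 2 = 0 then depth C h else -depth C h - 1 := by
  set Z := fsum C (dbl N) with hZ
  set G : ℕ → ℤ := fun h => if depth C h % 2 = 0 then depth C h else -depth C h - 1 with hG
  have hstep : ∀ h < N, gamAt (h + 1) Z - G (h + 1) = -(gamAt h Z - G h) := by
    intro h hh
    have h1 := gamAt_succ h Z
    have h2 := hC.mem_fsum_dbl hh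
    have h3 := hC.1.depth_succ h
    -- The depth stays constant only at a free point, and there it is 0.
    have h4 : (¬ ∃ p ∈ C, p.1 = h + 1) → (¬ ∃ p ∈ C, p.2 = h + 1) →
        depth C h = 0 ∧ depth C (h + 1) = 0 := fun ha hb => hC.depth_eq_zero hh (by
      rw [mem_supp]
      rintro ⟨p, hp, hx⟩
      rcases mem_pairSet.1 hx with hx | hx
      · exact ha ⟨p, hp, hx.symm⟩
      · exact hb ⟨p, hp, hx.symm⟩)
    have h5 : ¬ ((∃ p ∈ C, p.1 = h + 1) ∧ ∃ p ∈ C, p.2 = h + 1) := by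
      rintro ⟨⟨p, hp, hx⟩, q, hq, hy⟩
      have := hC.1.disj p hp q hq (h + 1) (mem_pairSet.2 (by simp [hx]))
        (mem_pairSet.2 (by simp [hy]))
      subst this
      have := mem_pairs.1 (hC.1.sub p hp)
      omega
    rw [← hZ] at h2
    simp only [hG]
    by_cases ha : ∃ p ∈ C, p.1 = h + 1 <;> by_cases hb : ∃ p ∈ C, p.2 = h + 1 <;>
      by_cases hc : h + 1 ∈ Z <;>
      simp only [ha, hb, hc, if_true, if_false, not_true, not_false_eq_true, true_and,
        forall_true_left, true_iff, false_iff] at h1 h2 h3 h4 h5 <;>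
      split_ifs <;> omega
  have hk : ∀ k ≤ N, gamAt k Z - G k = (-1) ^ k * (gamAt 0 Z - G 0) := by
    intro k
    induction k with
    | zero => simp
    | succ k ih =>
      intro hk
      rw [hstep k (by omega), ih (by omega), pow_succ]; ring
  have hN := hk N le_rfl
  rw [hodd.neg_one_pow, gamAt_period hodd (fsum_dbl_subset hC.1)] at hN
  have : G N = G 0 := by simp only [hG, hC.1.depth_period]
  rw [this] at hN
  have h0 : gamAt 0 Z - G 0 = 0 := by linarith
  have := hk h hh
  rw [h0, mul_zero] at this
  show gamAt h Z = G h
  omega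

theorem fold_fsum_dbl (hodd : Odd N) (hC : IsFilled N C) (h : ℕ) (hh : h ≤ N) :
    fold h (fsum C (dbl N)) = depth C h := by
  have := hC.gamAt_fsum_dbl hodd h hh
  have := IsMatching.depth_nonneg C h
  unfold fold
  split_ifs at * <;> omega

/-- The domination behind all triangularity below. -/
theorem fold_le_of_mem_span (hodd : Odd N) (hC : IsFilled N C) {Z : Finset ℕ} (hZ : Z ∈ span C)
    (h : ℕ) (hh : h ≤ N) : fold h Z ≤ fold h (fsum C (dbl N)) := by
  obtain ⟨D, hD, rfl⟩ := Finset.mem_image.1 hZ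
  rw [Finset.mem_powerset] at hD
  rw [(hC.1.mono hD).fsum_pairSet, hC.fold_fsum_dbl hodd h hh]
  exact hC.fold_supp_le hodd hD h hh

end IsFilled

theorem even_card_symmDiff {A B : Finset ℕ} (hA : Even A.card) (hB : Even B.card) :
    Even (A ∆ B).card := by
  have h1 := Finset.card_sdiff_add_card_inter A B
  have h2 := Finset.card_sdiff_add_card_inter B A
  have h3 : (A ∆ B).card = (A \ B).card + (B \ A).card :=
    Finset.card_union_of_disjoint disjoint_sdiff_sdiff
  rw [Finset.inter_comm] at h2
  rw [Nat.even_iff] at *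
  omega

theorem even_card_dbl {N : ℕ} (hodd : Odd N) {p : ℕ × ℕ} (hp : p ∈ pairs N) :
    Even (dbl N p).card := by
  have h := mem_pairs.1 hp
  rw [Nat.odd_iff] at hodd
  unfold dbl
  split_ifs with hlt
  · rw [Nat.card_Icc, Nat.even_iff]; omega
  · rw [Finset.card_union_of_disjoint, Nat.card_Icc, Nat.card_Icc, Nat.even_iff]
    · omega
    · rw [Finset.disjoint_left]
      intro x hx
      rw [Finset.mem_Icc] at *
      omega

theorem IsMatching.fsum_dbl_mem_E {N : ℕ} {C : Finset (ℕ × ℕ)} (hodd : Odd N)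
    (hC : IsMatching N C) : fsum C (dbl N) ∈ E N := by
  rw [E, Finset.mem_filter, Finset.mem_powerset]
  refine ⟨IsFilled.fsum_dbl_subset hC, ?_⟩
  have : ∀ p ∈ C, p ∈ pairs N := hC.sub
  clear hC
  induction C using Finset.induction_on with
  | empty => simp [fsum]
  | insert a s ha ih =>
    rw [fsum_insert ha]
    exact even_card_symmDiff (even_card_dbl hodd (this a (Finset.mem_insert_self _ _)))
      (ih fun p hp => this p (Finset.mem_insert_of_mem hp))

theorem mem_E {N : ℕ} {Z : Finset ℕ} : Z ∈ E N ↔ Z ⊆ Finset.Icc 1 N ∧ Even Z.card := by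
  rw [E, Finset.mem_filter, Finset.mem_powerset]

/-- `fold` is injective on even integers, and `gamAt_succ` reads off membership of `h + 1` from two
consecutive values. -/
theorem mem_iff_of_fold_eq {N h : ℕ} {Z Z' : Finset ℕ} (hZ : Z ∈ E N) (hZ' : Z' ∈ E N)
    (h1 : fold h Z = fold h Z') (h2 : fold (h + 1) Z = fold (h + 1) Z') :
    h + 1 ∈ Z ↔ h + 1 ∈ Z' := by
  have e1 := gamAt_even (mem_E.1 hZ).2 h
  have e2 := gamAt_even (mem_E.1 hZ).2 (h + 1)
  have e3 := gamAt_even (mem_E.1 hZ').2 h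
  have e4 := gamAt_even (mem_E.1 hZ').2 (h + 1)
  rw [Int.even_iff] at *
  have s1 := gamAt_succ h Z
  have s2 := gamAt_succ h Z'
  unfold fold at h1 h2
  by_cases ha : h + 1 ∈ Z <;> by_cases hb : h + 1 ∈ Z' <;> simp only [ha, hb, if_true, if_false] at * <;>
    split_ifs at * <;> omega

theorem eq_of_fold_eq {N : ℕ} {Z Z' : Finset ℕ} (hZ : Z ∈ E N) (hZ' : Z' ∈ E N)
    (h : ∀ h ≤ N, fold h Z = fold h Z') : Z = Z' := by
  ext x
  by_cases hx : x ∈ Finset.Icc 1 N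
  · rw [Finset.mem_Icc] at hx
    have := mem_iff_of_fold_eq (h := x - 1) hZ hZ' (h _ (by omega)) (h _ (by omega))
    rwa [Nat.sub_add_cancel hx.1] at this
  · exact iff_of_false (fun h => hx ((mem_E.1 hZ).1 h)) fun h => hx ((mem_E.1 hZ').1 h)

end Lusztig

/-! ### Noncrossing arc systems are determined by the sum of their arcs. -/

namespace Lusztig

/-- A noncrossing set of arcs `[[ij]]` on the circle `[1,N]`, each filled by smaller arcs. -/
structure IsArcSystem (N : ℕ) (C : Finset (ℕ × ℕ)) : Prop where
  matching : IsMatching N C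
  nest : ∀ p ∈ C, ∀ x ∈ dbl N p, x ∉ pairSet p → ∃ q ∈ C, x ∈ pairSet q ∧ dbl N q ⊆ dbl N p

theorem fst_mem_dbl {N : ℕ} {p : ℕ × ℕ} (hp : p ∈ pairs N) : p.1 ∈ dbl N p := by
  rw [mem_dbl hp]; rw [mem_pairs] at hp; omega

theorem snd_mem_dbl {N : ℕ} {p : ℕ × ℕ} (hp : p ∈ pairs N) : p.2 ∈ dbl N p := by
  rw [mem_dbl hp]; rw [mem_pairs] at hp; omega

namespace IsArcSystem

variable {N : ℕ} {C : Finset (ℕ × ℕ)}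

theorem filled (hC : IsArcSystem N C) : IsFilled N C := by
  refine ⟨hC.matching, fun p hp x hx => ?_⟩
  by_cases h : x ∈ pairSet p
  · exact mem_supp.2 ⟨p, hp, h⟩
  · obtain ⟨q, hq, h1, -⟩ := hC.nest p hp x hx h
    exact mem_supp.2 ⟨q, hq, h1⟩

/-- The noncrossing property in usable form: a point lies in only one pair, so the arc supplied by
`nest` is `q`. -/
theorem dbl_subset (hC : IsArcSystem N C) {p q : ℕ × ℕ} (hp : p ∈ C) (hq : q ∈ C) {x : ℕ}
    (hx : x ∈ pairSet q) (hxp : x ∈ dbl N p) : dbl N q ⊆ dbl N p := by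
  by_cases h : x ∈ pairSet p
  · rw [hC.matching.disj p hp q hq x h hx]
  · obtain ⟨q', hq', h1, h2⟩ := hC.nest p hp x hxp h
    rwa [hC.matching.disj q hq q' hq' x hx h1]

/-- By noncrossing, the same arcs lie over both endpoints of `p`. -/
theorem fst_mem_iff_snd_mem (hC : IsArcSystem N C) {p : ℕ × ℕ} (hp : p ∈ C) :
    p.1 ∈ fsum C (dbl N) ↔ p.2 ∈ fsum C (dbl N) := by
  rw [mem_fsum, mem_fsum]
  have : C.filter (fun a => p.1 ∈ dbl N a) = C.filter fun a => p.2 ∈ dbl N a := by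
    refine Finset.filter_congr fun q hq => ⟨fun h => ?_, fun h => ?_⟩
    · exact hC.dbl_subset hq hp (fst_mem_pairSet p) h (snd_mem_dbl (hC.matching.sub p hp))
    · exact hC.dbl_subset hq hp (snd_mem_pairSet p) h (fst_mem_dbl (hC.matching.sub p hp))
  rw [this]

theorem fsum_dbl_eq_supp (hC : IsArcSystem N C) :
    fsum C (dbl N) = supp (C.filter fun p => p.1 ∈ fsum C (dbl N)) := by
  ext x
  rw [mem_supp]
  constructor
  · intro hx
    obtain ⟨q, hq⟩ := Finset.card_pos.1 ((mem_fsum _ _ _).1 hx).pos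
    rw [Finset.mem_filter] at hq
    obtain ⟨p, hp, hxp⟩ := mem_supp.1 (hC.filled.2 q hq.1 x hq.2)
    refine ⟨p, Finset.mem_filter.2 ⟨hp, ?_⟩, hxp⟩
    rcases mem_pairSet.1 hxp with rfl | rfl
    · exact hx
    · exact (hC.fst_mem_iff_snd_mem hp).2 hx
  · rintro ⟨p, hp, hxp⟩
    rw [Finset.mem_filter] at hp
    rcases mem_pairSet.1 hxp with rfl | rfl
    · exact hp.2
    · exact (hC.fst_mem_iff_snd_mem hp.1).1 hp.2

/-- `∑ [[ij]]` lies in the span of the pairs whose endpoints it contains. -/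
theorem fsum_dbl_mem_span (hC : IsArcSystem N C) {B : Finset (ℕ × ℕ)}
    (hB : ∀ p ∈ C, p.1 ∈ fsum C (dbl N) → p ∈ B) : fsum C (dbl N) ∈ span B := by
  refine Finset.mem_image.2 ⟨C.filter fun p => p.1 ∈ fsum C (dbl N), ?_, ?_⟩
  · rw [Finset.mem_powerset]
    intro p hp
    rw [Finset.mem_filter] at hp
    exact hB p hp.1 hp.2
  · rw [(hC.matching.mono (Finset.filter_subset _ _)).fsum_pairSet, ← hC.fsum_dbl_eq_supp]

/-- An arc determines its spelling: a wrapping arc leaves a nonempty gap because `i - j` is even and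
positive, so it is never an interval, and its endpoints border the gap. -/
theorem card_dbl_lt {p q : ℕ × ℕ} (hp : p ∈ pairs N) (hq : q ∈ pairs N) (hne : p ≠ q)
    (h : dbl N q ⊆ dbl N p) : (dbl N q).card < (dbl N p).card := by
  refine Finset.card_lt_card ⟨h, fun h' => hne ?_⟩
  have hi : ∀ x, x ∈ dbl N p ↔ x ∈ dbl N q := fun x => ⟨fun a => h' a, fun a => h a⟩
  simp only [mem_dbl hp, mem_dbl hq] at hi
  rw [mem_pairs] at hp hq
  obtain ⟨a, b⟩ := p
  obtain ⟨c, d⟩ := q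
  dsimp only at *
  rw [Prod.mk.injEq]
  have h1 := hi a
  have h2 := hi b
  have h3 := hi c
  have h4 := hi d
  rcases hp.2.2.2.2 with hp' | hp' <;> rcases hq.2.2.2.2 with hq' | hq' <;>
    simp only [hp'.1, hq'.1, hp'.1.not_gt, hq'.1.not_gt, true_and, false_and, or_false,
      false_or] at hi h1 h2 h3 h4
  · omega
  · have := hi (d + 1)
    omega
  · have := hi (b + 1)
    omega
  · have h5 := hi (a - 1)
    have h6 := hi (b + 1)
    have h7 := hi (c - 1)
    have h8 := hi (d + 1)
    omega

/-- Induction on the size of the arc `p`. Let `q` and `t` be the arcs of `C'` with the start and the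
end of `p`. By induction, arcs of `C'` with an endpoint strictly inside `p` belong to `C`. If `q ≠
p`, then `q` ends or `t` starts inside `p`, and `C` would contain two pairs sharing a point. -/
theorem mem_of_same_ends {C' : Finset (ℕ × ℕ)} (hC : IsArcSystem N C) (hC' : IsArcSystem N C')
    (h1 : ∀ x, (∃ p ∈ C, p.1 = x) ↔ ∃ p ∈ C', p.1 = x)
    (h2 : ∀ x, (∃ p ∈ C, p.2 = x) ↔ ∃ p ∈ C', p.2 = x) (n : ℕ) :
    ∀ p ∈ C, (dbl N p).card = n → p ∈ C' := by
  induction n using Nat.strong_induction_on with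
  | _ n ih =>
    intro p hp hn
    obtain ⟨q, hq, hq1⟩ := (h1 p.1).1 ⟨p, hp, rfl⟩
    obtain ⟨t, ht, ht1⟩ := (h2 p.2).1 ⟨p, hp, rfl⟩
    have pp := hC.matching.sub p hp
    have pq := hC'.matching.sub q hq
    have pt := hC'.matching.sub t ht
    by_cases hqp : q.2 = p.2
    · rwa [← Prod.ext hq1 hqp]
    exfalso
    -- an element of `C'` that shares an inner point of `p` belongs to `C`
    have inner : ∀ s ∈ C', ∀ x ∈ pairSet s, x ∈ dbl N p → x ∉ pairSet p → s ∈ C := by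
      intro s hs x hx hxp hxn
      obtain ⟨s', hs', hx', hsub⟩ := hC.nest p hp x hxp hxn
      have hne : p ≠ s' := by rintro rfl; exact hxn hx'
      have := ih _ (hn ▸ card_dbl_lt pp (hC.matching.sub s' hs') hne hsub) s' hs' rfl
      rwa [hC'.matching.disj s hs s' this x hx hx']
    -- Of two arcs with the same start, one contains the end of the other.
    have hd : q.2 ∈ dbl N p ∨ p.2 ∈ dbl N q := by
      rw [mem_dbl pp, mem_dbl pq]
      rw [mem_pairs] at pp pq
      omega
    have hne2 : q.2 ≠ p.1 := by rw [mem_pairs] at pq; omega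
    rcases hd with hd | hd
    · have := inner q hq q.2 (snd_mem_pairSet q) hd (by rw [mem_pairSet]; omega)
      have := hC.matching.disj q this p hp p.1 (by simp [pairSet, hq1]) (by simp [pairSet])
      rw [this] at hqp
      exact hqp rfl
    · have h3 := hC'.dbl_subset hq ht (x := p.2) (by simp [pairSet, ht1]) hd
      have hne3 : q ≠ t := by rintro rfl; exact hqp ht1
      have h4 : p.1 ∉ pairSet t := fun h => hne3 (hC'.matching.disj q hq t ht p.1
        (by simp [pairSet, hq1]) h)
      have h5 : p.1 ∉ dbl N t := fun h => by
        have := hC'.dbl_subset ht hq (x := p.1) (by simp [pairSet, hq1]) h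
        have a := card_dbl_lt pq pt hne3 h3
        have b := Finset.card_le_card this
        omega
      -- `t` lies in `q` but avoids the common start of `p` and `q`, so it starts inside `p`.
      have h6 := h3 (fst_mem_dbl pt)
      have h7 : t.1 ≠ p.2 := by rw [mem_pairs] at pt; omega
      rw [mem_pairSet] at h4
      have h8 : t.1 ∈ dbl N p := by
        rw [mem_dbl pt] at h5
        rw [mem_dbl pq] at h6
        rw [mem_dbl pp]
        rw [mem_pairs] at pp pq pt
        omega
      have := inner t ht t.1 (fst_mem_pairSet t) h8 (by rw [mem_pairSet]; omega)
      have := hC.matching.disj t this p hp p.2 (by simp [pairSet, ht1]) (by simp [pairSet])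
      rw [this] at h4
      exact h4 (Or.inl rfl)

/-- An arc system is determined by `∑ [[ij]]`. -/
theorem eq_of_fsum_dbl_eq {C' : Finset (ℕ × ℕ)} (hodd : Odd N) (hC : IsArcSystem N C)
    (hC' : IsArcSystem N C') (h : fsum C (dbl N) = fsum C' (dbl N)) : C = C' := by
  have hd : ∀ h ≤ N, depth C h = depth C' h := fun k hk => by
    rw [← hC.filled.fold_fsum_dbl hodd k hk, ← hC'.filled.fold_fsum_dbl hodd k hk, h]
  -- Starts and ends of arcs are the rises and falls of the depth.
  have ends : ∀ {D : Finset (ℕ × ℕ)}, IsArcSystem N D → ∀ x,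
      ((∃ p ∈ D, p.1 = x) ↔ 1 ≤ x ∧ x ≤ N ∧ depth D x = depth D (x - 1) + 1) ∧
      ((∃ p ∈ D, p.2 = x) ↔ 1 ≤ x ∧ x ≤ N ∧ depth D x = depth D (x - 1) - 1) := by
    intro D hD x
    have hr1 : (∃ p ∈ D, p.1 = x) → 1 ≤ x ∧ x ≤ N := by
      rintro ⟨p, hp, rfl⟩
      have := mem_pairs.1 (hD.matching.sub p hp)
      omega
    have hr2 : (∃ p ∈ D, p.2 = x) → 1 ≤ x ∧ x ≤ N := by
      rintro ⟨p, hp, rfl⟩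
      have := mem_pairs.1 (hD.matching.sub p hp)
      omega
    by_cases hx : 1 ≤ x ∧ x ≤ N
    · obtain ⟨y, rfl⟩ : ∃ y, x = y + 1 := ⟨x - 1, by omega⟩
      have h1 := hD.matching.depth_succ y
      have h5 : ¬ ((∃ p ∈ D, p.1 = y + 1) ∧ ∃ p ∈ D, p.2 = y + 1) := by
        rintro ⟨⟨p, hp, hx⟩, q, hq, hy⟩
        have := hD.matching.disj p hp q hq (y + 1) (mem_pairSet.2 (by simp [hx]))
          (mem_pairSet.2 (by simp [hy]))
        subst this
        have := mem_pairs.1 (hD.matching.sub p hp)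
        omega
      simp only [Nat.add_sub_cancel]
      by_cases ha : ∃ p ∈ D, p.1 = y + 1 <;> by_cases hb : ∃ p ∈ D, p.2 = y + 1 <;>
        simp only [ha, hb, if_true, if_false, and_self, not_true] at h1 h5 ⊢
      all_goals constructor <;> constructor <;> intro h <;> first | omega | trivial
    · exact ⟨iff_of_false (fun h => hx (hr1 h)) fun h => hx ⟨h.1, h.2.1⟩,
        iff_of_false (fun h => hx (hr2 h)) fun h => hx ⟨h.1, h.2.1⟩⟩
  have e1 : ∀ x, (∃ p ∈ C, p.1 = x) ↔ ∃ p ∈ C', p.1 = x := fun x => by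
    rw [(ends hC x).1, (ends hC' x).1]
    refine and_congr_right fun _ => and_congr_right fun hx => ?_
    rw [hd x hx, hd (x - 1) (by omega)]
  have e2 : ∀ x, (∃ p ∈ C, p.2 = x) ↔ ∃ p ∈ C', p.2 = x := fun x => by
    rw [(ends hC x).2, (ends hC' x).2]
    refine and_congr_right fun _ => and_congr_right fun hx => ?_
    rw [hd x hx, hd (x - 1) (by omega)]
  exact Finset.Subset.antisymm (fun p hp => mem_of_same_ends hC hC' e1 e2 _ p hp rfl)
    fun p hp => mem_of_same_ends hC' hC (fun x => (e1 x).symm) (fun x => (e2 x).symm) _ p hp rfl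

end IsArcSystem

end Lusztig

/-! ### Existence of arc systems: excursions of a periodic walk. -/

namespace Lusztig

/-- A nonnegative `N`-periodic function whose steps are `±1`, or `0` at the value `0`. -/
structure IsDepthFunction (N : ℕ) (R : ℕ → ℤ) : Prop where
  pos : 0 < N
  nonneg : ∀ h, 0 ≤ R h
  period : ∀ h, R (h + N) = R h
  step : ∀ h, R (h + 1) = R h + 1 ∨ R (h + 1) = R h - 1 ∨ (R h = 0 ∧ R (h + 1) = 0)

/-- The second endpoint of the arc `[[ij]]`, lifted to an integer larger than `i`. -/
def lift (N : ℕ) (p : ℕ × ℕ) : ℕ := if p.1 < p.2 then p.2 else p.2 + N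

/-- `R` makes its first return to its value before `a` at `b`. -/
def IsExcursion (N : ℕ) (R : ℕ → ℤ) (a b : ℕ) : Prop :=
  a < b ∧ b < a + N ∧ (b - a) % 2 = 1 ∧ R b = R (a - 1) ∧ ∀ k, a ≤ k → k < b → R (a - 1) < R k

open Classical in
/-- The arcs under the excursions of `R`. -/
noncomputable def excursions (N : ℕ) (R : ℕ → ℤ) : Finset (ℕ × ℕ) :=
  (pairs N).filter fun p => IsExcursion N R p.1 (lift N p)

namespace IsDepthFunction

variable {N : ℕ} {R : ℕ → ℤ}

theorem parity (hR : IsDepthFunction N R) {a n : ℕ} (h : ∀ k, a ≤ k → k < a + n → 0 < R k) :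
    (R (a + n) - R a - n) % 2 = 0 := by
  induction n with
  | zero => simp
  | succ n ih =>
    have h1 := ih fun k hk hk' => h k hk (by omega)
    have h2 := h (a + n) (by omega) (by omega)
    have h3 := hR.step (a + n)
    rw [← add_assoc]
    push_cast
    omega

/-- No flat step occurs above level 0, so the return to the initial level takes `b - a + 1` steps,
an even number. -/
theorem excursion_parity (hR : IsDepthFunction N R) {a b : ℕ} (ha : 1 ≤ a) (hab : a < b)
    (hb : R b = R (a - 1)) (h : ∀ k, a ≤ k → k < b → R (a - 1) < R k) : (b - a) % 2 = 1 := by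
  have h0 := hR.nonneg (a - 1)
  have h1 := hR.parity (a := a) (n := b - a) fun k hk hk' => by
    have := h k hk (by omega); omega
  have h2 := h a le_rfl hab
  have h3 := hR.step (a - 1)
  rw [Nat.sub_add_cancel ha] at h3
  rw [show a + (b - a) = b by omega] at h1
  omega

/-- Take the first return; periodicity guarantees one by time `a - 1 + N`. -/
theorem exists_right (hR : IsDepthFunction N R) {a : ℕ} (ha : 1 ≤ a)
    (hup : R (a - 1) < R a) : ∃ b, IsExcursion N R a b := by
  classical
  have hpos := hR.pos
  have hex : ∃ k, a ≤ k ∧ R k ≤ R (a - 1) := ⟨a - 1 + N, by omega, (hR.period _).le⟩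
  obtain ⟨b, ⟨hab, hb⟩, hmin⟩ : ∃ b, (a ≤ b ∧ R b ≤ R (a - 1)) ∧
      ∀ k < b, ¬ (a ≤ k ∧ R k ≤ R (a - 1)) :=
    ⟨Nat.find hex, Nat.find_spec hex, fun k hk => Nat.find_min hex hk⟩
  have hlt : a < b := by
    rcases hab.lt_or_eq with h | rfl
    · exact h
    · omega
  have hin : ∀ k, a ≤ k → k < b → R (a - 1) < R k := fun k hk hk' => by
    have := hmin k hk'; omega
  have hle : b ≤ a - 1 + N := by
    by_contra! hcon
    exact hmin _ hcon ⟨by omega, (hR.period _).le⟩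
  have heq : R b = R (a - 1) := by
    have h1 := hin (b - 1) (by omega) (by omega)
    have h2 := hR.step (b - 1)
    rw [Nat.sub_add_cancel (by omega)] at h2
    omega
  exact ⟨b, hlt, by omega, hR.excursion_parity ha hlt heq hin, heq, hin⟩

/-- Mirror image of `exists_right`. The end is shifted by `N` so that the search backwards stays in
the natural numbers. -/
theorem exists_left (hR : IsDepthFunction N R) {b : ℕ} (hb : 1 ≤ b)
    (hdown : R b < R (b - 1)) : ∃ a, b < a ∧ IsExcursion N R a (b + N) := by
  classical
  have hpos := hR.pos
  have hper : R (b + N) = R b := hR.period b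
  have hper1 : R (b + N - 1) = R (b - 1) := by
    rw [show b + N - 1 = b - 1 + N by omega, hR.period]
  obtain ⟨a, ha, hba, haN, hmax⟩ : ∃ a, R a ≤ R b ∧ b ≤ a ∧ a ≤ b + N - 1 ∧
      ∀ k, a < k → k ≤ b + N - 1 → ¬ R k ≤ R b :=
    ⟨Nat.findGreatest (fun k => R k ≤ R b) (b + N - 1),
      Nat.findGreatest_spec (P := fun k => R k ≤ R b) (m := b) (by omega) le_rfl,
      Nat.le_findGreatest (by omega) le_rfl, Nat.findGreatest_le _,
      fun k hk hk' => Nat.findGreatest_is_greatest hk hk'⟩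
  have hlt : a + 1 < b + N := by
    rcases haN.lt_or_eq with h | rfl
    · omega
    · omega
  have heq : R a = R b := by
    have h1 := hmax (a + 1) (by omega) (by omega)
    have h2 := hR.step a
    omega
  have hin : ∀ k, a + 1 ≤ k → k < b + N → R (a + 1 - 1) < R k := fun k hk hk' => by
    have := hmax k (by omega) (by omega)
    rw [Nat.add_sub_cancel]; omega
  have heq' : R (b + N) = R (a + 1 - 1) := by rw [Nat.add_sub_cancel, hper, heq]
  exact ⟨a + 1, by omega, hlt, by omega,
    hR.excursion_parity (by omega) hlt heq' hin, heq', hin⟩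

theorem excursion_shift (hR : IsDepthFunction N R) {a b : ℕ} (ha : 1 ≤ a) :
    IsExcursion N R (a + N) (b + N) ↔ IsExcursion N R a b := by
  have h1 : R (a + N - 1) = R (a - 1) := by
    rw [show a + N - 1 = a - 1 + N by omega, hR.period]
  unfold IsExcursion
  rw [hR.period, h1]
  refine and_congr (by omega) (and_congr (by omega) (and_congr (by
    rw [Nat.add_sub_add_right]) (and_congr_right fun _ => ⟨fun h k hk hk' => ?_,
      fun h k hk hk' => ?_⟩)))
  · rw [← hR.period k]; exact h (k + N) (by omega) (by omega)
  · have := h (k - N) (by omega) (by omega)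
    rwa [← hR.period (k - N), Nat.sub_add_cancel (by omega)] at this

theorem mem_excursions {p : ℕ × ℕ} :
    p ∈ excursions N R ↔ p ∈ pairs N ∧ IsExcursion N R p.1 (lift N p) := by
  classical
  unfold excursions
  simp only [Finset.mem_filter]

theorem exists_mem_excursions_of_le (hodd : Odd N) {c d : ℕ}
    (hc : 1 ≤ c) (hcN : c ≤ N) (h : IsExcursion N R c d) :
    ∃ q ∈ excursions N R, q.1 = c ∧ lift N q = d := by
  have h' := h
  obtain ⟨h1, h2, h3, h4, h5⟩ := h'
  rw [Nat.odd_iff] at hodd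
  by_cases hd : d ≤ N
  · have hl : lift N (c, d) = d := if_pos h1
    refine ⟨(c, d), mem_excursions.2 ⟨mem_pairs.2 ?_, ?_⟩, rfl, hl⟩
    · dsimp only; omega
    · rw [hl]; exact h
  -- The arc wraps: subtracting the odd number `N` from the end changes the parity, as the second
  -- kind of spelling requires.
  · have hl : lift N (c, d - N) = d := by
      unfold lift
      rw [if_neg (by dsimp only; omega)]
      dsimp only; omega
    refine ⟨(c, d - N), mem_excursions.2 ⟨mem_pairs.2 ?_, ?_⟩, rfl, hl⟩
    · dsimp only
      have : d - N ≠ c := by omega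
      omega
    · rw [hl]; exact h

theorem exists_mem_excursions (hodd : Odd N) (hR : IsDepthFunction N R) {c d : ℕ}
    (hc : 1 ≤ c) (hcN : c ≤ 2 * N) (h : IsExcursion N R c d) :
    ∃ q ∈ excursions N R, (q.1 = c ∧ lift N q = d) ∨ (q.1 + N = c ∧ lift N q + N = d) := by
  by_cases hc' : c ≤ N
  · obtain ⟨q, hq, h1⟩ := exists_mem_excursions_of_le hodd hc hc' h
    exact ⟨q, hq, Or.inl h1⟩
  · have := h.1
    rw [show c = c - N + N by omega, show d = d - N + N by omega,
      hR.excursion_shift (by omega)] at h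
    obtain ⟨q, hq, h1⟩ := exists_mem_excursions_of_le hodd (by omega) (by omega) h
    exact ⟨q, hq, Or.inr (by omega)⟩

theorem lift_cases (p : ℕ × ℕ) : (p.1 < p.2 ∧ lift N p = p.2) ∨ (p.2 ≤ p.1 ∧ lift N p = p.2 + N) := by
  unfold lift
  split_ifs with h
  · exact Or.inl ⟨h, rfl⟩
  · exact Or.inr ⟨by omega, rfl⟩

theorem fst_up {p : ℕ × ℕ} (hp : p ∈ excursions N R) :
    R (p.1 - 1) < R p.1 := by
  obtain ⟨-, h⟩ := mem_excursions.1 hp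
  exact h.2.2.2.2 _ le_rfl h.1

theorem snd_down (hR : IsDepthFunction N R) {p : ℕ × ℕ} (hp : p ∈ excursions N R) :
    R p.2 < R (p.2 - 1) := by
  obtain ⟨h0, h⟩ := mem_excursions.1 hp
  rw [mem_pairs] at h0
  have h1 := h.2.2.2.2 (lift N p - 1) (by have := h.1; omega) (by have := h.1; omega)
  rw [← h.2.2.2.1] at h1
  rcases lift_cases (N := N) p with h2 | h2 <;> rw [h2.2] at h1
  · exact h1
  · rwa [hR.period, show p.2 + N - 1 = p.2 - 1 + N by omega, hR.period] at h1

/-- Every start is a rise and every end is a fall, so a start never coincides with an end. The start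
fixes the end as first return. If two excursions had the same end, then, up to translation by `N`,
the level before the later start would equal the end level strictly inside the longer one. -/
theorem matching_excursions (hR : IsDepthFunction N R) : IsMatching N (excursions N R) := by
  have hfst : ∀ p ∈ excursions N R, ∀ q ∈ excursions N R, p.1 = q.1 → p = q := by
    intro p hp q hq h
    obtain ⟨pp, -, -, -, h1, h2⟩ := mem_excursions.1 hp
    obtain ⟨pq, -, -, -, h3, h4⟩ := mem_excursions.1 hq
    have hp' := (mem_excursions.1 hp).2.1
    have hq' := (mem_excursions.1 hq).2.1
    rw [← h] at h3 h4 hq'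
    have : lift N p = lift N q := by
      by_contra hne
      rcases lt_or_gt_of_ne hne with hlt | hlt
      · have := h4 _ hp'.le hlt; omega
      · have := h2 _ hq'.le hlt; omega
    rw [mem_pairs] at pp pq
    have a := lift_cases (N := N) p
    have b := lift_cases (N := N) q
    exact Prod.ext h (by omega)
  have hsnd : ∀ p ∈ excursions N R, ∀ q ∈ excursions N R, p.2 = q.2 → p.1 < q.1 → False := by
    intro p hp q hq h hlt
    obtain ⟨pp, ha, hb, -, h1, h2⟩ := mem_excursions.1 hp
    obtain ⟨pq, hc, hd, -, h3, h4⟩ := mem_excursions.1 hq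
    rw [mem_pairs] at pp pq
    rcases lift_cases (N := N) p with a | a <;> rcases lift_cases (N := N) q with b | b <;>
      rw [a.2] at h1 h2 <;> rw [b.2] at h3 h4
    · have := h2 (q.1 - 1) (by omega) (by omega)
      rw [← h1, ← h3, h] at this
      omega
    · have := h4 (p.1 - 1 + N) (by omega) (by omega)
      rw [hR.period, ← h1, ← h3, h, hR.period] at this
      omega
    · omega
    · have := h2 (q.1 - 1) (by omega) (by omega)
      rw [← h1, ← h3, h] at this
      omega
  refine ⟨fun p hp => (mem_excursions.1 hp).1, fun p hp q hq x hx hx' => ?_⟩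
  have p1 := fst_up hp
  have p2 := hR.snd_down hp
  have q1 := fst_up hq
  have q2 := hR.snd_down hq
  rcases mem_pairSet.1 hx with rfl | rfl <;> rcases mem_pairSet.1 hx' with h | h
  · exact hfst p hp q hq h
  · rw [h] at p1; omega
  · rw [h] at p2; omega
  · rcases lt_trichotomy p.1 q.1 with h1 | h1 | h1
    · exact (hsnd p hp q hq h h1).elim
    · exact hfst p hp q hq h1
    · exact (hsnd q hq p hp h.symm h1).elim

/-- An inner point of an excursion is an endpoint of a smaller excursion. -/
theorem exists_inner_excursion (hR : IsDepthFunction N R) {a b x : ℕ} (ha : 1 ≤ a)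
    (h : IsExcursion N R a b) (hax : a < x) (hxb : x < b) :
    ∃ c d, IsExcursion N R c d ∧ a ≤ c ∧ d ≤ b ∧ (x = c ∨ x = d) := by
  obtain ⟨h1, h2, h3, h4, h5⟩ := h
  have h0 := hR.nonneg (a - 1)
  have hx := h5 x hax.le hxb
  have hx1 := h5 (x - 1) (by omega) (by omega)
  have hstep := hR.step (x - 1)
  rw [Nat.sub_add_cancel (by omega)] at hstep
  by_cases hup : R (x - 1) < R x
  · obtain ⟨d, hd⟩ := hR.exists_right (by omega) hup
    refine ⟨x, d, hd, hax.le, ?_, Or.inl rfl⟩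
    by_contra! hcon
    have := hd.2.2.2.2 b hxb.le hcon
    omega
  · obtain ⟨c, hc, hcd⟩ := hR.exists_left (b := x) (by omega) (by omega)
    have hper := hR.period (a - 1)
    rw [show a - 1 + N = a + N - 1 by omega] at hper
    have hxN := hcd.2.2.2.1
    rw [hR.period] at hxN
    -- An excursion ending at `x + N` stays above `R x` from its start on, but `R (a + N - 1)` is
    -- below `R x`; so it starts after `a + N`.
    have hac : a + N < c := by
      by_contra! hcon
      rcases hcon.lt_or_eq with hlt | rfl
      · have := hcd.2.2.2.2 (a + N - 1) (by omega) (by omega)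
        omega
      · omega
    refine ⟨c - N, x, ?_, by omega, hxb.le, Or.inr rfl⟩
    rw [← hR.excursion_shift (by omega), Nat.sub_add_cancel (by omega)]
    exact hcd

theorem arcSystem_excursions (hodd : Odd N) (hR : IsDepthFunction N R) :
    IsArcSystem N (excursions N R) := by
  refine ⟨hR.matching_excursions, fun p hp x hx hxp => ?_⟩
  obtain ⟨pp, he⟩ := mem_excursions.1 hp
  rw [mem_dbl pp] at hx
  rw [mem_pairSet] at hxp
  have pp' := mem_pairs.1 pp
  have lp := lift_cases (N := N) p
  -- Lift `x` to the line, adding `N` if it lies on the part of the arc beyond `N`.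
  obtain ⟨y, hy1, hy2, hxy⟩ : ∃ y, p.1 < y ∧ y < lift N p ∧ (y = x ∨ y = x + N) := by
    by_cases h : p.1 < x ∧ x < lift N p
    · exact ⟨x, h.1, h.2, Or.inl rfl⟩
    · exact ⟨x + N, by omega, by omega, Or.inr rfl⟩
  obtain ⟨c, d, hcd, hc, hd, hycd⟩ := hR.exists_inner_excursion pp'.1 he hy1 hy2
  have hlt := hcd.1
  obtain ⟨q, hq, hq'⟩ := exists_mem_excursions hodd hR (c := c) (by omega) (by omega) hcd
  have pq := (mem_excursions.1 hq).1
  have pq' := mem_pairs.1 pq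
  have lq := lift_cases (N := N) q
  refine ⟨q, hq, by rw [mem_pairSet]; omega, fun z hz => ?_⟩
  rw [mem_dbl pq] at hz
  rw [mem_dbl pp]
  omega

theorem exists_fst_iff (hodd : Odd N) (hR : IsDepthFunction N R) {h : ℕ} (hh : h < N) :
    (∃ p ∈ excursions N R, p.1 = h + 1) ↔ R (h + 1) = R h + 1 := by
  constructor
  · rintro ⟨p, hp, hx⟩
    have := fst_up hp
    rw [hx, Nat.add_sub_cancel] at this
    have := hR.step h
    omega
  · intro hup
    obtain ⟨b, hb⟩ := hR.exists_right (a := h + 1) (by omega) (by rw [Nat.add_sub_cancel]; omega)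
    obtain ⟨q, hq, hq1, -⟩ := exists_mem_excursions_of_le hodd (by omega) (by omega) hb
    exact ⟨q, hq, hq1⟩

theorem exists_snd_iff (hodd : Odd N) (hR : IsDepthFunction N R) {h : ℕ} (hh : h < N) :
    (∃ p ∈ excursions N R, p.2 = h + 1) ↔ R (h + 1) = R h - 1 := by
  constructor
  · rintro ⟨p, hp, hx⟩
    have := hR.snd_down hp
    rw [hx, Nat.add_sub_cancel] at this
    have := hR.step h
    omega
  · intro hdown
    obtain ⟨a, ha, hb⟩ := hR.exists_left (b := h + 1) (by omega)
      (by rw [Nat.add_sub_cancel]; omega)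
    have := hb.1
    obtain ⟨q, hq, hq1⟩ := exists_mem_excursions hodd hR (by omega) (by omega) hb
    have pq := mem_pairs.1 (mem_excursions.1 hq).1
    have lq := lift_cases (N := N) q
    exact ⟨q, hq, by omega⟩

/-- Both functions rise and fall at the same points. They agree at a free point: the walk is flat
there, hence at level 0. -/
theorem depth_excursions (hodd : Odd N) (hR : IsDepthFunction N R) (h : ℕ) (hh : h ≤ N) :
    depth (excursions N R) h = R h := by
  have hM := hR.matching_excursions
  obtain ⟨x, hxN, hx⟩ := hM.exists_notMem_supp hodd
  refine cyclic_induction (P := fun h => depth (excursions N R) h = R h) x hxN.le ?_ ?_ ?_ h hh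
  · rw [((hR.arcSystem_excursions hodd).filled.depth_eq_zero hxN hx).1]
    have h1 := mt (hR.exists_fst_iff hodd hxN).2 fun ⟨p, hp, h⟩ =>
      hx (mem_supp.2 ⟨p, hp, by rw [← h]; exact fst_mem_pairSet p⟩)
    have h2 := mt (hR.exists_snd_iff hodd hxN).2 fun ⟨p, hp, h⟩ =>
      hx (mem_supp.2 ⟨p, hp, by rw [← h]; exact snd_mem_pairSet p⟩)
    have := hR.step x
    omega
  · intro k hk ih
    rw [hM.depth_succ, ih]
    simp only [hR.exists_fst_iff hodd hk, hR.exists_snd_iff hodd hk]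
    have := hR.step k
    split_ifs <;> omega
  · intro ih
    rw [← hM.depth_period, ih]
    simpa using hR.period 0

end IsDepthFunction

/-- In the numbering 0, -2, 2, -4, … the map `g ↦ -g` fixes 0 and swaps the numbers 1↔2, 3↔4, …,
while `g ↦ -g - 2` swaps 0↔1, 2↔3, …. -/
theorem isDepthFunction_fold {N : ℕ} (hodd : Odd N) {Z : Finset ℕ} (hZ : Z ∈ E N) :
    IsDepthFunction N fun h => fold (h % N) Z := by
  rw [mem_E] at hZ
  have hpos := hodd.pos
  refine ⟨hpos, fun h => ?_, fun h => by simp, fun h => ?_⟩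
  · unfold fold; split_ifs <;> omega
  · have key : fold ((h + 1) % N) Z = fold (h % N + 1) Z := by
      have hlt := Nat.mod_lt h hpos
      by_cases hh : h % N + 1 = N
      · rw [hh, Nat.add_mod, ← Nat.add_mod]
        have : (h + 1) % N = 0 := by
          rw [← Nat.mod_add_mod, hh, Nat.mod_self]
        rw [this]
        unfold fold
        rw [gamAt_period hodd hZ.1]
      · rw [← Nat.mod_add_mod, Nat.mod_eq_of_lt (by omega)]
    rw [key]
    have h1 := gamAt_succ (h % N) Z
    have h2 := gamAt_even hZ.2 (h % N)
    have h3 := gamAt_even hZ.2 (h % N + 1)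
    rw [Int.even_iff] at h2 h3
    unfold fold
    split_ifs at * <;> omega

/-- Every element of `E_N` is `∑ [[ij]]` for an arc system. -/
theorem exists_arcSystem {N : ℕ} (hodd : Odd N) {Z : Finset ℕ} (hZ : Z ∈ E N) :
    ∃ C, IsArcSystem N C ∧ fsum C (dbl N) = Z := by
  have hR := isDepthFunction_fold hodd hZ
  have hC := hR.arcSystem_excursions hodd
  refine ⟨_, hC, eq_of_fold_eq (hC.matching.fsum_dbl_mem_E hodd) hZ fun h hh => ?_⟩
  rw [hC.filled.fold_fsum_dbl hodd h hh, hR.depth_excursions hodd h hh]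
  rcases hh.lt_or_eq with hlt | rfl
  · rw [Nat.mod_eq_of_lt hlt]
  · rw [Nat.mod_self]
    unfold fold
    rw [gamAt_period hodd (mem_E.1 hZ).1]

end Lusztig

/-! ### Covered sets and `i_*` in terms of arcs. -/

namespace Lusztig

theorem mem_B0 {B : Finset (ℕ × ℕ)} {p : ℕ × ℕ} : p ∈ B0 B ↔ p ∈ B ∧ p.2 < p.1 :=
  Finset.mem_filter

theorem mem_B1 {B : Finset (ℕ × ℕ)} {p : ℕ × ℕ} : p ∈ B1 B ↔ p ∈ B ∧ p.1 < p.2 :=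
  Finset.mem_filter

/-! ### Covered sets -/

theorem ZeroCovered.union {C : Finset (ℕ × ℕ)} {X Y : Finset ℕ} (hX : ZeroCovered C X)
    (hY : ZeroCovered C Y) (h : Disjoint X Y) : ZeroCovered C (X ∪ Y) := by
  obtain ⟨D, hD, hd, rfl⟩ := hX
  obtain ⟨D', hD', hd', rfl⟩ := hY
  rw [Finset.mem_powerset] at hD hD'
  refine ⟨D ∪ D', Finset.mem_powerset.2 (Finset.union_subset hD hD'), ?_, ?_⟩
  · have key : ∀ p ∈ D, ∀ q ∈ D', Disjoint (Finset.Icc p.1 p.2) (Finset.Icc q.1 q.2) :=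
      fun p hp q hq => h.mono (Finset.subset_biUnion_of_mem (fun p : ℕ × ℕ => Finset.Icc p.1 p.2) hp)
        (Finset.subset_biUnion_of_mem (fun p : ℕ × ℕ => Finset.Icc p.1 p.2) hq)
    intro p hp q hq hne
    rcases Finset.mem_union.1 hp with hp | hp <;> rcases Finset.mem_union.1 hq with hq | hq
    · exact hd p hp q hq hne
    · exact key p hp q hq
    · exact (key q hq p hp).symm
    · exact hd' p hp q hq hne
  · rw [Finset.union_biUnion]

theorem ZeroCovered.empty (C : Finset (ℕ × ℕ)) : ZeroCovered C ∅ :=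
  ⟨∅, by simp, by simp, by simp⟩

theorem ZeroCovered.interval {C : Finset (ℕ × ℕ)} {p : ℕ × ℕ} (hp : p ∈ C) :
    ZeroCovered C (Finset.Icc p.1 p.2) :=
  ⟨{p}, by simpa using hp, by
    intro a ha b hb hne
    rw [Finset.mem_singleton] at ha hb
    exact absurd (ha.trans hb.symm) hne, by simp⟩

theorem ZeroCovered.even_card {N : ℕ} {C : Finset (ℕ × ℕ)} (hC : ∀ p ∈ C, p ∈ pairs N)
    {X : Finset ℕ} (hX : ZeroCovered (B1 C) X) : Even X.card := by
  obtain ⟨D, hD, hd, rfl⟩ := hX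
  rw [Finset.mem_powerset] at hD
  rw [Finset.card_biUnion hd]
  refine Finset.even_sum _ fun p hp => ?_
  have h1 := mem_B1.1 (hD hp)
  have h2 := mem_pairs.1 (hC p h1.1)
  rw [Nat.card_Icc, Nat.even_iff]
  omega

/-- No interval of the cover contains `u`, so each lies entirely on one side of it. -/
theorem ZeroCovered.erase {C : Finset (ℕ × ℕ)} {a b u : ℕ}
    (hu : 1 ≤ u) (hau : a ≤ u) (hub : u ≤ b) (h : ZeroCovered C ((Finset.Icc a b).erase u)) :
    ZeroCovered C (Finset.Icc a (u - 1)) ∧ ZeroCovered C (Finset.Icc (u + 1) b) := by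
  obtain ⟨D, hD, hd, hX⟩ := h
  rw [Finset.mem_powerset] at hD
  have hav : ∀ p ∈ D, ∀ x, p.1 ≤ x → x ≤ p.2 → a ≤ x ∧ x ≤ b ∧ x ≠ u := fun p hp x h1 h2 => by
    have : x ∈ (Finset.Icc a b).erase u := by
      rw [← hX]
      exact Finset.mem_biUnion.2 ⟨p, hp, Finset.mem_Icc.2 ⟨h1, h2⟩⟩
    rw [Finset.mem_erase, Finset.mem_Icc] at this
    exact ⟨this.2.1, this.2.2, this.1⟩
  have hcov : ∀ x, a ≤ x → x ≤ b → x ≠ u → ∃ p ∈ D, p.1 ≤ x ∧ x ≤ p.2 := fun x h1 h2 h3 => by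
    have : x ∈ D.biUnion fun p => Finset.Icc p.1 p.2 := by
      rw [hX, Finset.mem_erase, Finset.mem_Icc]
      exact ⟨h3, h1, h2⟩
    obtain ⟨p, hp, hx⟩ := Finset.mem_biUnion.1 this
    exact ⟨p, hp, Finset.mem_Icc.1 hx⟩
  refine ⟨⟨D.filter fun p => p.2 < u, ?_, ?_, ?_⟩, ⟨D.filter fun p => u < p.1, ?_, ?_, ?_⟩⟩
  · exact Finset.mem_powerset.2 ((Finset.filter_subset _ _).trans hD)
  · exact fun p hp q hq => hd p (Finset.mem_filter.1 hp).1 q (Finset.mem_filter.1 hq).1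
  · ext x
    simp only [Finset.mem_biUnion, Finset.mem_filter, Finset.mem_Icc]
    constructor
    · rintro ⟨p, ⟨hp, hpu⟩, h1, h2⟩
      have := hav p hp x h1 h2
      omega
    · rintro ⟨h1, h2⟩
      obtain ⟨p, hp, h3, h4⟩ := hcov x h1 (by omega) (by omega)
      refine ⟨p, ⟨hp, ?_⟩, h3, h4⟩
      by_contra! hcon
      exact (hav p hp u (by omega) hcon).2.2 rfl
  · exact Finset.mem_powerset.2 ((Finset.filter_subset _ _).trans hD)
  · exact fun p hp q hq => hd p (Finset.mem_filter.1 hp).1 q (Finset.mem_filter.1 hq).1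
  · ext x
    simp only [Finset.mem_biUnion, Finset.mem_filter, Finset.mem_Icc]
    constructor
    · rintro ⟨p, ⟨hp, hpu⟩, h1, h2⟩
      have := hav p hp x h1 h2
      omega
    · rintro ⟨h1, h2⟩
      obtain ⟨p, hp, h3, h4⟩ := hcov x (by omega) h2 (by omega)
      refine ⟨p, ⟨hp, ?_⟩, h3, h4⟩
      by_contra! hcon
      exact (hav p hp u hcon (by omega)).2.2 rfl

/-- Every point of a covered set is matched by an arc inside the set. -/
theorem ZeroCovered.exists_mem {B : Finset (ℕ × ℕ)}
    (hB : ∀ p ∈ B1 B, ZeroCovered (B1 B) (Finset.Icc (p.1 + 1) (p.2 - 1))) {X : Finset ℕ}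
    (hX : ZeroCovered (B1 B) X) {x : ℕ} (hx : x ∈ X) :
    ∃ q ∈ B1 B, x ∈ pairSet q ∧ Finset.Icc q.1 q.2 ⊆ X := by
  induction hn : X.card using Nat.strong_induction_on generalizing X with
  | _ n ih =>
    have hX' := hX
    obtain ⟨D, hD, hd, rfl⟩ := hX'
    rw [Finset.mem_powerset] at hD
    obtain ⟨p, hp, hxp⟩ := Finset.mem_biUnion.1 hx
    have hsub := Finset.subset_biUnion_of_mem (fun p : ℕ × ℕ => Finset.Icc p.1 p.2) hp
    rw [Finset.mem_Icc] at hxp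
    by_cases hpx : x ∈ pairSet p
    · exact ⟨p, hD hp, hpx, hsub⟩
    · rw [mem_pairSet] at hpx
      have hss : Finset.Icc (p.1 + 1) (p.2 - 1) ⊆ Finset.Icc p.1 p.2 :=
        Finset.Icc_subset_Icc (by omega) (by omega)
      have hlt : (Finset.Icc (p.1 + 1) (p.2 - 1)).card < n := by
        rw [← hn]
        refine lt_of_lt_of_le ?_ (Finset.card_le_card hsub)
        rw [Nat.card_Icc, Nat.card_Icc]; omega
      obtain ⟨q, hq, h1, h2⟩ := ih _ hlt (hB p (hD hp))
        (Finset.mem_Icc.2 (by omega)) rfl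
      exact ⟨q, hq, h1, (h2.trans hss).trans hsub⟩

/-- Every point of `[a,b]` is matched by an arc of `B¹` inside `[a,b]`. -/
def Covers (B : Finset (ℕ × ℕ)) (a b : ℕ) : Prop :=
  ∀ x, a ≤ x → x ≤ b → ∃ q ∈ B, x ∈ pairSet q ∧ q.1 < q.2 ∧ a ≤ q.1 ∧ q.2 ≤ b

/-- Split off the arc `q` starting at `a` and recurse on what lies to its right. -/
theorem Covers.zeroCovered {N : ℕ} {B : Finset (ℕ × ℕ)} (hM : IsMatching N B)
    (hB : ∀ p ∈ B, p.1 < p.2 → Covers B (p.1 + 1) (p.2 - 1)) {a b : ℕ} (h : Covers B a b) :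
    ZeroCovered (B1 B) (Finset.Icc a b) := by
  induction hn : b + 1 - a using Nat.strong_induction_on generalizing a with
  | _ n ih =>
    by_cases hab : b < a
    · rw [Finset.Icc_eq_empty (by omega)]; exact ZeroCovered.empty _
    obtain ⟨q, hq, haq, hlt, h1, h2⟩ := h a le_rfl (by omega)
    have hqa : q.1 = a := by rw [mem_pairSet] at haq; omega
    have hrest : Covers B (q.2 + 1) b := by
      intro x hx hxb
      obtain ⟨r, hr, hxr, hltr, h3, h4⟩ := h x (by omega) hxb
      refine ⟨r, hr, hxr, hltr, ?_, h4⟩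
      by_contra! hcon
      have hne : r ≠ q := by rintro rfl; rw [mem_pairSet] at hxr; omega
      -- An arc starting before the end of `q` would start inside `q`, and then also end inside it.
      have h5 : r.1 ∉ pairSet q := fun h' => hne (hM.disj r hr q hq r.1 (fst_mem_pairSet r) h')
      rw [mem_pairSet] at h5 hxr
      obtain ⟨t, ht, hrt, -, -, h6⟩ := hB q hq hlt r.1 (by omega) (by omega)
      rw [hM.disj t ht r hr r.1 hrt (fst_mem_pairSet r)] at h6
      omega
    have := (ZeroCovered.interval (mem_B1.2 ⟨hq, hlt⟩)).union (ih _ (by omega) hrest rfl) (by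
      rw [Finset.disjoint_left]; intro x hx hx'; rw [Finset.mem_Icc] at hx hx'; omega)
    convert this using 1
    ext x
    rw [Finset.mem_union, Finset.mem_Icc, Finset.mem_Icc, Finset.mem_Icc]
    omega

/-! ### The sequence `i_*` -/

section iStar

variable {N : ℕ} {B : Finset (ℕ × ℕ)}

theorem B0_subset (B : Finset (ℕ × ℕ)) : B0 B ⊆ B := Finset.filter_subset _ _

theorem iStar_eq_getElem (hM : IsMatching N B) {k : ℕ} (hk : 1 ≤ k) (hk' : k ≤ 2 * (B0 B).card) :
    ∃ h : k - 1 < ((supp (B0 B)).sort (· ≤ ·)).length,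
      iStar B k = ((supp (B0 B)).sort (· ≤ ·))[k - 1] := by
  have hl : ((supp (B0 B)).sort (· ≤ ·)).length = 2 * (B0 B).card := by
    rw [Finset.length_sort, (hM.mono (B0_subset B)).card_supp]
  exact ⟨by omega, List.getD_eq_getElem _ _ (by omega)⟩

theorem iStar_mem (hM : IsMatching N B) {k : ℕ} (hk : 1 ≤ k) (hk' : k ≤ 2 * (B0 B).card) :
    iStar B k ∈ supp (B0 B) := by
  obtain ⟨h, he⟩ := iStar_eq_getElem hM hk hk'
  rw [he, ← Finset.mem_sort (r := (· ≤ ·))]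
  exact List.getElem_mem h

theorem iStar_lt (hM : IsMatching N B) {k m : ℕ} (hk : 1 ≤ k) (hkm : k < m)
    (hm : m ≤ 2 * (B0 B).card) : iStar B k < iStar B m := by
  obtain ⟨h, he⟩ := iStar_eq_getElem hM hk (by omega)
  obtain ⟨h', he'⟩ := iStar_eq_getElem hM (by omega : 1 ≤ m) hm
  rw [he, he']
  exact (Finset.sortedLT_sort _).getElem_lt_getElem_of_lt (by omega)

theorem exists_iStar (hM : IsMatching N B) {x : ℕ} (hx : x ∈ supp (B0 B)) :
    ∃ k, 1 ≤ k ∧ k ≤ 2 * (B0 B).card ∧ iStar B k = x := by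
  have hl : ((supp (B0 B)).sort (· ≤ ·)).length = 2 * (B0 B).card := by
    rw [Finset.length_sort, (hM.mono (B0_subset B)).card_supp]
  rw [← Finset.mem_sort (r := (· ≤ ·))] at hx
  obtain ⟨n, hn, rfl⟩ := List.getElem_of_mem hx
  refine ⟨n + 1, by omega, by omega, ?_⟩
  exact List.getD_eq_getElem _ _ hn

/-- The index of a point is found by counting smaller points; this is how arcs are located in `i_*`.
-/
theorem iStar_card (hM : IsMatching N B) {x : ℕ} (hx : x ∈ supp (B0 B)) :
    iStar B (((supp (B0 B)).filter (· < x)).card + 1) = x := by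
  obtain ⟨k, hk, hk', rfl⟩ := exists_iStar hM hx
  have : (supp (B0 B)).filter (· < iStar B k) = (Finset.Icc 1 (k - 1)).image (iStar B) := by
    ext y
    rw [Finset.mem_filter, Finset.mem_image]
    constructor
    · rintro ⟨hy, hlt⟩
      obtain ⟨m, hm, hm', rfl⟩ := exists_iStar hM hy
      refine ⟨m, Finset.mem_Icc.2 ⟨hm, ?_⟩, rfl⟩
      by_contra! hcon
      rcases (by omega : k = m ∨ k < m) with rfl | h
      · exact lt_irrefl _ hlt
      · exact absurd (iStar_lt hM hk h hm') hlt.not_gt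
    · rintro ⟨m, hm, rfl⟩
      rw [Finset.mem_Icc] at hm
      exact ⟨iStar_mem hM hm.1 (by omega), iStar_lt hM hm.1 (by omega) hk'⟩
  rw [this, Finset.card_image_of_injOn, Nat.card_Icc]
  · congr 1; omega
  · intro a ha b hb hab
    rw [Finset.coe_Icc, Set.mem_Icc] at ha hb
    rcases lt_trichotomy a b with h | h | h
    · exact absurd hab (iStar_lt hM ha.1 h (by omega)).ne
    · exact h
    · exact absurd hab.symm (iStar_lt hM hb.1 h (by omega)).ne

/-- The nested arcs of `B⁰` are spelled by `i_*`. -/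
theorem exists_eq_iStar (hM : IsMatching N B)
    (hn : ∀ p ∈ B0 B, ∀ q ∈ B0 B, p ≠ q → (p.2 < q.2 ∧ q.1 < p.1) ∨ (q.2 < p.2 ∧ p.1 < q.1))
    {p : ℕ × ℕ} (hp : p ∈ B0 B) :
    ∃ k ∈ Finset.Icc 1 (B0 B).card, (iStar B (2 * (B0 B).card + 1 - k), iStar B k) = p := by
  have hM0 := hM.mono (B0_subset B)
  have hn' : ∀ q ∈ B0 B, p = q ∨ (p.2 < q.2 ∧ q.1 < p.1) ∨ (q.2 < p.2 ∧ p.1 < q.1) :=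
    fun q hq => or_iff_not_imp_left.2 (hn p hp q hq)
  have hlt : ∀ q ∈ B0 B, q.2 < q.1 := fun q hq => (mem_B0.1 hq).2
  have hplt := hlt p hp
  have inj1 : Set.InjOn Prod.fst (B0 B : Set (ℕ × ℕ)) := fun a ha b hb hab =>
    hM0.disj a ha b hb a.1 (fst_mem_pairSet a) (by rw [hab]; exact fst_mem_pairSet b)
  have inj2 : Set.InjOn Prod.snd (B0 B : Set (ℕ × ℕ)) := fun a ha b hb hab =>
    hM0.disj a ha b hb a.2 (snd_mem_pairSet a) (by rw [hab]; exact snd_mem_pairSet b)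
  -- The index sought is `m + 1`: nestedness orders the arcs by their smaller endpoints.
  set m := ((B0 B).filter fun q => q.2 < p.2).card with hm
  have e1 : ((supp (B0 B)).filter (· < p.2)).card = m := by
    rw [hm, ← Finset.card_image_of_injOn (inj2.mono (by
      intro q hq; exact (Finset.mem_filter.1 hq).1))]
    congr 1
    ext x
    simp only [Finset.mem_filter, Finset.mem_image, mem_supp]
    constructor
    · rintro ⟨⟨q, hq, hx⟩, hxp⟩
      have := hlt q hq
      rw [mem_pairSet] at hx
      rcases hx with rfl | rfl
      · rcases hn' q hq with h | h | h
        · rw [h] at hxp; omega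
        · omega
        · omega
      · exact ⟨q, ⟨hq, hxp⟩, rfl⟩
    · rintro ⟨q, ⟨hq, hx⟩, rfl⟩
      exact ⟨⟨q, hq, snd_mem_pairSet q⟩, hx⟩
  -- Below `p.1` lie all `s` smaller endpoints and the larger endpoints of the `s - m - 1` arcs with
  -- smaller endpoint beyond `p.2`.
  have e2 : ((supp (B0 B)).filter (· < p.1)).card + m + 1 = 2 * (B0 B).card := by
    have hsplit : (supp (B0 B)).filter (· < p.1) =
        (B0 B).image Prod.snd ∪ ((B0 B).filter fun q => p.2 < q.2).image Prod.fst := by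
      ext x
      simp only [Finset.mem_filter, Finset.mem_image, mem_supp, Finset.mem_union]
      constructor
      · rintro ⟨⟨q, hq, hx⟩, hxp⟩
        have := hlt q hq
        rw [mem_pairSet] at hx
        rcases hx with rfl | rfl
        · right
          refine ⟨q, ⟨hq, ?_⟩, rfl⟩
          rcases hn' q hq with h | h | h
          · rw [h] at hxp; omega
          · omega
          · omega
        · exact Or.inl ⟨q, hq, rfl⟩
      · rintro (⟨q, hq, rfl⟩ | ⟨q, ⟨hq, hx⟩, rfl⟩)
        · refine ⟨⟨q, hq, snd_mem_pairSet q⟩, ?_⟩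
          have := hlt q hq
          rcases hn' q hq with h | h | h
          · rw [← h]; omega
          · omega
          · omega
        · refine ⟨⟨q, hq, fst_mem_pairSet q⟩, ?_⟩
          rcases hn' q hq with h | h | h
          · rw [h] at hx; omega
          · omega
          · omega
    have hdis : Disjoint ((B0 B).image Prod.snd)
        (((B0 B).filter fun q => p.2 < q.2).image Prod.fst) := by
      rw [Finset.disjoint_left]
      intro x hx hx'
      obtain ⟨q, hq, rfl⟩ := Finset.mem_image.1 hx
      obtain ⟨r, hr, h⟩ := Finset.mem_image.1 hx'
      have hr := (Finset.mem_filter.1 hr).1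
      have := hM0.disj q hq r hr q.2 (snd_mem_pairSet q) (by rw [← h]; exact fst_mem_pairSet r)
      subst this
      have := hlt q hq
      omega
    rw [hsplit, Finset.card_union_of_disjoint hdis, Finset.card_image_of_injOn inj2,
      Finset.card_image_of_injOn (inj1.mono (by
        intro q hq; exact (Finset.mem_filter.1 hq).1))]
    have h3 : (B0 B).filter (fun q => ¬ q.2 < p.2) =
        insert p ((B0 B).filter fun q => p.2 < q.2) := by
      ext q
      simp only [Finset.mem_filter, Finset.mem_insert]
      constructor
      · rintro ⟨hq, hx⟩
        rcases hn' q hq with h | h | h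
        · exact Or.inl h.symm
        · exact Or.inr ⟨hq, h.1⟩
        · omega
      · rintro (rfl | ⟨hq, hx⟩)
        · exact ⟨hp, lt_irrefl _⟩
        · exact ⟨hq, by omega⟩
    have h4 := Finset.card_filter_add_card_filter_not (s := B0 B) (fun q => q.2 < p.2)
    rw [h3, Finset.card_insert_of_notMem (by simp)] at h4
    omega
  have c1 := iStar_card hM (mem_supp.2 ⟨p, hp, fst_mem_pairSet p⟩)
  have c2 := iStar_card hM (mem_supp.2 ⟨p, hp, snd_mem_pairSet p⟩)
  have hle : m < (B0 B).card := by
    refine Finset.card_lt_card ⟨Finset.filter_subset _ _, fun h => ?_⟩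
    exact lt_irrefl _ (Finset.mem_filter.1 (h hp)).2
  refine ⟨m + 1, Finset.mem_Icc.2 (by omega), Prod.ext ?_ ?_⟩
  · rw [← c1]; dsimp only; congr 1; omega
  · rw [← c2, e1]

/-- A criterion for `IsStar` that speaks only of arcs; the sequence `i_*` is recovered from the
nesting. -/
theorem isStar_of_nested (hM : IsMatching N B)
    (h1 : ∀ p ∈ B, p.1 < p.2 → Covers B (p.1 + 1) (p.2 - 1))
    (hn : ∀ p ∈ B0 B, ∀ q ∈ B0 B, p ≠ q → (p.2 < q.2 ∧ q.1 < p.1) ∨ (q.2 < p.2 ∧ p.1 < q.1))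
    (hlow : ∀ p ∈ B0 B, ∀ q ∈ B0 B, ∀ x, q.2 < x → x < p.2 →
      ∃ r ∈ B, x ∈ pairSet r ∧ (r.2 < r.1 ∨ (r.1 < r.2 ∧ q.2 < r.1 ∧ r.2 < p.2)))
    (hhigh : ∀ p ∈ B0 B, ∀ q ∈ B0 B, ∀ x, p.1 < x → x < q.1 →
      ∃ r ∈ B, x ∈ pairSet r ∧ (r.2 < r.1 ∨ (r.1 < r.2 ∧ p.1 < r.1 ∧ r.2 < q.1))) :
    IsStar B := by
  have himg : B0 B = (Finset.Icc 1 (B0 B).card).image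
      (fun k => (iStar B (2 * (B0 B).card + 1 - k), iStar B k)) := by
    -- Every arc is in the image, and the image has at most `|B⁰|` elements.
    refine Finset.eq_of_subset_of_card_le (fun p hp => ?_) ?_
    · obtain ⟨k, hk, he⟩ := exists_eq_iStar hM hn hp
      exact Finset.mem_image.2 ⟨k, hk, he⟩
    · refine Finset.card_image_le.trans ?_
      rw [Nat.card_Icc]; omega
  have harc : ∀ k, 1 ≤ k → k ≤ (B0 B).card →
      (iStar B (2 * (B0 B).card + 1 - k), iStar B k) ∈ B0 B := by
    intro k hk hk'
    exact (Finset.ext_iff.1 himg _).2 (Finset.mem_image.2 ⟨k, Finset.mem_Icc.2 ⟨hk, hk'⟩, rfl⟩)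
  have hgap : ∀ k, 1 ≤ k → k + 1 ≤ 2 * (B0 B).card → ∀ x, iStar B k < x → x < iStar B (k + 1) →
      x ∉ supp (B0 B) := by
    intro k hk hk' x hx hx' hmem
    obtain ⟨m, hm, hm', rfl⟩ := exists_iStar hM hmem
    rcases (by omega : m < k ∨ m = k ∨ m = k + 1 ∨ k + 1 < m) with h | rfl | rfl | h
    · have := iStar_lt hM hm h (by omega); omega
    · omega
    · omega
    · have := iStar_lt hM (by omega) h hm'; omega
  refine ⟨fun p hp => (h1 p (mem_B1.1 hp).1 (mem_B1.1 hp).2).zeroCovered hM h1, himg,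
    fun k hk => Covers.zeroCovered hM h1 fun x hx hx' => ?_,
    fun k hk => Covers.zeroCovered hM h1 fun x hx hx' => ?_⟩
  · rw [Finset.mem_Icc] at hk
    obtain ⟨r, hr, hxr, h | h⟩ := hlow _ (harc (k + 1) (by omega) (by omega)) _
      (harc k (by omega) (by omega)) x (by dsimp only; omega) (by dsimp only; omega)
    · exact absurd (mem_supp.2 ⟨r, mem_B0.2 ⟨hr, h⟩, hxr⟩)
        (hgap k (by omega) (by omega) x (by omega) (by omega))
    · dsimp only at h
      exact ⟨r, hr, hxr, h.1, by omega, by omega⟩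
  · rw [Finset.mem_Icc] at hk
    -- In the upper half, the arc with larger endpoint `i_k` has index `2s + 1 - k`.
    have a1 := harc (2 * (B0 B).card - k + 1) (by omega) (by omega)
    have a2 := harc (2 * (B0 B).card - k) (by omega) (by omega)
    rw [show 2 * (B0 B).card + 1 - (2 * (B0 B).card - k + 1) = k by omega] at a1
    rw [show 2 * (B0 B).card + 1 - (2 * (B0 B).card - k) = k + 1 by omega] at a2
    obtain ⟨r, hr, hxr, h | h⟩ := hhigh _ a1 _ a2 x (by dsimp only; omega) (by dsimp only; omega)
    · exact absurd (mem_supp.2 ⟨r, mem_B0.2 ⟨hr, h⟩, hxr⟩)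
        (hgap k (by omega) (by omega) x (by omega) (by omega))
    · dsimp only at h
      exact ⟨r, hr, hxr, h.1, by omega, by omega⟩

end iStar

end Lusztig

/-! ### From elements of `X N` to arc systems. -/

namespace Lusztig

section

variable {N : ℕ} {B : Finset (ℕ × ℕ)}

theorem IsStar.arc_mem (hS : IsStar B) {k : ℕ} (hk : 1 ≤ k) (hk' : k ≤ (B0 B).card) :
    (iStar B (2 * (B0 B).card + 1 - k), iStar B k) ∈ B0 B :=
  (Finset.ext_iff.1 hS.2.1 _).2 (Finset.mem_image.2 ⟨k, Finset.mem_Icc.2 ⟨hk, hk'⟩, rfl⟩)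

theorem IsStar.exists_arc (hS : IsStar B) {p : ℕ × ℕ} (hp : p ∈ B0 B) :
    ∃ k, 1 ≤ k ∧ k ≤ (B0 B).card ∧ p = (iStar B (2 * (B0 B).card + 1 - k), iStar B k) := by
  obtain ⟨k, hk, rfl⟩ := Finset.mem_image.1 ((Finset.ext_iff.1 hS.2.1 _).1 hp)
  rw [Finset.mem_Icc] at hk
  exact ⟨k, hk.1, hk.2, rfl⟩

/-- The innermost arc of `B⁰`. -/
theorem IsStar.inner_mem (hS : IsStar B) (hs : (B0 B).card ≠ 0) :
    (iLast B, iStar B 1) ∈ B0 B := by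
  have := hS.arc_mem (k := 1) le_rfl (by omega)
  rwa [Nat.add_sub_cancel] at this

theorem iStar_one_le (hM : IsMatching N B) {x : ℕ} (hx : x ∈ supp (B0 B)) :
    iStar B 1 ≤ x ∧ x ≤ iLast B := by
  obtain ⟨k, hk, hk', rfl⟩ := exists_iStar hM hx
  unfold iLast
  constructor
  · rcases hk.lt_or_eq with h | h
    · exact (iStar_lt hM le_rfl h hk').le
    · rw [← h]
  · rcases hk'.lt_or_eq with h | h
    · exact (iStar_lt hM hk h le_rfl).le
    · rw [← h]

theorem dbl_subset_of_lt (p : ℕ × ℕ) {q : ℕ × ℕ} (hp : p ∈ pairs N) (hq : q ∈ pairs N)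
    (h1 : p.2 < p.1) (h2 : q.1 < q.2) (h : q.2 ≤ p.2 ∨ p.1 ≤ q.1) : dbl N q ⊆ dbl N p := by
  intro x hx
  rw [mem_dbl hq] at hx
  rw [mem_dbl hp]
  rw [mem_pairs] at hq
  omega

/-- The nesting property for arcs of `B`, with partners allowed in a larger set `C` (later `B`,
possibly with the arc at `N` added). The arc with index `k + 1` exceeds that with index `k` by two
0-covered gaps, so all reduces to the innermost arc, treated by `hout`. -/
theorem IsStar.nest (hM : IsMatching N B) (hS : IsStar B) {C : Finset (ℕ × ℕ)} (hBC : B ⊆ C)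
    (hout : (B0 B).card ≠ 0 → ∀ x, (1 ≤ x ∧ x < iStar B 1) ∨ (iLast B < x ∧ x ≤ N) →
      ∃ q ∈ C, x ∈ pairSet q ∧ dbl N q ⊆ dbl N (iLast B, iStar B 1))
    {p : ℕ × ℕ} (hp : p ∈ B) {x : ℕ} (hx : x ∈ dbl N p) (hxp : x ∉ pairSet p) :
    ∃ q ∈ C, x ∈ pairSet q ∧ dbl N q ⊆ dbl N p := by
  have pp := hM.sub p hp
  rcases (mem_pairs.1 pp).2.2.2.2 with h | h
  · rw [mem_dbl pp] at hx
    rw [mem_pairSet] at hxp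
    obtain ⟨q, hq, hxq, hsub⟩ := ZeroCovered.exists_mem hS.1 (hS.1 p (mem_B1.2 ⟨hp, h.1⟩))
      (x := x) (Finset.mem_Icc.2 (by omega))
    rw [mem_B1] at hq
    refine ⟨q, hBC hq.1, hxq, fun y hy => ?_⟩
    rw [mem_dbl (hM.sub q hq.1)] at hy
    have := Finset.mem_Icc.1 (hsub (Finset.mem_Icc.2 (by omega : q.1 ≤ y ∧ y ≤ q.2)))
    rw [mem_dbl pp]
    omega
  · obtain ⟨k, hk, hk', rfl⟩ := hS.exists_arc (mem_B0.2 ⟨hp, h.1⟩)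
    clear hp pp h
    induction k, hk using Nat.le_induction generalizing x with
    | base =>
      rw [Nat.add_sub_cancel] at hx hxp ⊢
      have p1 := hM.sub _ (B0_subset B (hS.inner_mem (by omega)))
      rw [← iLast] at hx hxp ⊢
      rw [mem_dbl p1] at hx
      rw [mem_pairSet] at hxp
      have := mem_B0.1 (hS.inner_mem (by omega))
      dsimp only at hx hxp this
      exact hout (by omega) x (by omega)
    | succ k hk ih =>
      have a1 := hS.arc_mem hk (by omega)
      have a2 := hS.arc_mem (k := k + 1) (by omega) hk'
      have b1 := hM.sub _ (B0_subset B a1)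
      have b2 := hM.sub _ (B0_subset B a2)
      have l1 := iStar_lt hM hk (by omega : k < k + 1) (by omega)
      have l2 := iStar_lt hM (by omega : 1 ≤ 2 * (B0 B).card + 1 - (k + 1))
        (by omega : _ < 2 * (B0 B).card + 1 - k) (by omega)
      have c1 := (mem_B0.1 a1).2
      have c2 := (mem_B0.1 a2).2
      have hsub : dbl N (iStar B (2 * (B0 B).card + 1 - k), iStar B k) ⊆
          dbl N (iStar B (2 * (B0 B).card + 1 - (k + 1)), iStar B (k + 1)) := by
        intro y hy
        rw [mem_dbl b1] at hy
        rw [mem_dbl b2]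
        dsimp only at *
        omega
      by_cases hx1 : x ∈ dbl N (iStar B (2 * (B0 B).card + 1 - k), iStar B k)
      · by_cases hx2 : x ∈ pairSet (iStar B (2 * (B0 B).card + 1 - k), iStar B k)
        · exact ⟨_, hBC (B0_subset B a1), hx2, hsub⟩
        · obtain ⟨q, hq, hxq, hq'⟩ := ih (by omega) hx1 hx2
          exact ⟨q, hq, hxq, hq'.trans hsub⟩
      · rw [mem_dbl b2] at hx
        rw [mem_dbl b1] at hx1
        rw [mem_pairSet] at hxp
        dsimp only at hx hx1 hxp c1 c2
        have hz : ∃ q ∈ B1 B, x ∈ pairSet q ∧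
            (q.2 ≤ iStar B (k + 1) ∨ iStar B (2 * (B0 B).card + 1 - (k + 1)) ≤ q.1) := by
          rcases (by omega : (iStar B k < x ∧ x < iStar B (k + 1)) ∨
            (iStar B (2 * (B0 B).card + 1 - (k + 1)) < x ∧
              x < iStar B (2 * (B0 B).card + 1 - k))) with h | h
          · obtain ⟨q, hq, hxq, hsub⟩ := ZeroCovered.exists_mem hS.1
              (hS.2.2.1 k (Finset.mem_Icc.2 (by omega))) (x := x) (Finset.mem_Icc.2 (by omega))
            have h1 := mem_B1.1 hq
            have := Finset.mem_Icc.1 (hsub (Finset.mem_Icc.2 ⟨h1.2.le, le_rfl⟩))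
            exact ⟨q, hq, hxq, Or.inl (by omega)⟩
          · have hg := hS.2.2.2 (2 * (B0 B).card + 1 - (k + 1)) (Finset.mem_Icc.2 (by omega))
            rw [show 2 * (B0 B).card + 1 - (k + 1) + 1 = 2 * (B0 B).card + 1 - k by omega] at hg
            obtain ⟨q, hq, hxq, hsub⟩ := ZeroCovered.exists_mem hS.1 hg (x := x)
              (Finset.mem_Icc.2 (by omega))
            have h1 := mem_B1.1 hq
            have := Finset.mem_Icc.1 (hsub (Finset.mem_Icc.2 ⟨le_rfl, h1.2.le⟩))
            exact ⟨q, hq, hxq, Or.inr (by omega)⟩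
        obtain ⟨q, hq, hxq, h⟩ := hz
        rw [mem_B1] at hq
        exact ⟨q, hBC hq.1, hxq, dbl_subset_of_lt _ b2 (hM.sub q hq.1) c2 hq.2 h⟩

theorem CondII.exists_isU (hN : CondII N B) (hs : (B0 B).card ≠ 0) : ∃ u, IsU N B u := by
  rcases hN.2 with h | ⟨-, h | h⟩
  · exact absurd h hs
  · obtain ⟨u, hu, hz⟩ := h.1
    have hu' := Finset.mem_Icc.1 hu
    obtain ⟨h1, h2⟩ := hz.erase hu'.1 hu'.1 hu'.2
    exact ⟨u, Or.inl ⟨h, hu, h1, h2⟩⟩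
  · obtain ⟨u, hu, hz⟩ := h.2
    have hu' := Finset.mem_Icc.1 hu
    obtain ⟨h1, h2⟩ := hz.erase (by omega) hu'.1 hu'.2
    exact ⟨u, Or.inr ⟨h, hu, h1, h2⟩⟩

/-- The properties of `u_B` used below. -/
theorem IsU.spec (hM : IsMatching N B) (hS : IsStar B) (hs : (B0 B).card ≠ 0)
    (hNB : N ∉ supp B) {u : ℕ} (hu : IsU N B u) :
    1 ≤ u ∧ u < N ∧ u ∉ supp B ∧ ((u % 2 = 0 ∧ iLast B < u) ∨ (u % 2 = 1 ∧ u < iStar B 1)) ∧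
    ∀ x, (1 ≤ x ∧ x < iStar B 1) ∨ (iLast B < x ∧ x < N) → x ≠ u →
      ∃ q ∈ B, x ∈ pairSet q ∧ q.1 < q.2 ∧ (q.2 < iStar B 1 ∨ iLast B < q.1 ∧ q.2 < N) ∧
        (u < q.1 ∨ q.2 < u) := by
  have hin := hS.inner_mem hs
  have h1 := mem_pairs.1 (hM.sub _ (B0_subset B hin))
  have h2 := (mem_B0.1 hin).2
  dsimp only at h1 h2
  -- a covered interval that avoids `u`
  have cov : ∀ a b x, ZeroCovered (B1 B) (Finset.Icc a b) → a ≤ x → x ≤ b →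
      ∃ q ∈ B, x ∈ pairSet q ∧ q.1 < q.2 ∧ a ≤ q.1 ∧ q.2 ≤ b := by
    intro a b x hz ha hb
    obtain ⟨q, hq, hxq, hsub⟩ := ZeroCovered.exists_mem hS.1 hz (Finset.mem_Icc.2 ⟨ha, hb⟩)
    have hq' := mem_B1.1 hq
    have e1 := Finset.mem_Icc.1 (hsub (Finset.mem_Icc.2 ⟨le_rfl, hq'.2.le⟩))
    have e2 := Finset.mem_Icc.1 (hsub (Finset.mem_Icc.2 ⟨hq'.2.le, le_rfl⟩))
    exact ⟨q, hq'.1, hxq, hq'.2, e1.1, e2.2⟩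
  have evn : ∀ a b, ZeroCovered (B1 B) (Finset.Icc a b) → (b + 1 - a) % 2 = 0 := by
    intro a b hz
    have := hz.even_card hM.sub
    rwa [Nat.card_Icc, Nat.even_iff] at this
  have hmain : 1 ≤ u ∧ u < N ∧
      ((u % 2 = 0 ∧ iLast B < u) ∨ (u % 2 = 1 ∧ u < iStar B 1)) ∧
      ∀ x, (1 ≤ x ∧ x < iStar B 1) ∨ (iLast B < x ∧ x < N) → x ≠ u →
        ∃ q ∈ B, x ∈ pairSet q ∧ q.1 < q.2 ∧ (q.2 < iStar B 1 ∨ iLast B < q.1 ∧ q.2 < N) ∧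
          (u < q.1 ∨ q.2 < u) := by
    rcases hu with ⟨⟨-, hz⟩, hu, hz1, hz2⟩ | ⟨⟨hz, -⟩, hu, hz1, hz2⟩ <;> rw [Finset.mem_Icc] at hu
    · refine ⟨hu.1, by omega, Or.inr ⟨?_, by omega⟩, fun x hx hxu => ?_⟩
      · have := evn _ _ hz1; omega
      · rcases hx with hx | hx
        · rcases lt_or_gt_of_ne hxu with h | h
          · obtain ⟨q, hq, hxq, hlt, ha, hb⟩ := cov _ _ x hz1 hx.1 (by omega)
            exact ⟨q, hq, hxq, hlt, Or.inl (by omega), Or.inr (by omega)⟩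
          · obtain ⟨q, hq, hxq, hlt, ha, hb⟩ := cov _ _ x hz2 (by omega) (by omega)
            exact ⟨q, hq, hxq, hlt, Or.inl (by omega), Or.inl (by omega)⟩
        · obtain ⟨q, hq, hxq, hlt, ha, hb⟩ := cov _ _ x hz (by omega) (by omega)
          exact ⟨q, hq, hxq, hlt, Or.inr (by omega), Or.inl (by omega)⟩
    · refine ⟨by omega, by omega, Or.inl ⟨?_, by omega⟩, fun x hx hxu => ?_⟩
      · have := evn _ _ hz1
        have := evn _ _ hz
        omega
      · rcases hx with hx | hx
        · obtain ⟨q, hq, hxq, hlt, ha, hb⟩ := cov _ _ x hz (by omega) (by omega)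
          exact ⟨q, hq, hxq, hlt, Or.inl (by omega), Or.inr (by omega)⟩
        · rcases lt_or_gt_of_ne hxu with h | h
          · obtain ⟨q, hq, hxq, hlt, ha, hb⟩ := cov _ _ x hz1 (by omega) (by omega)
            exact ⟨q, hq, hxq, hlt, Or.inr (by omega), Or.inr (by omega)⟩
          · obtain ⟨q, hq, hxq, hlt, ha, hb⟩ := cov _ _ x hz2 (by omega) (by omega)
            exact ⟨q, hq, hxq, hlt, Or.inr (by omega), Or.inl (by omega)⟩
  obtain ⟨u1, u2, u3, u4⟩ := hmain
  refine ⟨u1, u2, fun hus => ?_, u3, u4⟩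
  obtain ⟨q, hq, huq⟩ := mem_supp.1 hus
  have pq := mem_pairs.1 (hM.sub q hq)
  have hNq : N ∉ pairSet q := fun h => hNB (mem_supp.2 ⟨q, hq, h⟩)
  by_cases hlt : q.2 < q.1
  · have := iStar_one_le hM (mem_supp.2 ⟨q, mem_B0.2 ⟨hq, hlt⟩, huq⟩)
    omega
  · -- the endpoints of the innermost arc do not lie under `q`
    have hno : ∀ x ∈ supp (B0 B), ¬ (q.1 ≤ x ∧ x ≤ q.2) := by
      intro x hx hxq
      have hz := ZeroCovered.interval (mem_B1.2 ⟨hq, (by omega : q.1 < q.2)⟩)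
      obtain ⟨r, hr, hxr, -⟩ := ZeroCovered.exists_mem hS.1 hz (Finset.mem_Icc.2 hxq)
      obtain ⟨t, ht, hxt⟩ := mem_supp.1 hx
      have := hM.disj r (mem_B1.1 hr).1 t (mem_B0.1 ht).1 x hxr hxt
      subst this
      have a := (mem_B1.1 hr).2
      have b := (mem_B0.1 ht).2
      omega
    have n1 := hno _ (mem_supp.2 ⟨_, hin, fst_mem_pairSet _⟩)
    have n2 := hno _ (mem_supp.2 ⟨_, hin, snd_mem_pairSet _⟩)
    dsimp only at n1 n2
    rw [mem_pairSet] at huq hNq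
    have other : ∀ y ∈ pairSet q, y ≠ u →
        (1 ≤ y ∧ y < iStar B 1) ∨ (iLast B < y ∧ y < N) → False := by
      intro y hy hyu hr
      obtain ⟨r, hr, hyr, -, -, h⟩ := u4 y hr hyu
      have := hM.disj q hq r hr y hy hyr
      subst this
      omega
    rcases huq with h | h
    · exact other q.2 (snd_mem_pairSet q) (by omega) (by omega)
    · exact other q.1 (fst_mem_pairSet q) (by omega) (by omega)

/-- All other points of the range are matched in `B`, whereas `v` is free. -/
theorem IsU.unique (hM : IsMatching N B) (hS : IsStar B) (hs : (B0 B).card ≠ 0)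
    (hNB : N ∉ supp B) {u v : ℕ} (hu : IsU N B u) (hv : IsU N B v) : u = v := by
  obtain ⟨-, -, -, -, h1⟩ := hu.spec hM hS hs hNB
  obtain ⟨a, b, h2, h3, -⟩ := hv.spec hM hS hs hNB
  by_contra hne
  obtain ⟨q, hq, hv, -⟩ := h1 v (by omega) (Ne.symm hne)
  exact h2 (mem_supp.2 ⟨q, hq, hv⟩)

theorem uB_eq (hM : IsMatching N B) (hS : IsStar B) (hs : (B0 B).card ≠ 0)
    (hNB : N ∉ supp B) {u : ℕ} (hu : IsU N B u) : uB N B = u := by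
  have : (Finset.Icc 1 N).filter (IsU N B) = {u} := by
    ext v
    rw [Finset.mem_filter, Finset.mem_singleton, Finset.mem_Icc]
    constructor
    · exact fun h => h.2.unique hM hS hs hNB hu
    · rintro rfl
      have := hu.spec hM hS hs hNB
      exact ⟨by omega, hu⟩
  rw [uB, this, Finset.sup_singleton, id]

/-- The arc between `u` and `N`. -/
def arcToLast (N u : ℕ) : ℕ × ℕ := if u % 2 = 0 then (u, N) else (N, u)

/-- The correction term in ′ε is `[[ij]]` for the arc joining `u` and `N`, so ′ε is a plain sum once
this arc is added. -/
theorem eps_of_isU (hB : B ∈ XPlus N) (hM : IsMatching N B) (hS : IsStar B)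
    (hs : (B0 B).card ≠ 0) (hNB : N ∉ supp B) {u : ℕ} (hu : IsU N B u) :
    eps N B = fsum (insert (arcToLast N u) B) (dbl N) := by
  obtain ⟨u1, u2, u3, -, -⟩ := hu.spec hM hS hs hNB
  have hnot : arcToLast N u ∉ B := fun h => u3 (mem_supp.2 ⟨_, h, by
    unfold arcToLast; split_ifs <;> simp [pairSet]⟩)
  rw [fsum_insert hnot, eps, if_pos ⟨hB, hs⟩, uB_eq hM hS hs hNB hu, symmDiff_comm (dbl N _)]
  by_cases he : u % 2 = 0
  · rw [if_pos (Nat.even_iff.2 he), arcToLast, if_pos he, dbl, if_pos u2]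
  · rw [if_neg (by rwa [Nat.even_iff]), arcToLast, if_neg he, dbl, if_neg (by dsimp only; omega),
      symmDiff_assoc]
    congr 1
    dsimp only
    rw [Finset.Icc_self]
    refine Disjoint.symmDiff_eq_sup ?_
    rw [Finset.disjoint_singleton_left, Finset.mem_Icc]
    omega

theorem mem_XPlus : B ∈ XPlus N ↔ IsMatching N B ∧ IsStar B ∧ CondII N B := by
  rw [XPlus, Finset.mem_filter, starP, Finset.mem_filter, mem_P, and_assoc]

theorem mem_XMinus : B ∈ XMinus N ↔ IsMatching N B ∧ IsStar B ∧ CondIII N B := by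
  rw [XMinus, Finset.mem_filter, starP, Finset.mem_filter, mem_P, and_assoc]

/-- The arcs that contain `N`, for a matching that does not match `N` with an even point. -/
theorem filter_mem_dbl (hM : IsMatching N B) (h : ∀ p ∈ B, p.1 < p.2 → p.2 ≠ N) :
    B.filter (fun p => N ∈ dbl N p) = B0 B := by
  refine Finset.filter_congr fun p hp => ?_
  have h1 := mem_pairs.1 (hM.sub p hp)
  have h2 := h p hp
  rw [mem_dbl (hM.sub p hp)]
  omega

theorem filter_mem_dbl_of_even (hM : IsMatching N B) {i : ℕ} (h : (i, N) ∈ B) :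
    B.filter (fun p => N ∈ dbl N p) = insert (i, N) (B0 B) := by
  ext p
  rw [Finset.mem_filter, Finset.mem_insert, mem_B0]
  constructor
  · rintro ⟨hp, hx⟩
    have h1 := mem_pairs.1 (hM.sub p hp)
    rw [mem_dbl (hM.sub p hp)] at hx
    by_cases hlt : p.2 < p.1
    · exact Or.inr ⟨hp, hlt⟩
    · refine Or.inl (hM.disj p hp _ h N ?_ (snd_mem_pairSet _))
      rw [mem_pairSet]; omega
  · rintro (rfl | ⟨hp, hlt⟩)
    · exact ⟨h, snd_mem_dbl (hM.sub _ h)⟩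
    · refine ⟨hp, ?_⟩
      have h1 := mem_pairs.1 (hM.sub p hp)
      rw [mem_dbl (hM.sub p hp)]; omega

theorem last_mem_fsum_iff (hM : IsMatching N B) (h : ∀ p ∈ B, p.1 < p.2 → p.2 ≠ N) :
    N ∈ fsum B (dbl N) ↔ Odd (B0 B).card := by
  rw [mem_fsum, filter_mem_dbl hM h]

theorem last_mem_fsum_iff_of_even (hM : IsMatching N B) {i : ℕ} (h : (i, N) ∈ B) (hi : i < N) :
    N ∈ fsum B (dbl N) ↔ Even (B0 B).card := by
  rw [mem_fsum, filter_mem_dbl_of_even hM h, Finset.card_insert_of_notMem,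
    Nat.odd_add_one, Nat.not_odd_iff_even]
  rw [mem_B0]
  exact fun h => absurd h.2 (by dsimp only; omega)

/-- The congruence `i ≡ |B⁰|` says that `N` lies under an odd number of arcs: the arcs of `B⁰`, and
the arc at `N` if `i` is even. -/
theorem exists_arcSystem_of_mem_XMinus (hodd : Odd N) (hB : B ∈ XMinus N) :
    IsArcSystem N B ∧ N ∈ fsum B (dbl N) ∧ N ∈ supp B := by
  obtain ⟨hM, hS, hI, he, ho⟩ := mem_XMinus.1 hB
  rw [Nat.odd_iff] at hodd
  refine ⟨⟨hM, fun p hp x hx hxp => hS.nest hM subset_rfl (fun hs y hy => ?_) hp hx hxp⟩, ?_⟩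
  · have hin := hS.inner_mem hs
    rcases hI with h | ⟨z1, z2⟩
    · exact absurd h hs
    · rcases hy with hy | hy
      · obtain ⟨q, hq, hyq, hsub⟩ := ZeroCovered.exists_mem hS.1 z1 (x := y)
          (Finset.mem_Icc.2 (by omega))
        have hq' := mem_B1.1 hq
        have := Finset.mem_Icc.1 (hsub (Finset.mem_Icc.2 ⟨hq'.2.le, le_rfl⟩))
        exact ⟨q, hq'.1, hyq, dbl_subset_of_lt _ (hM.sub _ (B0_subset B hin)) (hM.sub q hq'.1)
          (mem_B0.1 hin).2 hq'.2 (Or.inl (by dsimp only; omega))⟩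
      · obtain ⟨q, hq, hyq, hsub⟩ := ZeroCovered.exists_mem hS.1 z2 (x := y)
          (Finset.mem_Icc.2 (by omega))
        have hq' := mem_B1.1 hq
        have := Finset.mem_Icc.1 (hsub (Finset.mem_Icc.2 ⟨le_rfl, hq'.2.le⟩))
        exact ⟨q, hq'.1, hyq, dbl_subset_of_lt _ (hM.sub _ (B0_subset B hin)) (hM.sub q hq'.1)
          (mem_B0.1 hin).2 hq'.2 (Or.inr (by dsimp only; omega))⟩
  · have spell : ∀ p ∈ B, ∀ i, pairSet p = {i, N} → (p = (i, N) ∨ p = (N, i)) := by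
      intro p hp i h
      have h1 : i ∈ pairSet p := by rw [h]; simp
      have h2 : N ∈ pairSet p := by rw [h]; simp
      have h3 : p.1 ∈ ({i, N} : Finset ℕ) := h ▸ fst_mem_pairSet p
      have h4 : p.2 ∈ ({i, N} : Finset ℕ) := h ▸ snd_mem_pairSet p
      rw [mem_pairSet] at h1 h2
      rw [Finset.mem_insert, Finset.mem_singleton] at h3 h4
      have h5 := mem_pairs.1 (hM.sub p hp)
      rw [Prod.ext_iff, Prod.ext_iff]
      dsimp only
      omega
    rcases Nat.even_or_odd (B0 B).card with hs | hs
    · obtain ⟨p, hp, i, hi, hi', heq⟩ := he hs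
      have h1 := mem_pairs.1 (hM.sub p hp)
      rw [Nat.even_iff] at hi'
      rw [Finset.mem_Icc] at hi
      rcases spell p hp i heq with rfl | rfl
      · have hlt : i < N := by dsimp only at h1; omega
        exact ⟨(last_mem_fsum_iff_of_even hM hp hlt).2 hs, mem_supp.2 ⟨_, hp, snd_mem_pairSet _⟩⟩
      · dsimp only at h1; omega
    · obtain ⟨p, hp, i, hi, hi', heq⟩ := ho hs
      have h1 := mem_pairs.1 (hM.sub p hp)
      rw [Nat.odd_iff] at hi'
      rw [Finset.mem_Icc] at hi
      rcases spell p hp i heq with rfl | rfl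
      · dsimp only at h1; omega
      · refine ⟨(last_mem_fsum_iff hM fun q hq hlt hqN => ?_).2 hs,
          mem_supp.2 ⟨_, hp, fst_mem_pairSet _⟩⟩
        have := hM.disj q hq _ hp N (by rw [← hqN]; exact snd_mem_pairSet q) (fst_mem_pairSet _)
        subst this
        dsimp only at hlt h1
        omega

theorem IsMatching.insert (hM : IsMatching N B) {p : ℕ × ℕ} (hp : p ∈ pairs N)
    (h : ∀ x ∈ pairSet p, x ∉ supp B) : IsMatching N (insert p B) := by
  refine ⟨fun q hq => ?_, fun q hq r hr x hx hx' => ?_⟩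
  · rcases Finset.mem_insert.1 hq with rfl | hq
    · exact hp
    · exact hM.sub q hq
  · rcases Finset.mem_insert.1 hq with hq' | hq' <;> rcases Finset.mem_insert.1 hr with hr' | hr'
    · exact hq'.trans hr'.symm
    · exact absurd (mem_supp.2 ⟨r, hr', hx'⟩) (h x (hq' ▸ hx))
    · exact absurd (mem_supp.2 ⟨q, hq', hx⟩) (h x (hr' ▸ hx'))
    · exact hM.disj q hq' r hr' x hx hx'

/-- If `B⁰` is nonempty, `C` is `B` with the arc joining `u_B` and `N` added. As `|B⁰|` is odd, `N`
then lies under an even number of arcs. -/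
theorem exists_arcSystem_of_mem_XPlus (hodd : Odd N) (hB : B ∈ XPlus N) :
    ∃ C, IsArcSystem N C ∧ fsum C (dbl N) = eps N B ∧ N ∉ eps N B ∧
      B = C.filter (fun p => N ∉ pairSet p) := by
  obtain ⟨hM, hS, hII⟩ := mem_XPlus.1 hB
  have hNB := hII.1
  have hfil : B.filter (fun p => N ∉ pairSet p) = B :=
    Finset.filter_true_of_mem fun p hp h => hNB (mem_supp.2 ⟨p, hp, h⟩)
  have hB1 : ∀ p ∈ B, p.1 < p.2 → p.2 ≠ N := fun p hp _ h =>
    hNB (mem_supp.2 ⟨p, hp, by rw [← h]; exact snd_mem_pairSet p⟩)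
  by_cases hs : (B0 B).card = 0
  · have heps : eps N B = fsum B (dbl N) := by
      rw [eps, if_neg fun h => h.2 hs]
    refine ⟨B, ⟨hM, fun p hp x hx hxp => hS.nest hM subset_rfl (fun h => absurd hs h) hp hx hxp⟩,
      heps.symm, ?_, hfil.symm⟩
    rw [heps, last_mem_fsum_iff hM hB1, hs]
    decide
  · obtain ⟨u, hu⟩ := hII.exists_isU hs
    obtain ⟨u1, u2, u3, u4, u5⟩ := hu.spec hM hS hs hNB
    have heps := eps_of_isU hB hM hS hs hNB hu
    have hsodd : Odd (B0 B).card := by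
      rcases hII.2 with h | h
      · exact absurd h hs
      · exact h.1
    rw [Nat.odd_iff] at hodd
    have hap : arcToLast N u ∈ pairs N := by
      unfold arcToLast
      split_ifs <;> rw [mem_pairs] <;> dsimp only <;> omega
    have hset : ∀ x, x ∈ pairSet (arcToLast N u) ↔ x = u ∨ x = N := by
      intro x
      unfold arcToLast
      split_ifs <;> rw [mem_pairSet]
      tauto
    have hdbl : ∀ x, x ∈ dbl N (arcToLast N u) ↔
        (u % 2 = 0 ∧ u ≤ x ∧ x ≤ N) ∨ (u % 2 = 1 ∧ (x = N ∨ (1 ≤ x ∧ x ≤ u))) := by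
      intro x
      rw [mem_dbl hap]
      unfold arcToLast
      split_ifs <;> dsimp only <;> omega
    have hMC : IsMatching N (insert (arcToLast N u) B) := by
      refine hM.insert hap fun x hx => ?_
      rcases (hset x).1 hx with rfl | rfl
      · exact u3
      · exact hNB
    have hin := hS.inner_mem hs
    have pin := hM.sub _ (B0_subset B hin)
    have pin' := mem_pairs.1 pin
    have hin2 := (mem_B0.1 hin).2
    dsimp only at pin' hin2
    have hnot : arcToLast N u ∉ B := fun h => u3 (mem_supp.2 ⟨_, h, (hset u).2 (Or.inl rfl)⟩)
    refine ⟨insert (arcToLast N u) B, ⟨hMC, fun p hp x hx hxp => ?_⟩, heps.symm, ?_, ?_⟩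
    · rcases Finset.mem_insert.1 hp with rfl | hp
      · rw [hset] at hxp
        rw [hdbl] at hx
        obtain ⟨q, hq, hxq, hlt, h1, h2⟩ := u5 x (by omega) (by omega)
        refine ⟨q, Finset.mem_insert_of_mem hq, hxq, fun y hy => ?_⟩
        have pq := mem_pairs.1 (hM.sub q hq)
        rw [mem_dbl (hM.sub q hq)] at hy
        rw [mem_pairSet] at hxq
        rw [hdbl]
        omega
      · refine hS.nest hM (Finset.subset_insert _ _) (fun _ y hy => ?_) hp hx hxp
        by_cases hy' : y = u ∨ y = N
        · refine ⟨_, Finset.mem_insert_self _ _, (hset y).2 hy', fun z hz => ?_⟩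
          rw [hdbl] at hz
          rw [mem_dbl pin]
          dsimp only
          omega
        · obtain ⟨q, hq, hyq, hlt, h1, h2⟩ := u5 y (by omega) (by omega)
          exact ⟨q, Finset.mem_insert_of_mem hq, hyq, dbl_subset_of_lt _ pin (hM.sub q hq)
            hin2 hlt (by dsimp only; omega)⟩
    · rw [heps, fsum_insert hnot, Finset.mem_symmDiff]
      have h1 : N ∈ dbl N (arcToLast N u) := by rw [hdbl]; omega
      have h2 := (last_mem_fsum_iff hM hB1).2 hsodd
      rintro (h | h)
      · exact h.2 h2
      · exact h.2 h1
    · rw [Finset.filter_insert, if_neg (not_not.2 ((hset N).2 (Or.inr rfl))), hfil]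

/-- `B` is a function of ′ε(B) and `C`, and `C` is determined by its sum; this yields injectivity of
′ε. -/
theorem exists_arcSystem_of_mem_X (hodd : Odd N) (hB : B ∈ X N) :
    ∃ C, IsArcSystem N C ∧ fsum C (dbl N) = eps N B ∧
      B = if N ∈ eps N B then C else C.filter fun p => N ∉ pairSet p := by
  rcases Finset.mem_union.1 hB with h | h
  · obtain ⟨C, h1, h2, h3, h4⟩ := exists_arcSystem_of_mem_XPlus hodd h
    exact ⟨C, h1, h2, by rwa [if_neg h3]⟩
  · obtain ⟨h1, h2, h3⟩ := exists_arcSystem_of_mem_XMinus hodd h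
    have heps : eps N B = fsum B (dbl N) := by
      rw [eps, if_neg fun h' => (mem_XPlus.1 h'.1).2.2.1 h3]
    exact ⟨B, h1, heps.symm, by rw [if_pos (by rwa [heps])]⟩

end

end Lusztig

/-! ### From arc systems to elements of `X N`; bijectivity of ′ε. -/

namespace Lusztig

namespace IsArcSystem

variable {N : ℕ} {C B : Finset (ℕ × ℕ)}

theorem inner_one (hodd : Odd N) (hC : IsArcSystem N C) {p : ℕ × ℕ} (hp : p ∈ C)
    (hlt : p.1 < p.2) {x : ℕ} (h1 : p.1 < x) (h2 : x < p.2) :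
    ∃ r ∈ C, x ∈ pairSet r ∧ r.1 < r.2 ∧ p.1 < r.1 ∧ r.2 < p.2 := by
  have pp := hC.matching.sub p hp
  have hx : x ∉ pairSet p := by rw [mem_pairSet]; omega
  obtain ⟨r, hr, hxr, hsub⟩ := hC.nest p hp x (by rw [mem_dbl pp]; omega) hx
  have pr := hC.matching.sub r hr
  have e1 := hsub (fst_mem_dbl pr)
  have e2 := hsub (snd_mem_dbl pr)
  have hne : p ≠ r := by rintro rfl; exact hx hxr
  have d1 : r.1 ∉ pairSet p := fun h => hne (hC.matching.disj p hp r hr _ h (fst_mem_pairSet r))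
  have d2 : r.2 ∉ pairSet p := fun h => hne (hC.matching.disj p hp r hr _ h (snd_mem_pairSet r))
  rw [mem_pairSet] at d1 d2
  rw [mem_dbl pp] at e1 e2
  refine ⟨r, hr, hxr, ?_, by omega, by omega⟩
  by_contra hcon
  -- A wrapping arc contains `1` and `N`, so `p` would be `(1, N)`, whose difference is even.
  have e3 : N ∈ dbl N p := hsub (by rw [mem_dbl pr]; rw [mem_pairs] at pr; omega)
  have e4 : 1 ∈ dbl N p := hsub (by rw [mem_dbl pr]; rw [mem_pairs] at pr; omega)
  rw [mem_dbl pp] at e3 e4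
  rw [mem_pairs] at pp
  rw [Nat.odd_iff] at hodd
  omega

/-- A subarc of a wrapping arc must avoid its gap, in particular the points `p.2 + 1` and `p.1 - 1`
bordering it. -/
theorem gap_subset {p r : ℕ × ℕ} (pp : p ∈ pairs N) (pr : r ∈ pairs N) (h : p.2 < p.1)
    (hsub : dbl N r ⊆ dbl N p) :
    (r.1 < r.2 ∧ (r.2 ≤ p.2 ∨ p.1 ≤ r.1)) ∨ (r.2 < r.1 ∧ r.2 ≤ p.2 ∧ p.1 ≤ r.1) := by
  have e1 := hsub (fst_mem_dbl pr)
  have e2 := hsub (snd_mem_dbl pr)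
  have e3 : p.2 + 1 ∉ dbl N p := by rw [mem_dbl pp]; rw [mem_pairs] at pp; omega
  have e4 : p.2 + 1 ∉ dbl N r := fun h' => e3 (hsub h')
  have e5 : p.1 - 1 ∉ dbl N p := by rw [mem_dbl pp]; rw [mem_pairs] at pp; omega
  have e6 : p.1 - 1 ∉ dbl N r := fun h' => e5 (hsub h')
  rw [mem_dbl pp] at e1 e2
  rw [mem_dbl pr] at e4 e6
  rw [mem_pairs] at pp pr
  omega

theorem inner_zero (hC : IsArcSystem N C) {p : ℕ × ℕ} (hp : p ∈ C)
    (hlt : p.2 < p.1) {x : ℕ} (hx : (1 ≤ x ∧ x < p.2) ∨ (p.1 < x ∧ x ≤ N)) :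
    ∃ r ∈ C, x ∈ pairSet r ∧ ((r.1 < r.2 ∧ (r.2 < p.2 ∨ p.1 < r.1)) ∨
      (r.2 < r.1 ∧ r.2 < p.2 ∧ p.1 < r.1)) := by
  have pp := hC.matching.sub p hp
  have hxp : x ∉ pairSet p := by rw [mem_pairSet]; omega
  obtain ⟨r, hr, hxr, hsub⟩ := hC.nest p hp x (by rw [mem_dbl pp]; omega) hxp
  have pr := hC.matching.sub r hr
  have hne : p ≠ r := by rintro rfl; exact hxp hxr
  have d1 : r.1 ∉ pairSet p := fun h => hne (hC.matching.disj p hp r hr _ h (fst_mem_pairSet r))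
  have d2 : r.2 ∉ pairSet p := fun h => hne (hC.matching.disj p hp r hr _ h (snd_mem_pairSet r))
  rw [mem_pairSet] at d1 d2
  have := gap_subset pp pr hlt hsub
  exact ⟨r, hr, hxr, by omega⟩

theorem nested (hC : IsArcSystem N C) {p q : ℕ × ℕ} (hp : p ∈ C) (hq : q ∈ C)
    (h1 : p.2 < p.1) (h2 : q.2 < q.1) (hne : p ≠ q) :
    (p.2 < q.2 ∧ q.1 < p.1) ∨ (q.2 < p.2 ∧ p.1 < q.1) := by
  have pp := hC.matching.sub p hp
  have pq := hC.matching.sub q hq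
  have d1 : p.1 ∉ pairSet q := fun h => hne (hC.matching.disj p hp q hq _ (fst_mem_pairSet p) h)
  have d2 : p.2 ∉ pairSet q := fun h => hne (hC.matching.disj p hp q hq _ (snd_mem_pairSet p) h)
  rw [mem_pairSet] at d1 d2
  rcases (by omega : p.2 < q.2 ∨ q.2 < p.2) with h | h
  · have := gap_subset pq pp h2 (hC.dbl_subset hq hp (snd_mem_pairSet p) (by
      rw [mem_dbl pq]; rw [mem_pairs] at pp; omega))
    omega
  · have := gap_subset pp pq h1 (hC.dbl_subset hp hq (snd_mem_pairSet q) (by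
      rw [mem_dbl pp]; rw [mem_pairs] at pq; omega))
    omega

/-- Points under a nonwrapping arc are matched by nonwrapping arcs. -/
theorem not_under (hodd : Odd N) (hC : IsArcSystem N C) {p q : ℕ × ℕ} (hp : p ∈ C) (hq : q ∈ C)
    (h1 : p.2 < p.1) (h2 : q.1 < q.2) {x : ℕ} (hx : x ∈ pairSet p) (hxq : q.1 ≤ x) :
    q.2 < x := by
  by_contra! hcon
  have hxn : x ∉ pairSet q := fun h => by
    rw [hC.matching.disj p hp q hq x hx h] at h1
    omega
  rw [mem_pairSet] at hxn
  obtain ⟨r, hr, hxr, hlt, -⟩ := hC.inner_one hodd hq h2 (x := x) (by omega) (by omega)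
  rw [hC.matching.disj r hr p hp x hxr hx] at hlt
  omega

theorem covers_inner (hodd : Odd N) (hC : IsArcSystem N C)
    (hB : ∀ p ∈ C, N ∉ pairSet p → p ∈ B) {p : ℕ × ℕ} (hp : p ∈ C) (hlt : p.1 < p.2) :
    Covers B (p.1 + 1) (p.2 - 1) := by
  intro x hx hx'
  obtain ⟨r, hr, hxr, h1, h2, h3⟩ := hC.inner_one hodd hp hlt (x := x) (by omega) (by omega)
  have := mem_pairs.1 (hC.matching.sub p hp)
  exact ⟨r, hB r hr (by rw [mem_pairSet]; omega), hxr, h1, by omega, by omega⟩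

/-- `B` may be all of `C` or lack the arc at `N`, which serves both signs. -/
theorem isStar (hodd : Odd N) (hC : IsArcSystem N C) (hBC : B ⊆ C)
    (hB : ∀ p ∈ C, N ∉ pairSet p → p ∈ B) : IsStar B := by
  refine isStar_of_nested (hC.matching.mono hBC) (fun p hp => hC.covers_inner hodd hB (hBC hp))
    ?_ ?_ ?_
  · intro p hp q hq hne
    rw [mem_B0] at hp hq
    exact hC.nested (hBC hp.1) (hBC hq.1) hp.2 hq.2 hne
  · intro p hp q hq x h1 h2
    rw [mem_B0] at hp hq
    have pp := mem_pairs.1 (hC.matching.sub p (hBC hp.1))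
    have pq := mem_pairs.1 (hC.matching.sub q (hBC hq.1))
    obtain ⟨r, hr, hxr, h⟩ := hC.inner_zero (hBC hp.1) hp.2 (x := x) (by omega)
    have hxr' := mem_pairSet.1 hxr
    have pr := mem_pairs.1 (hC.matching.sub r hr)
    have hne : q ≠ r := by rintro rfl; omega
    rcases h with h | h
    · have := hC.not_under hodd (hBC hq.1) hr hq.2 h.1 (snd_mem_pairSet q)
      exact ⟨r, hB r hr (by rw [mem_pairSet]; omega), hxr, Or.inr (by omega)⟩
    · have := hC.nested (hBC hq.1) hr hq.2 h.1 hne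
      exact ⟨r, hB r hr (by rw [mem_pairSet]; omega), hxr, Or.inl h.1⟩
  · intro p hp q hq x h1 h2
    rw [mem_B0] at hp hq
    have pp := mem_pairs.1 (hC.matching.sub p (hBC hp.1))
    have pq := mem_pairs.1 (hC.matching.sub q (hBC hq.1))
    obtain ⟨r, hr, hxr, h⟩ := hC.inner_zero (hBC hp.1) hp.2 (x := x) (by omega)
    have hxr' := mem_pairSet.1 hxr
    have pr := mem_pairs.1 (hC.matching.sub r hr)
    rcases h with h | h
    · have := hC.not_under hodd (hBC hq.1) hr hq.2 h.1 (fst_mem_pairSet q)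
      exact ⟨r, hB r hr (by rw [mem_pairSet]; omega), hxr, Or.inr (by omega)⟩
    · exact ⟨r, hB r hr (by rw [mem_pairSet]; omega), hxr, Or.inl h.1⟩

/-- The points outside the innermost arc of `B⁰` are matched by arcs of the other kind. -/
theorem exists_outer (hC : IsArcSystem N C) (hBC : B ⊆ C)
    (hB : ∀ p ∈ C, N ∉ pairSet p → p ∈ B) (hS : IsStar B) (hs : (B0 B).card ≠ 0) {x : ℕ}
    (hx : (1 ≤ x ∧ x < iStar B 1) ∨ (iLast B < x ∧ x ≤ N)) :
    (∃ r ∈ C, x ∈ pairSet r ∧ r.1 < r.2 ∧ (r.2 < iStar B 1 ∨ iLast B < r.1)) ∨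
      ∃ r ∈ C, x ∈ pairSet r ∧ N ∈ pairSet r ∧ r.2 < r.1 := by
  have hin := mem_B0.1 (hS.inner_mem hs)
  obtain ⟨r, hr, hxr, h⟩ := hC.inner_zero (hBC hin.1) hin.2 hx
  dsimp only at h
  rcases h with h | h
  · exact Or.inl ⟨r, hr, hxr, h⟩
  · refine Or.inr ⟨r, hr, hxr, ?_, h.1⟩
    by_contra hcon
    have := iStar_one_le (hC.matching.mono hBC)
      (mem_supp.2 ⟨r, mem_B0.2 ⟨hB r hr hcon, h.1⟩, hxr⟩)
    omega

theorem condI (hodd : Odd N) (hC : IsArcSystem N C) (hS : IsStar C) : CondI N C := by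
  by_cases hs : (B0 C).card = 0
  · exact Or.inl hs
  have hcov := fun p hp => hC.covers_inner hodd (B := C) (fun p hp _ => hp) (p := p) hp
  have hout : ∀ x, (1 ≤ x ∧ x < iStar C 1) ∨ (iLast C < x ∧ x ≤ N) →
      ∃ r ∈ C, x ∈ pairSet r ∧ r.1 < r.2 ∧ (r.2 < iStar C 1 ∨ iLast C < r.1) := by
    intro x hx
    rcases hC.exists_outer subset_rfl (fun p hp _ => hp) hS hs hx with h | ⟨r, hr, hxr, -, hlt⟩
    · exact h
    · have := iStar_one_le hC.matching (mem_supp.2 ⟨r, mem_B0.2 ⟨hr, hlt⟩, hxr⟩)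
      omega
  have hin := (mem_B0.1 (hS.inner_mem hs)).2
  dsimp only at hin
  refine Or.inr ⟨Covers.zeroCovered hC.matching hcov fun x h1 h2 => ?_,
    Covers.zeroCovered hC.matching hcov fun x h1 h2 => ?_⟩
  · obtain ⟨r, hr, hxr, hlt, h⟩ := hout x (by omega)
    have pr := mem_pairs.1 (hC.matching.sub r hr)
    have hxr' := mem_pairSet.1 hxr
    exact ⟨r, hr, hxr, hlt, by omega, by omega⟩
  · obtain ⟨r, hr, hxr, hlt, h⟩ := hout x (by omega)
    have pr := mem_pairs.1 (hC.matching.sub r hr)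
    have hxr' := mem_pairSet.1 hxr
    exact ⟨r, hr, hxr, hlt, by omega, by omega⟩

/-- Every wrapping arc contains `N`; if `N` is free there is none, and `B⁰` is empty. -/
theorem mem_XPlus_of_notMem_supp (hodd : Odd N) (hC : IsArcSystem N C) (hN : N ∉ supp C) :
    C ∈ XPlus N ∧ eps N C = fsum C (dbl N) := by
  have h0 : (B0 C).card = 0 := by
    rw [Finset.card_eq_zero, Finset.eq_empty_iff_forall_notMem]
    intro p hp
    rw [mem_B0] at hp
    have pp := hC.matching.sub p hp.1
    exact hN (hC.filled.2 p hp.1 N (by rw [mem_dbl pp]; rw [mem_pairs] at pp; omega))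
  refine ⟨mem_XPlus.2 ⟨hC.matching, hC.isStar hodd subset_rfl fun p hp _ => hp, hN, Or.inl h0⟩, ?_⟩
  rw [eps, if_neg fun h => h.2 h0]

/-- Since `N` is odd, the arc at `N` is `(u, N)` for even `u` and wraps as `(N, u)` for odd `u`. So
`N` lies under `|B⁰| + 1` arcs in the first case and `|B⁰|` in the second. -/
theorem exists_arcToLast (hodd : Odd N) (hC : IsArcSystem N C) (hN : N ∈ supp C) :
    ∃ u, 1 ≤ u ∧ u < N ∧ arcToLast N u ∈ C ∧
      (N ∈ fsum C (dbl N) ↔ (u + (B0 C).card) % 2 = 0) := by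
  obtain ⟨p, hp, hNp⟩ := mem_supp.1 hN
  have pp := mem_pairs.1 (hC.matching.sub p hp)
  rw [Nat.odd_iff] at hodd
  rcases mem_pairSet.1 hNp with h | h
  · have he : p.2 % 2 = 1 := by omega
    have ha : arcToLast N p.2 = p := by
      rw [arcToLast, if_neg (by omega)]; exact Prod.ext h rfl
    refine ⟨p.2, by omega, by omega, by rw [ha]; exact hp, ?_⟩
    rw [last_mem_fsum_iff hC.matching, Nat.odd_iff]
    · omega
    · intro q hq hlt hqN
      rw [hC.matching.disj q hq p hp N (by rw [mem_pairSet]; omega) hNp] at hlt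
      omega
  · have he : p.1 % 2 = 0 := by omega
    have ha : arcToLast N p.1 = p := by
      rw [arcToLast, if_pos (by omega)]; exact Prod.ext rfl h
    refine ⟨p.1, by omega, by omega, by rw [ha]; exact hp, ?_⟩
    have ha' : p = (p.1, N) := Prod.ext rfl h.symm
    rw [last_mem_fsum_iff_of_even hC.matching (ha' ▸ hp) (by omega), Nat.even_iff]
    omega

theorem mem_pairSet_arcToLast {u x : ℕ} : x ∈ pairSet (arcToLast N u) ↔ x = u ∨ x = N := by
  unfold arcToLast
  split_ifs <;> rw [mem_pairSet]
  exact Or.comm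

theorem mem_XMinus_of_last_mem (hodd : Odd N) (hC : IsArcSystem N C)
    (hN : N ∈ fsum C (dbl N)) : C ∈ XMinus N ∧ eps N C = fsum C (dbl N) := by
  have hNs : N ∈ supp C := by
    obtain ⟨q, hq⟩ := Finset.card_pos.1 ((mem_fsum _ _ _).1 hN).pos
    rw [Finset.mem_filter] at hq
    exact hC.filled.2 q hq.1 N hq.2
  obtain ⟨u, u1, u2, hu, hiff⟩ := hC.exists_arcToLast hodd hNs
  have hpar := hiff.1 hN
  have hS := hC.isStar hodd subset_rfl fun p hp _ => hp
  have hset : pairSet (arcToLast N u) = {u, N} := by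
    ext x; rw [mem_pairSet_arcToLast, Finset.mem_insert, Finset.mem_singleton]
  refine ⟨mem_XMinus.2 ⟨hC.matching, hS, hC.condI hodd hS, fun h => ?_, fun h => ?_⟩, ?_⟩
  · rw [Nat.even_iff] at h
    exact ⟨_, hu, u, Finset.mem_Icc.2 ⟨u1, u2.le⟩, Nat.even_iff.2 (by omega), hset⟩
  · rw [Nat.odd_iff] at h
    exact ⟨_, hu, u, Finset.mem_Icc.2 ⟨u1, u2.le⟩, Nat.odd_iff.2 (by omega), hset⟩
  · rw [eps, if_neg fun h' => (mem_XPlus.1 h'.1).2.2.1 hNs]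

theorem _root_.Lusztig.OneCovered.of_split {C : Finset (ℕ × ℕ)} {a b u : ℕ} (ha : a ≤ u)
    (hb : u ≤ b) (hu : 1 ≤ u) (h1 : ZeroCovered C (Finset.Icc a (u - 1)))
    (h2 : ZeroCovered C (Finset.Icc (u + 1) b)) : OneCovered C (Finset.Icc a b) := by
  refine ⟨u, Finset.mem_Icc.2 ⟨ha, hb⟩, ?_⟩
  have := h1.union h2 (by
    rw [Finset.disjoint_left]; intro x hx hx'; rw [Finset.mem_Icc] at hx hx'; omega)
  convert this using 1
  ext x
  rw [Finset.mem_erase, Finset.mem_union, Finset.mem_Icc, Finset.mem_Icc, Finset.mem_Icc]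
  omega

/-- Delete the arc at `N`; its other endpoint `u` becomes the point left free in (II), in case (ii)
for even `u` and in case (i) for odd `u`. -/
theorem exists_mem_XPlus (hodd : Odd N) (hC : IsArcSystem N C) (hNs : N ∈ supp C)
    (hN : N ∉ fsum C (dbl N)) : ∃ B ∈ XPlus N, eps N B = fsum C (dbl N) := by
  obtain ⟨u, u1, u2, hu, hiff⟩ := hC.exists_arcToLast hodd hNs
  have hM := hC.matching
  have hpar : (u + (B0 C).card) % 2 = 1 := by
    have := mt hiff.2 hN; omega
  set B := C.erase (arcToLast N u) with hBdef
  have hBC : B ⊆ C := Finset.erase_subset _ _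
  have huniq : ∀ p ∈ C, N ∈ pairSet p → p = arcToLast N u := fun p hp h =>
    hM.disj p hp _ hu N h (mem_pairSet_arcToLast.2 (Or.inr rfl))
  have hB : ∀ p ∈ C, N ∉ pairSet p → p ∈ B := fun p hp h => by
    refine Finset.mem_erase.2 ⟨?_, hp⟩
    rintro rfl
    exact h (mem_pairSet_arcToLast.2 (Or.inr rfl))
  have hB' : ∀ p ∈ C, u ∉ pairSet p → p ∈ B := fun p hp h => by
    refine Finset.mem_erase.2 ⟨?_, hp⟩
    rintro rfl
    exact h (mem_pairSet_arcToLast.2 (Or.inl rfl))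
  have hnotin : ∀ p ∈ B, ∀ x ∈ pairSet p, x ≠ u ∧ x ≠ N := by
    intro p hp x hx
    have h := Finset.mem_erase.1 hp
    have : ¬ (x = u ∨ x = N) := fun h' => h.1 (hM.disj p h.2 _ hu x hx (mem_pairSet_arcToLast.2 h'))
    omega
  have hins : insert (arcToLast N u) B = C := Finset.insert_erase hu
  have hMB := hM.mono hBC
  have hS := hC.isStar hodd hBC hB
  have hNB : N ∉ supp B := fun h => by
    obtain ⟨p, hp, hx⟩ := mem_supp.1 h
    exact (hnotin p hp N hx).2 rfl
  -- Deleting the arc removes an element of `B⁰` exactly when `u` is odd, so in both cases the count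
  -- becomes odd.
  have hcard : (B0 B).card % 2 = 1 := by
    by_cases he : u % 2 = 0
    · have : B0 B = B0 C := by
        rw [← hins, B0, B0, Finset.filter_insert, if_neg]
        rw [arcToLast, if_pos he]; dsimp only; omega
      rw [this]; omega
    · have : (B0 C).card = (B0 B).card + 1 := by
        rw [← hins, B0, B0, Finset.filter_insert, if_pos, Finset.card_insert_of_notMem]
        · exact fun h => Finset.notMem_erase _ _ (Finset.mem_filter.1 h).1
        · rw [arcToLast, if_neg he]; exact u2
      omega
  have hs : (B0 B).card ≠ 0 := by omega
  have hin := mem_B0.1 (hS.inner_mem hs)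
  have hinC := hBC hin.1
  have pin := mem_pairs.1 (hMB.sub _ hin.1)
  have hin2 := hin.2
  have hinu := hnotin _ hin.1
  have hi1 := hinu _ (snd_mem_pairSet _)
  have hi2 := hinu _ (fst_mem_pairSet _)
  dsimp only at pin hin2 hi1 hi2
  have hcov := fun p hp => hC.covers_inner hodd hB (p := p) (hBC hp)
  have zc : ∀ {a b}, Covers B a b → ZeroCovered (B1 B) (Finset.Icc a b) :=
    fun h => h.zeroCovered hMB hcov
  have hout : ∀ x, (1 ≤ x ∧ x < iStar B 1) ∨ (iLast B < x ∧ x < N) → x ≠ u →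
      ∃ r ∈ B, x ∈ pairSet r ∧ r.1 < r.2 ∧ 1 ≤ r.1 ∧ r.2 < N ∧
        (r.2 < iStar B 1 ∨ iLast B < r.1) := by
    intro x hx hxu
    rcases hC.exists_outer hBC hB hS hs (x := x) (by omega) with
      ⟨r, hr, hxr, hlt, h⟩ | ⟨r, hr, hxr, hNr, -⟩
    · have hrB : r ∈ B := by
        refine Finset.mem_erase.2 ⟨?_, hr⟩
        rintro rfl
        rw [mem_pairSet_arcToLast] at hxr
        omega
      have pr := mem_pairs.1 (hM.sub r hr)
      have := hnotin r hrB r.2 (snd_mem_pairSet r)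
      exact ⟨r, hrB, hxr, hlt, by omega, by omega, h⟩
    · rw [huniq r hr hNr, mem_pairSet_arcToLast] at hxr
      omega
  suffices hU : IsU N B u ∧ (CondIIi N B ∨ CondIIii N B) by
    have hX : B ∈ XPlus N :=
      mem_XPlus.2 ⟨hMB, hS, hNB, Or.inr ⟨Nat.odd_iff.2 hcard, hU.2⟩⟩
    exact ⟨B, hX, by rw [eps_of_isU hX hMB hS hs hNB hU.1, hins]⟩
  by_cases he : u % 2 = 0
  · have ha : arcToLast N u = (u, N) := by rw [arcToLast, if_pos he]
    rw [ha] at hu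
    -- The arc `(u, N)` does not pass over `i_{2s}`, so `u` lies beyond it.
    have n1 := hC.not_under hodd hinC hu hin2 u2 (fst_mem_pairSet _)
    dsimp only at n1
    -- no arc of `B¹` passes over `u`
    have hav : ∀ r ∈ B, r.1 < r.2 → ¬ (r.1 ≤ u ∧ u ≤ r.2) := by
      intro r hr hlt h
      have a := hnotin r hr _ (fst_mem_pairSet r)
      have b := hnotin r hr _ (snd_mem_pairSet r)
      obtain ⟨t, ht, hut, -, -, h3⟩ := hC.inner_one hodd (hBC hr) hlt (x := u)
        (by omega) (by omega)
      rw [hM.disj t ht _ hu u hut (fst_mem_pairSet _)] at h3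
      have := mem_pairs.1 (hM.sub r (hBC hr))
      dsimp only at h3
      omega
    have z0 : ZeroCovered (B1 B) (Finset.Icc 1 (iStar B 1 - 1)) := zc fun x h1 h2 => by
      obtain ⟨r, hr, hxr, hlt, h3, h4, h5⟩ := hout x (by omega) (by omega)
      have := mem_pairSet.1 hxr
      exact ⟨r, hr, hxr, hlt, h3, by omega⟩
    have z1 : ZeroCovered (B1 B) (Finset.Icc (iLast B + 1) (u - 1)) := zc fun x h1 h2 => by
      obtain ⟨r, hr, hxr, hlt, h3, h4, h5⟩ := hout x (by omega) (by omega)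
      have := mem_pairSet.1 hxr
      have := hav r hr hlt
      exact ⟨r, hr, hxr, hlt, by omega, by omega⟩
    have z2 : ZeroCovered (B1 B) (Finset.Icc (u + 1) (N - 1)) := zc fun x h1 h2 => by
      obtain ⟨r, hr, hxr, hlt, h3, h4, h5⟩ := hout x (by omega) (by omega)
      have := mem_pairSet.1 hxr
      have := hav r hr hlt
      exact ⟨r, hr, hxr, hlt, by omega, by omega⟩
    have hii : CondIIii N B := ⟨z0, OneCovered.of_split (by omega) (by omega) u1 z1 z2⟩
    exact ⟨Or.inr ⟨hii, Finset.mem_Icc.2 (by omega), z1, z2⟩, Or.inr hii⟩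
  · have ha : arcToLast N u = (N, u) := by rw [arcToLast, if_neg he]
    rw [ha] at hu
    -- The arc `(N, u)` is nested inside the innermost arc of `B⁰`, so `u` lies before `i_1`.
    have n1 := hC.nested hinC hu hin2 u2 (by
      intro h; rw [Prod.mk.injEq] at h; omega)
    dsimp only at n1
    have hav : ∀ r ∈ B, r.1 < r.2 → ¬ (r.1 ≤ u ∧ u ≤ r.2) := by
      intro r hr hlt h
      have := hC.not_under hodd hu (hBC hr) u2 hlt (snd_mem_pairSet _) h.1
      dsimp only at this
      omega
    have z0 : ZeroCovered (B1 B) (Finset.Icc (iLast B + 1) (N - 1)) := zc fun x h1 h2 => by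
      obtain ⟨r, hr, hxr, hlt, h3, h4, h5⟩ := hout x (by omega) (by omega)
      have := mem_pairSet.1 hxr
      exact ⟨r, hr, hxr, hlt, by omega, by omega⟩
    have z1 : ZeroCovered (B1 B) (Finset.Icc 1 (u - 1)) := zc fun x h1 h2 => by
      obtain ⟨r, hr, hxr, hlt, h3, h4, h5⟩ := hout x (by omega) (by omega)
      have := mem_pairSet.1 hxr
      have := hav r hr hlt
      exact ⟨r, hr, hxr, hlt, by omega, by omega⟩
    have z2 : ZeroCovered (B1 B) (Finset.Icc (u + 1) (iStar B 1 - 1)) := zc fun x h1 h2 => by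
      obtain ⟨r, hr, hxr, hlt, h3, h4, h5⟩ := hout x (by omega) (by omega)
      have := mem_pairSet.1 hxr
      have := hav r hr hlt
      exact ⟨r, hr, hxr, hlt, by omega, by omega⟩
    have hi : CondIIi N B := ⟨OneCovered.of_split (by omega) (by omega) u1 z1 z2, z0⟩
    exact ⟨Or.inl ⟨hi, Finset.mem_Icc.2 (by omega), z1, z2⟩, Or.inl hi⟩

theorem exists_mem_X (hodd : Odd N) (hC : IsArcSystem N C) :
    ∃ B ∈ X N, eps N B = fsum C (dbl N) := by
  by_cases hs : N ∈ supp C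
  · by_cases hN : N ∈ fsum C (dbl N)
    · have := hC.mem_XMinus_of_last_mem hodd hN
      exact ⟨C, Finset.mem_union_right _ this.1, this.2⟩
    · obtain ⟨B, hB, h⟩ := hC.exists_mem_XPlus hodd hs hN
      exact ⟨B, Finset.mem_union_left _ hB, h⟩
  · have := hC.mem_XPlus_of_notMem_supp hodd hs
    exact ⟨C, Finset.mem_union_left _ this.1, this.2⟩

end IsArcSystem

theorem bijOn_eps {N : ℕ} (hodd : Odd N) :
    Set.BijOn (eps N) (X N : Set (Finset (ℕ × ℕ))) (E N : Set (Finset ℕ)) := by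
  refine ⟨fun B hB => ?_, fun B hB B' hB' heq => ?_, fun Z hZ => ?_⟩
  · obtain ⟨C, hC, h, -⟩ := exists_arcSystem_of_mem_X hodd hB
    rw [← h]
    exact hC.matching.fsum_dbl_mem_E hodd
  · obtain ⟨C, hC, h, e⟩ := exists_arcSystem_of_mem_X hodd hB
    obtain ⟨C', hC', h', e'⟩ := exists_arcSystem_of_mem_X hodd hB'
    rw [e, e', heq, hC.eq_of_fsum_dbl_eq hodd hC' (by rw [h, h', heq])]
  · obtain ⟨C, hC, h⟩ := exists_arcSystem hodd hZ
    obtain ⟨B, hB, h'⟩ := hC.exists_mem_X hodd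
    exact ⟨B, hB, h'.trans h⟩

end Lusztig

/-! ### Domination, orbits of the involution, and the order on orbits. -/

namespace Lusztig

variable {N : ℕ}

/-! ### The order on `X_{N-2}` and `E_N` -/

theorem span_mono {B C : Finset (ℕ × ℕ)} (h : B ⊆ C) : span B ⊆ span C :=
  Finset.image_subset_image (Finset.powerset_mono.2 h)

theorem exists_arcSystem_of_mem_X' (hodd : Odd N) {B : Finset (ℕ × ℕ)} (hB : B ∈ X N) :
    ∃ C, IsArcSystem N C ∧ fsum C (dbl N) = eps N B ∧ B ⊆ C ∧ eps N B ∈ span B := by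
  obtain ⟨C, hC, h, e⟩ := exists_arcSystem_of_mem_X hodd hB
  have hBC : B ⊆ C := by
    rw [e]; split_ifs
    · exact subset_rfl
    · exact Finset.filter_subset _ _
  refine ⟨C, hC, h, hBC, ?_⟩
  rw [← h]
  refine hC.fsum_dbl_mem_span fun p hp hp1 => ?_
  rw [e]
  split_ifs with hN
  · exact hp
  -- If `N` is not in the sum, the arc at `N` is not among the pairs making up the sum, so its
  -- deletion does no harm.
  · refine Finset.mem_filter.2 ⟨hp, fun hNp => hN ?_⟩
    have : ∀ x ∈ pairSet p, x ∈ fsum C (dbl N) := fun x hx => by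
      rcases mem_pairSet.1 hx with rfl | rfl
      · exact hp1
      · exact (hC.fst_mem_iff_snd_mem hp).1 hp1
    exact h ▸ this N hNp

theorem epsInv_mem (hodd : Odd N) {Z : Finset ℕ} (hZ : Z ∈ E N) : epsInv N Z ∈ X N :=
  Function.invFunOn_mem ((bijOn_eps hodd).surjOn hZ)

theorem eps_epsInv (hodd : Odd N) {Z : Finset ℕ} (hZ : Z ∈ E N) : eps N (epsInv N Z) = Z :=
  Function.invFunOn_eq ((bijOn_eps hodd).surjOn hZ)

theorem self_mem_span (hodd : Odd N) {Z : Finset ℕ} (hZ : Z ∈ E N) : Z ∈ span (epsInv N Z) := by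
  obtain ⟨C, -, -, -, h⟩ := exists_arcSystem_of_mem_X' hodd (epsInv_mem hodd hZ)
  rwa [eps_epsInv hodd hZ] at h

theorem fold_le_eps (hodd : Odd N) {B : Finset (ℕ × ℕ)} (hB : B ∈ X N) {Z : Finset ℕ}
    (hZ : Z ∈ span B) (h : ℕ) (hh : h ≤ N) : fold h Z ≤ fold h (eps N B) := by
  obtain ⟨C, hC, he, hBC, -⟩ := exists_arcSystem_of_mem_X' hodd hB
  rw [← he]
  exact hC.filled.fold_le_of_mem_span hodd (span_mono hBC hZ) h hh

theorem fold_le_of_mem_span_epsInv (hodd : Odd N) {Z Z' : Finset ℕ} (hZ : Z ∈ E N)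
    (h' : Z' ∈ span (epsInv N Z)) (h : ℕ) (hh : h ≤ N) : fold h Z' ≤ fold h Z := by
  have := fold_le_eps hodd (epsInv_mem hodd hZ) h' h hh
  rwa [eps_epsInv hodd hZ] at this

theorem Prec.fold_le (hodd : Odd N) {Z Z' : Finset ℕ} (hZ : Z ∈ E N) (hZ' : Z' ∈ E N)
    (h : Prec N Z' Z) (k : ℕ) (hk : k ≤ N) : fold k Z' ≤ fold k Z := by
  have key : ∀ B' B, PrecB N B' B → fold k (eps N B') ≤ fold k (eps N B) := by
    intro B' B hB
    induction hB with
    | refl => exact le_rfl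
    | tail _ h ih => exact ih.trans (fold_le_eps hodd h.2.1 h.2.2 k hk)
  have := key _ _ h
  rwa [eps_epsInv hodd hZ, eps_epsInv hodd hZ'] at this

theorem Prec.of_mem_span (hodd : Odd N) {Z Z' : Finset ℕ} (hZ : Z ∈ E N) (hZ' : Z' ∈ E N)
    (h : Z' ∈ span (epsInv N Z)) : Prec N Z' Z :=
  Relation.ReflTransGen.single ⟨epsInv_mem hodd hZ', epsInv_mem hodd hZ, by
    rwa [eps_epsInv hodd hZ']⟩

/-! ### The involution and its orbits -/

theorem mem_ES {σ : Sgn} {Z : Finset ℕ} :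
    Z ∈ ES N σ ↔ Z ∈ E N ∧ (N ∈ Z ↔ σ = Sgn.minus) := by
  cases σ <;> simp [ES]

theorem mem_symmDiff_Icc {Z : Finset ℕ} {x : ℕ} (h1 : 1 ≤ x) (h2 : x < N) :
    x ∈ Z ∆ Finset.Icc 1 (N - 1) ↔ x ∉ Z := by
  rw [Finset.mem_symmDiff, Finset.mem_Icc]
  have : 1 ≤ x ∧ x ≤ N - 1 := by omega
  tauto

theorem last_mem_symmDiff_Icc (hodd : Odd N) {Z : Finset ℕ} :
    N ∈ Z ∆ Finset.Icc 1 (N - 1) ↔ N ∈ Z := by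
  have := hodd.pos
  rw [Finset.mem_symmDiff, Finset.mem_Icc]
  have : ¬ (1 ≤ N ∧ N ≤ N - 1) := by omega
  tauto

theorem symmDiff_mem_ES (hodd : Odd N) {σ : Sgn} {Z : Finset ℕ} (hZ : Z ∈ ES N σ) :
    Z ∆ Finset.Icc 1 (N - 1) ∈ ES N σ := by
  rw [mem_ES, mem_E] at *
  refine ⟨⟨fun x hx => ?_, even_card_symmDiff hZ.1.2 ?_⟩, ?_⟩
  · rcases Finset.mem_symmDiff.1 hx with h | h
    · exact hZ.1.1 h.1
    · have := Finset.mem_Icc.1 h.1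
      exact Finset.mem_Icc.2 (by omega)
  · rw [Nat.card_Icc, Nat.add_sub_cancel]
    exact Nat.Odd.sub_odd hodd odd_one
  · rw [last_mem_symmDiff_Icc hodd]; exact hZ.2

/-- The involution complements within `[1,N-1]`, where the signs add up to 0; the point `N`, of sign
`-1`, counts for both sets. -/
theorem gam_symmDiff_Icc (hodd : Odd N) {Z : Finset ℕ} (hZ : Z ∈ E N) :
    gam (Z ∆ Finset.Icc 1 (N - 1)) = -gam Z - 2 * (if N ∈ Z then 1 else 0) := by
  have hZ' := (mem_E.1 hZ).1
  have hsub : Z ∆ Finset.Icc 1 (N - 1) ⊆ Finset.Icc 1 N := by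
    intro x hx
    rcases Finset.mem_symmDiff.1 hx with h | h
    · exact hZ' h.1
    · have := Finset.mem_Icc.1 h.1
      exact Finset.mem_Icc.2 (by omega)
  have ind : ∀ A ⊆ Finset.Icc 1 N, gam A = ∑ x ∈ Finset.Icc 1 N, if x ∈ A then sg 0 x else 0 := by
    intro A hA
    rw [← gamAt_zero hA, gamAt, ← Finset.sum_filter, Finset.filter_mem_eq_inter,
      Finset.inter_eq_right.2 hA]
  have hI : ∀ n, ∑ x ∈ Finset.Icc 1 n, sg 0 x = -((n % 2 : ℕ) : ℤ) := by
    intro n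
    induction n with
    | zero => simp
    | succ n ih =>
      rw [Finset.sum_Icc_succ_top (by omega), ih]
      have := sg_cases 0 (n + 1)
      omega
  have hlast := last_mem_symmDiff_Icc hodd (Z := Z)
  rw [ind _ hsub, ind _ hZ', eq_sub_iff_add_eq, eq_neg_iff_add_eq_zero]
  obtain ⟨n, rfl⟩ : ∃ n, N = n + 1 := ⟨N - 1, by have := hodd.pos; omega⟩
  rw [Finset.sum_Icc_succ_top (by omega), Finset.sum_Icc_succ_top (by omega)]
  have h1 : ∑ x ∈ Finset.Icc 1 n, (if x ∈ Z ∆ Finset.Icc 1 (n + 1 - 1) then sg 0 x else 0) +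
      ∑ x ∈ Finset.Icc 1 n, (if x ∈ Z then sg 0 x else 0) = 0 := by
    rw [← Finset.sum_add_distrib]
    rw [Finset.sum_congr rfl (g := fun x => sg 0 x), hI]
    · rw [Nat.odd_iff] at hodd; omega
    · intro x hx
      rw [Finset.mem_Icc] at hx
      simp only [mem_symmDiff_Icc hx.1 (by omega : x < n + 1)]
      split_ifs <;> simp_all
  have h2 := sg_cases 0 (n + 1)
  rw [Nat.odd_iff] at hodd
  simp only [hlast]
  split_ifs <;> omega

theorem even_gam {Z : Finset ℕ} (hZ : Z ∈ E N) : gam Z % 2 = 0 := by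
  rw [← gamAt_zero (mem_E.1 hZ).1, ← Int.even_iff]
  exact gamAt_even (mem_E.1 hZ).2 0

theorem mem_EPrime {σ : Sgn} {Z : Finset ℕ} (hZ : Z ∈ ES N σ) : Z ∈ EPrime N σ ↔
    (σ = Sgn.plus ∧ ((gam Z = 0 ∧ N - 1 ∉ Z) ∨ gam Z < 0)) ∨ (σ = Sgn.minus ∧ 0 ≤ gam Z) := by
  cases σ <;> simp only [EPrime, Finset.mem_filter, hZ, true_and, reduceCtorEq, false_and,
    or_false, false_or]

theorem EPrime_subset {σ : Sgn} {Z : Finset ℕ} (hZ : Z ∈ EPrime N σ) : Z ∈ ES N σ := by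
  cases σ <;> exact (Finset.mem_filter.1 hZ).1

/-- γ becomes `-γ`, resp. `-γ - 2`, and is even. Only `γ = 0` with sign + is ambiguous, and there `N
- 1` lies in exactly one of the two sets. -/
theorem mem_EPrime_iff_symmDiff (hN : 3 ≤ N) (hodd : Odd N) {σ : Sgn} {Z : Finset ℕ}
    (hZ : Z ∈ ES N σ) : Z ∈ EPrime N σ ↔ Z ∆ Finset.Icc 1 (N - 1) ∉ EPrime N σ := by
  have hE := mem_ES.1 hZ
  have h1 := gam_symmDiff_Icc hodd hE.1
  have h2 := even_gam hE.1
  have h3 := mem_symmDiff_Icc (N := N) (Z := Z) (x := N - 1) (by omega) (by omega)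
  rw [mem_EPrime hZ, mem_EPrime (symmDiff_mem_ES hodd hZ), h3]
  cases σ
  · rw [if_neg fun h => by simpa using hE.2.1 h] at h1
    simp only [reduceCtorEq, true_and, false_and, or_false]
    by_cases hz : N - 1 ∈ Z <;> simp only [hz, not_true, not_false_eq_true, and_true, and_false,
      false_or] <;> omega
  · rw [if_pos (hE.2.2 rfl)] at h1
    simp only [reduceCtorEq, true_and, false_and, false_or]
    omega

theorem height_symmDiff (hodd : Odd N) {σ : Sgn} {Z : Finset ℕ} (hZ : Z ∈ ES N σ) :
    height σ (Z ∆ Finset.Icc 1 (N - 1)) = height σ Z := by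
  have hE := mem_ES.1 hZ
  have h1 := gam_symmDiff_Icc hodd hE.1
  cases σ
  · rw [if_neg fun h => by simpa using hE.2.1 h] at h1
    rw [height, height, h1, ← abs_neg]; congr 1; ring
  · rw [if_pos (hE.2.2 rfl)] at h1
    rw [height, height, h1, ← abs_neg]; congr 1; ring

theorem fold_zero_cases {Z : Finset ℕ} (hZ : Z ∈ E N) :
    (0 ≤ gam Z ∧ fold 0 Z = gam Z) ∨ (gam Z < 0 ∧ fold 0 Z = -gam Z - 1) := by
  unfold fold
  rw [gamAt_zero (mem_E.1 hZ).1]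
  split_ifs <;> omega

/-- For sign + the height is `fold 0` rounded up to an even number, for sign - rounded up to an odd
number; both are monotone. -/
theorem height_le {σ : Sgn} {Z Z' : Finset ℕ} (hZ : Z ∈ E N) (hZ' : Z' ∈ E N)
    (h : fold 0 Z' ≤ fold 0 Z) : height σ Z' ≤ height σ Z := by
  have h1 := fold_zero_cases hZ
  have h2 := fold_zero_cases hZ'
  have h3 := even_gam hZ
  have h4 := even_gam hZ'
  cases σ <;> simp only [height] <;> rw [abs_le] <;>
    [rcases abs_cases (gam Z) with h5 | h5; rcases abs_cases (gam Z + 1) with h5 | h5] <;> omega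

theorem gamAt_eq_zero_of_fold {h : ℕ} {Z : Finset ℕ} (hZ : Z ∈ E N) (hf : fold h Z ≤ 0) :
    gamAt h Z = 0 := by
  have := gamAt_even (mem_E.1 hZ).2 h
  rw [Int.even_iff] at this
  unfold fold at hf
  split_ifs at hf <;> omega

/-- If `γ` vanishes and `N - 1`, `N` are not in the set, the last cuts have depth `0`. -/
theorem last_notMem_of_fold_le (hN : 3 ≤ N) (hodd : Odd N) {R Z : Finset ℕ} (hR : R ∈ E N)
    (hZ : Z ∈ E N) (hNR : N ∉ R) (hg : gam R = 0) (hR1 : N - 1 ∉ R)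
    (hle : ∀ h ≤ N, fold h Z ≤ fold h R) : N - 1 ∉ Z := by
  have e0 := gamAt_period hodd (mem_E.1 hR).1
  rw [gamAt_zero (mem_E.1 hR).1, hg] at e0
  have e1 := gamAt_succ (N - 1) R
  rw [Nat.sub_add_cancel (by omega), if_neg hNR, e0] at e1
  have e2 := gamAt_succ (N - 2) R
  rw [show N - 2 + 1 = N - 1 by omega, if_neg hR1] at e2
  have f1 : fold (N - 1) R = 0 := by unfold fold; split_ifs <;> omega
  have f2 : fold (N - 2) R = 0 := by unfold fold; split_ifs <;> omega
  have g1 := gamAt_eq_zero_of_fold hZ (f1 ▸ hle (N - 1) (by omega))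
  have g2 := gamAt_eq_zero_of_fold hZ (f2 ▸ hle (N - 2) (by omega))
  have e3 := gamAt_succ (N - 2) Z
  rw [show N - 2 + 1 = N - 1 by omega, g1, g2] at e3
  intro h
  rw [if_pos h] at e3
  omega

/-- If `γ(R) < 0` with sign +, the bound is `γ(Z) ≤ |γ(R)| - 1`. With sign -, it is `|γ(Z) + 1| ≤
γ(R)`, while `R` has height `γ(R) + 1`. If `γ(R) = 0` with sign +, the element `Z` would be a
representative. -/
theorem height_lt (hN : 3 ≤ N) (hodd : Odd N) {σ : Sgn} {R Z : Finset ℕ} (hR : R ∈ EPrime N σ)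
    (hZ : Z ∈ ES N σ) (hZ' : Z ∉ EPrime N σ) (h : Z ∈ span (epsInv N R)) :
    height σ Z < height σ R := by
  have hRS := EPrime_subset hR
  have hRE := mem_ES.1 hRS
  have hZE := mem_ES.1 hZ
  have hle := fold_le_of_mem_span_epsInv hodd hRE.1 h
  rw [mem_EPrime hRS] at hR
  rw [mem_EPrime hZ] at hZ'
  have h0 := hle 0 (by omega)
  have h1 := fold_zero_cases hRE.1
  have h2 := fold_zero_cases hZE.1
  have h3 := even_gam hRE.1
  have h4 := even_gam hZE.1
  cases σ
  · simp only [true_and, reduceCtorEq, false_and, or_false] at hR hZ'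
    have hNR : N ∉ R := fun h => by simpa using hRE.2.1 h
    rcases hR with ⟨hg, hn⟩ | hg
    · have hn' := last_notMem_of_fold_le hN hodd hRE.1 hZE.1 hNR hg hn hle
      have : gam Z = 0 := by omega
      exact absurd (Or.inl ⟨this, hn'⟩) hZ'
    · have : ¬ gam Z < 0 := fun h => hZ' (Or.inr h)
      simp only [height]
      rw [abs_of_neg hg, abs_of_nonneg (by omega)]
      omega
  · simp only [true_and, reduceCtorEq, false_and, false_or] at hR hZ'
    simp only [height]
    rw [abs_of_nonneg (by omega : 0 ≤ gam R + 1), abs_of_neg (by omega)]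
    omega

/-- If both sets lie in the span, every point of `[1,N-1]` is matched, so the free point is `N`. The
depth at the cut 0 then vanishes, so `γ(R) = 0` and the sign is +. Now `N - 1` is not in `R`, hence
in neither set, though it lies in one of them. -/
theorem not_both_mem_span (hN : 3 ≤ N) (hodd : Odd N) {σ : Sgn} {R W : Finset ℕ}
    (hR : R ∈ EPrime N σ) (hW : W ∈ ES N σ) (h1 : W ∈ span (epsInv N R))
    (h2 : W ∆ Finset.Icc 1 (N - 1) ∈ span (epsInv N R)) : False := by
  have hRS := EPrime_subset hR
  have hRE := mem_ES.1 hRS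
  have hle1 := fold_le_of_mem_span_epsInv hodd hRE.1 h1
  have hle2 := fold_le_of_mem_span_epsInv hodd hRE.1 h2
  obtain ⟨C, hC, he, hBC, hs⟩ := exists_arcSystem_of_mem_X' hodd (epsInv_mem hodd hRE.1)
  rw [eps_epsInv hodd hRE.1] at he hs
  have hspan : ∀ V ∈ span (epsInv N R), V ⊆ supp C := by
    intro V hV
    obtain ⟨D, hD, rfl⟩ := Finset.mem_image.1 (span_mono hBC hV)
    rw [Finset.mem_powerset] at hD
    rw [(hC.matching.mono hD).fsum_pairSet]
    exact Finset.biUnion_subset_biUnion_of_subset_left _ hD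
  have hlast : N ∉ supp C := by
    intro hNC
    obtain ⟨x, hx, hx'⟩ := hC.matching.exists_notMem_supp hodd
    by_cases hxN : x + 1 = N
    · exact hx' (hxN ▸ hNC)
    · have := mem_symmDiff_Icc (N := N) (Z := W) (x := x + 1) (by omega) (by omega)
      by_cases hxW : x + 1 ∈ W
      · exact hx' (hspan _ h1 hxW)
      · exact hx' (hspan _ h2 (this.2 hxW))
  have hNR : N ∉ R := fun h => hlast (hspan _ hs h)
  have hd : depth C 0 = 0 := by
    have := hC.filled.depth_eq_zero (h := N - 1) (by omega) (by
      rwa [Nat.sub_add_cancel (by omega)])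
    rw [Nat.sub_add_cancel (by omega)] at this
    rw [← hC.matching.depth_period, this.2]
  have hg : gam R = 0 := by
    rw [← gamAt_zero (mem_E.1 hRE.1).1]
    refine gamAt_eq_zero_of_fold hRE.1 ?_
    rw [← he, hC.filled.fold_fsum_dbl hodd 0 (by omega), hd]
  rw [mem_EPrime hRS] at hR
  cases σ
  · simp only [true_and, reduceCtorEq, false_and, or_false] at hR
    have hR1 : N - 1 ∉ R := by
      rcases hR with h | h
      · exact h.2
      · omega
    have a := last_notMem_of_fold_le hN hodd hRE.1 (mem_ES.1 hW).1 hNR hg hR1 hle1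
    have b := last_notMem_of_fold_le hN hodd hRE.1 (mem_ES.1 (symmDiff_mem_ES hodd hW)).1 hNR hg
      hR1 hle2
    rw [mem_symmDiff_Icc (by omega) (by omega)] at b
    exact b a
  · exact hNR (hRE.2.2 rfl)

/-! ### Representatives -/

theorem eq_pair_of_mem {σ : Sgn} {Y : EBar N σ} {W : Finset ℕ} (hW : W ∈ Y.1) :
    Y.1 = {W, W ∆ Finset.Icc 1 (N - 1)} := by
  obtain ⟨Z, hZ, hY⟩ := Finset.mem_image.1 Y.2
  rw [← hY] at hW ⊢
  rcases Finset.mem_insert.1 hW with rfl | h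
  · rfl
  · rw [Finset.mem_singleton] at h
    rw [h, symmDiff_symmDiff_cancel_right, Finset.pair_comm]

theorem existsUnique_rep (hN : 3 ≤ N) (hodd : Odd N) {σ : Sgn} (Y : EBar N σ) :
    ∃! Z, Z ∈ Y.1 ∧ Z ∈ EPrime N σ := by
  obtain ⟨Z, hZ, hY⟩ := Finset.mem_image.1 Y.2
  have h := mem_EPrime_iff_symmDiff hN hodd hZ
  rw [← hY]
  by_cases hp : Z ∈ EPrime N σ
  · refine ⟨Z, ⟨Finset.mem_insert_self _ _, hp⟩, fun W hW => ?_⟩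
    rcases Finset.mem_insert.1 hW.1 with hW' | hW'
    · exact hW'
    · rw [Finset.mem_singleton] at hW'
      exact absurd (hW' ▸ hW.2) (h.1 hp)
  · refine ⟨Z ∆ Finset.Icc 1 (N - 1), ⟨by simp, not_not.1 (mt h.2 hp)⟩, fun W hW => ?_⟩
    rcases Finset.mem_insert.1 hW.1 with hW' | hW'
    · exact absurd (hW' ▸ hW.2) hp
    · exact Finset.mem_singleton.1 hW'

theorem rep_spec (hN : 3 ≤ N) (hodd : Odd N) {σ : Sgn} (Y : EBar N σ) :
    rep N σ Y ∈ Y.1 ∧ rep N σ Y ∈ EPrime N σ :=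
  Classical.epsilon_spec (existsUnique_rep hN hodd Y).exists

theorem rep_mem_E (hN : 3 ≤ N) (hodd : Odd N) {σ : Sgn} (Y : EBar N σ) : rep N σ Y ∈ E N :=
  (mem_ES.1 (EPrime_subset (rep_spec hN hodd Y).2)).1

theorem rep_injective (hN : 3 ≤ N) (hodd : Odd N) {σ : Sgn} :
    Function.Injective (rep N σ) := by
  intro Y Y' h
  apply Subtype.ext
  rw [eq_pair_of_mem (rep_spec hN hodd Y).1, eq_pair_of_mem (rep_spec hN hodd Y').1, h]

/-- Each link raises the height, or keeps it and raises the walk weakly at every cut. A cycle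
therefore has constant walk, and the walk determines the representative. -/
theorem isPartialOrder_precBar (hN : 3 ≤ N) (hodd : Odd N) (σ : Sgn) :
    IsPartialOrder (EBar N σ) (PrecBar N σ) := by
  have key : ∀ Y' Y, PrecBar N σ Y' Y →
      height σ (rep N σ Y') < height σ (rep N σ Y) ∨
        (height σ (rep N σ Y') = height σ (rep N σ Y) ∧
          ∀ h ≤ N, fold h (rep N σ Y') ≤ fold h (rep N σ Y)) := by
    intro Y' Y h
    induction h with
    | refl => exact Or.inr ⟨rfl, fun _ _ => le_rfl⟩
    | @tail Y₁ Y₂ _ h ih =>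
      rcases h with h | h
      · have hf := h.fold_le hodd (rep_mem_E hN hodd Y₂) (rep_mem_E hN hodd Y₁)
        have hh := height_le (σ := σ) (rep_mem_E hN hodd Y₂) (rep_mem_E hN hodd Y₁)
          (hf 0 (by omega))
        rcases ih with ih | ih
        · exact Or.inl (by omega)
        · rcases hh.lt_or_eq with hlt | heq
          · exact Or.inl (by omega)
          · exact Or.inr ⟨by omega, fun k hk => (ih.2 k hk).trans (hf k hk)⟩
      · exact Or.inl (by omega)
  refine { refl := fun Y => Relation.ReflTransGen.refl
           trans := fun _ _ _ => Relation.ReflTransGen.trans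
           antisymm := fun Y' Y h h' => ?_ }
  have h1 := key _ _ h
  have h2 := key _ _ h'
  apply rep_injective hN hodd
  refine eq_of_fold_eq (rep_mem_E hN hodd Y') (rep_mem_E hN hodd Y) fun k hk => ?_
  rcases h1 with h1 | h1 <;> rcases h2 with h2 | h2
  · omega
  · omega
  · omega
  · exact le_antisymm (h1.2 k hk) (h2.2 k hk)

/-! ### The unitriangular matrix and the basis. -/

theorem cPrime_eq (Z' Z : Finset ℕ) : (cPrime N Z' Z = 1 ∧ Z' ∈ span (epsInv N Z)) ∨
    (cPrime N Z' Z = 0 ∧ Z' ∉ span (epsInv N Z)) := by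
  unfold cPrime
  split_ifs with h
  · exact Or.inl ⟨rfl, h⟩
  · exact Or.inr ⟨rfl, h⟩

theorem cBar_eq (hN : 3 ≤ N) (hodd : Odd N) {σ : Sgn} (Y' Y : EBar N σ) :
    cBar N σ Y' Y = cPrime N (rep N σ Y') (rep N σ Y) +
      cPrime N (rep N σ Y' ∆ Finset.Icc 1 (N - 1)) (rep N σ Y) := by
  have h : rep N σ Y' ≠ rep N σ Y' ∆ Finset.Icc 1 (N - 1) := by
    intro h
    have := mem_symmDiff_Icc (N := N) (Z := rep N σ Y') (x := 1) le_rfl (by omega)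
    rw [← h] at this
    tauto
  rw [cBar, eq_pair_of_mem (rep_spec hN hodd Y').1, Finset.sum_pair h]

theorem cBar_eq_zero_or_one (hN : 3 ≤ N) (hodd : Odd N) {σ : Sgn} (Y' Y : EBar N σ) :
    cBar N σ Y' Y = 0 ∨ cBar N σ Y' Y = 1 := by
  have h := not_both_mem_span hN hodd (rep_spec hN hodd Y).2
    (EPrime_subset (rep_spec hN hodd Y').2)
  rw [cBar_eq hN hodd]
  rcases cPrime_eq (N := N) (rep N σ Y') (rep N σ Y) with h1 | h1 <;>
    rcases cPrime_eq (N := N) (rep N σ Y' ∆ Finset.Icc 1 (N - 1)) (rep N σ Y) with h2 | h2 <;>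
    rw [h1.1, h2.1]
  · exact (h h1.2 h2.2).elim
  · exact Or.inr rfl
  · exact Or.inr rfl
  · exact Or.inl rfl

/-- A nonzero entry comes from the representative of `Y'`, giving a link by ⪯, or from the other
element, giving a link by height. -/
theorem precBar_of_cBar_ne_zero (hN : 3 ≤ N) (hodd : Odd N) {σ : Sgn} {Y' Y : EBar N σ}
    (h : cBar N σ Y' Y ≠ 0) : PrecBar N σ Y' Y := by
  have hS' := (rep_spec hN hodd Y').2
  have hS := EPrime_subset hS'
  refine Relation.ReflTransGen.single ?_
  rw [cBar_eq hN hodd] at h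
  rcases cPrime_eq (N := N) (rep N σ Y') (rep N σ Y) with h1 | h1
  · exact Or.inl (Prec.of_mem_span hodd (rep_mem_E hN hodd Y) (rep_mem_E hN hodd Y') h1.2)
  · rcases cPrime_eq (N := N) (rep N σ Y' ∆ Finset.Icc 1 (N - 1)) (rep N σ Y) with h2 | h2
    · right
      rw [← height_symmDiff hodd hS]
      exact height_lt hN hodd (rep_spec hN hodd Y).2 (symmDiff_mem_ES hodd hS)
        ((mem_EPrime_iff_symmDiff hN hodd hS).1 hS') h2.2
    · rw [h1.1, h2.1] at h
      exact absurd rfl h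

theorem cBar_self (hN : 3 ≤ N) (hodd : Odd N) {σ : Sgn} (Y : EBar N σ) : cBar N σ Y Y = 1 := by
  have h := not_both_mem_span hN hodd (rep_spec hN hodd Y).2
    (EPrime_subset (rep_spec hN hodd Y).2) (self_mem_span hodd (rep_mem_E hN hodd Y))
  rw [cBar_eq hN hodd, cPrime, cPrime, if_pos (self_mem_span hodd (rep_mem_E hN hodd Y)),
    if_neg h, add_zero]

/-- A unitriangular family of functions is a basis. -/
theorem exists_basis_of_unitriangular {α : Type*} [Fintype α] [DecidableEq α] (r : α → α → Prop)
    [hr : IsPartialOrder α r] (M : α → α → ℤ) (h1 : ∀ a, M a a = 1)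
    (h2 : ∀ a b, M a b ≠ 0 → r a b) :
    ∃ b : Module.Basis α ℤ (α → ℤ), ∀ a, b a = fun a' => M a' a := by
  -- Along a linear extension of `r` the matrix is upper triangular with diagonal 1.
  obtain ⟨s, hs, hle⟩ := extend_partialOrder r
  let _ : LinearOrder α :=
    { le := s
      le_refl := hs.refl
      le_trans := hs.trans
      le_antisymm := hs.antisymm
      le_total := hs.total
      toDecidableLE := Classical.decRel _
      toDecidableEq := ‹DecidableEq α› }
  have hA : (Matrix.of M).BlockTriangular id := by
    intro a b hab
    by_contra hne
    have : a ≤ b := hle a b (h2 a b hne)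
    exact absurd hab this.not_gt
  have hdet : Matrix.det (Matrix.of M) = 1 := by
    rw [Matrix.det_of_isUpperTriangular hA]
    exact Finset.prod_eq_one fun a _ => h1 a
  have hb := (Module.Basis.is_basis_iff_det (Pi.basisFun ℤ α) (v := fun a a' => M a' a)).2 (by
    have : (Pi.basisFun ℤ α).toMatrix (fun a a' => M a' a) = Matrix.of M := by
      ext i j; simp [Module.Basis.toMatrix_apply]
    rw [Module.Basis.det_apply, this, hdet]
    exact isUnit_one)
  exact ⟨Module.Basis.mk hb.1 hb.2.ge, fun a => by rw [Module.Basis.mk_apply]⟩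

theorem psiTilde_apply {σ : Sgn} (Y : EBar N σ) :
    psiTilde N σ Y = fun Y' => cBar N σ Y' Y := by
  funext Y'
  simp only [psiTilde, psi, Finset.sum_apply, Pi.smul_apply, smul_eq_mul]
  rw [Finset.sum_eq_single Y']
  · rw [Pi.single_eq_same, mul_one]
  · intro b _ hb
    rw [Pi.single_eq_of_ne hb.symm, mul_zero]
  · exact fun h => absurd (Finset.mem_univ _) h

end Lusztig

theorem mainTheorem4 (N : ℕ) (hN : 3 ≤ N) (hodd : Odd N) :
    -- the notions are well defined
    Set.BijOn (Lusztig.eps N) (Lusztig.X N : Set (Finset (ℕ × ℕ)))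
      (Lusztig.E N : Set (Finset ℕ)) ∧
    ∀ σ : Lusztig.Sgn,
      (∀ Y : Lusztig.EBar N σ, ∃! Z, Z ∈ Y.1 ∧ Z ∈ Lusztig.EPrime N σ) ∧
      IsPartialOrder (Lusztig.EBar N σ) (Lusztig.PrecBar N σ) ∧
      -- the matrix is unitriangular with entries `0` and `1`
      (∀ Y' Y : Lusztig.EBar N σ, Lusztig.cBar N σ Y' Y = 0 ∨ Lusztig.cBar N σ Y' Y = 1) ∧
      (∀ Y' Y : Lusztig.EBar N σ, Lusztig.cBar N σ Y' Y ≠ 0 → Lusztig.PrecBar N σ Y' Y) ∧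
      (∀ Y : Lusztig.EBar N σ, Lusztig.cBar N σ Y Y = 1) ∧
      -- the elements `ψ̃_Y` form a `ℤ`-basis
      (∃ b : Module.Basis (Lusztig.EBar N σ) ℤ (Lusztig.EBar N σ → ℤ),
        ∀ Y : Lusztig.EBar N σ, b Y = Lusztig.psiTilde N σ Y) := by
  refine ⟨Lusztig.bijOn_eps hodd, fun σ => ⟨Lusztig.existsUnique_rep hN hodd,
    Lusztig.isPartialOrder_precBar hN hodd σ, Lusztig.cBar_eq_zero_or_one hN hodd,
    fun _ _ => Lusztig.precBar_of_cBar_ne_zero hN hodd, Lusztig.cBar_self hN hodd, ?_⟩⟩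
  have := Lusztig.isPartialOrder_precBar hN hodd σ
  obtain ⟨b, hb⟩ := Lusztig.exists_basis_of_unitriangular (Lusztig.PrecBar N σ)
    (Lusztig.cBar N σ) (Lusztig.cBar_self hN hodd)
    (fun _ _ => Lusztig.precBar_of_cBar_ne_zero hN hodd)
  exact ⟨b, fun Y => by rw [hb, Lusztig.psiTilde_apply]⟩
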